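/- Let $N>1$ be an integer. A generalized ring is a commutative algebraic monad $M$ on the category of sets (determined by the sets $M(\mathbf n)$, $n\ge 0$, with their units and substitution operations); its modules are the algebras of the monad. A prime ideal of $M$ is an $M$-submodule of $M(\mathbf 1)$ whose complement is a multiplicative system, and $\operatorname{Spec} M$ is the space of prime ideals with the Zariski topology and the sheaf of generalized rings determined by $D_m\mapsto M[m^{-1}]$, $m\in M(\mathbf 1)$. A commutative ring $R$ is regarded as the generalized ring $\mathbf n\mapsto R^n$. Let $A_N$ be the generalized ring $A_N(\mathbf n)=\{\lambda\in\mathbb Z[N^{-1}]^n:\sum_i|\lambda_i|\le 1\}$, and let $$X=\widehat{\operatorname{Spec}\mathbb Z^N}=\operatorname{Spec}A_N\coprod_{\operatorname{Spec}\mathbb Z[N^{-1}]}\operatorname{Spec}\mathbb Z$$ be the generalized scheme obtained by gluing along the common open subset $\operatorname{Spec}\mathbb Z[N^{-1}]$. A vector bundle of rank $r$ on $X$ is a sheaf of $\mathcal O_X$-modules that is locally isomorphic to $\mathcal O_X(\mathbf r)$; a line bundle is a vector bundle of rank $1$; $\operatorname{Pic}(X)$ is the set of isomorphism classes of line bundles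 with the operation given by the tensor product of $\mathcal O_X$-modules (the target of the universal bilinear map). For $r\ge 0$ let $\mathrm{Oct}_r\subset \mathrm{GL}_r(\mathbb Z[N^{-1}])$ be the group of linear symmetries of the octahedron $\{x\in\mathbb R^r:\sum_i|x_i|\le1\}$. Say that $A=(a_{ij})\in \mathrm{GL}_r(\mathbb Z[N^{-1}])$ describes a vector bundle $\mathcal E$ of rank $r$ on $X$ if there are a basis $(e_i)$ of $\mathcal E$ over $\operatorname{Spec}A_N$ and a basis $(f_j)$ of $\mathcal E$ over $\operatorname{Spec}\mathbb Z$ with $e_i=\sum_j a_{ij}f_j$ over $\operatorname{Spec}\mathbb Z[N^{-1}]$. Then for every $r$ there is a bijection from the set of isomorphism classes of vector bundles of rank $r$ on $X$ to the set of double cosets $$\mathrm{Oct}_r\backslash \mathrm{GL}_r(\mathbb Z[N^{-1}])/\mathrm{GL}_r(\mathbb Z),$$ under which the class of $\mathcal E$ corresponds to the double coset of $A$ if and only if $A$ describes $\mathcal E$. In particular, any two line bundles on $X$ have a tensor product, which is again a line bundle, the tensor product makes $\operatorname{Pic}(X)$ an abelian group, and $$\operatorname{Pic}(X)\cong\{\pm1\}\backslash\mathbb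 Z[N^{-1}]^*/\{\pm1\}\cong\log\mathbb Z[N^{-1}]^*_+,$$ where $\log\mathbb Z[N^{-1}]^*_+$ is the multiplicative group of positive units of $\mathbb Z[N^{-1}]$ written additively: the first bijection sends a line bundle to the double coset of any unit $\lambda$ that describes it, the second sends the double coset of $\lambda$ to $\log|\lambda|$, and the composite is an isomorphism of groups. -/

import Mathlib

open TopologicalSpace

noncomputable section

/-! ### Generalized rings (commutative algebraic monads on sets) -/

/-- A generalized ring, i.e. a commutative algebraic monad `M` on the category of sets.
An algebraic monad commutes with filtered colimits, hence is the same thing as its values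
`M(𝐧)` on the finite sets `𝐧 = Fin n` (`op n`), the unit `𝐧 → M(𝐧)` (`var`) and the
Kleisli composition `M(𝐧) × M(𝐦)ⁿ → M(𝐦)` (`subst`), subject to the monad laws.
The axiom `comm` says that any two operations commute. -/
structure GenRing where
  op : ℕ → Type
  var : {n : ℕ} → Fin n → op n
  subst : {n m : ℕ} → op n → (Fin n → op m) → op m
  var_subst : ∀ {n m : ℕ} (i : Fin n) (x : Fin n → op m), subst (var i) x = x i
  subst_var : ∀ {n : ℕ} (t : op n), subst t var = t
  subst_assoc : ∀ {n m k : ℕ} (t : op n) (x : Fin n → op m) (y : Fin m → op k),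
    subst (subst t x) y = subst t (fun i => subst (x i) y)
  comm : ∀ {n m k : ℕ} (t : op n) (s : op m) (x : Fin n → Fin m → op k),
    subst t (fun i => subst s (x i)) = subst s (fun j => subst t (fun i => x i j))

namespace GenRing

/-- Morphisms of generalized rings (morphisms of monads). -/
structure Hom (M M' : GenRing) where
  app : {n : ℕ} → M.op n → M'.op n
  map_var : ∀ {n : ℕ} (i : Fin n), app (M.var i) = M'.var i
  map_subst : ∀ {n m : ℕ} (t : M.op n) (x : Fin n → M.op m),
    app (M.subst t x) = M'.subst (app t) (fun i => app (x i))

/-- Modules over a generalized ring: algebras `M(X) → X` of the monad, given by the action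
`M(𝐧) × Xⁿ → X` of the `n`-ary operations. -/
structure ModuleStr (M : GenRing) (X : Type) where
  act : {n : ℕ} → M.op n → (Fin n → X) → X
  var_act : ∀ {n : ℕ} (i : Fin n) (x : Fin n → X), act (M.var i) x = x i
  act_assoc : ∀ {n m : ℕ} (t : M.op n) (s : Fin n → M.op m) (x : Fin m → X),
    act (M.subst t s) x = act t (fun i => act (s i) x)

/-- The generalized ring `M_R`, `M_R(𝐧) = Rⁿ`, of a commutative ring `R`. -/
def ofRing (R : Type) [CommRing R] : GenRing where
  op n := Fin n → R
  var i := Pi.single i 1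
  subst t x := fun j => ∑ i, t i * x i j
  var_subst i x := by ext j; simp [Pi.single_apply]
  subst_var t := by ext j; simp [Pi.single_apply]
  subst_assoc t x y := by
    ext j
    simp only [Finset.sum_mul, Finset.mul_sum]
    rw [Finset.sum_comm]
    simp only [mul_assoc]
  comm t s x := by
    ext j
    simp only [Finset.mul_sum]
    rw [Finset.sum_comm]
    simp only [mul_left_comm]

/-- The morphism `M_R → M_R'` induced by a ring homomorphism. -/
def ofRingHom {R R' : Type} [CommRing R] [CommRing R'] (f : R →+* R') :
    Hom (ofRing R) (ofRing R') where
  app t := fun i => f (t i)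
  map_var i := by
    funext j
    simp [ofRing, Pi.single_apply, apply_ite f]
  map_subst t x := by
    funext j
    simp [ofRing]

variable (M : GenRing)

/-- The multiplicative monoid `M(𝟏)`. -/
instance : CommMonoid (M.op 1) where
  one := M.var 0
  mul a b := M.subst a (fun _ => b)
  mul_assoc a b c := M.subst_assoc a (fun _ => b) (fun _ => c)
  one_mul a := M.var_subst 0 (fun _ => a)
  mul_one a := by
    have h : (fun _ : Fin 1 => M.var (0 : Fin 1)) = M.var := by
      funext i; rw [Subsingleton.elim i 0]
    change M.subst a (fun _ => M.var 0) = a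
    rw [h, M.subst_var]
  mul_comm a b := by
    have h : (fun _ : Fin 1 => M.var (0 : Fin 1)) = M.var := by
      funext i; rw [Subsingleton.elim i 0]
    have := M.comm a b (fun _ _ => M.var (0 : Fin 1))
    rw [h, M.subst_var, M.subst_var] at this
    exact this

/-- The action of `M(𝟏)` on `M(𝐧)`. -/
def scale {n : ℕ} (a : M.op 1) (t : M.op n) : M.op n := M.subst a (fun _ => t)

variable {M}

lemma one_scale {n : ℕ} (t : M.op n) : M.scale 1 t = t := M.var_subst 0 (fun _ => t)

lemma mul_scale {n : ℕ} (a b : M.op 1) (t : M.op n) :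
    M.scale (a * b) t = M.scale a (M.scale b t) :=
  M.subst_assoc a (fun _ => b) (fun _ => t)

lemma scale_subst_left {n m : ℕ} (c : M.op 1) (a : M.op n) (b : Fin n → M.op m) :
    M.scale c (M.subst a b) = M.subst (M.scale c a) b :=
  (M.subst_assoc c (fun _ => a) b).symm

lemma scale_subst_right {n m : ℕ} (c : M.op 1) (a : M.op n) (b : Fin n → M.op m) :
    M.scale c (M.subst a b) = M.subst a (fun i => M.scale c (b i)) :=
  M.comm c a (fun _ => b)

lemma mul_scale_subst {n m : ℕ} (c d : M.op 1) (a : M.op n) (b : Fin n → M.op m) :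
    M.scale (c * d) (M.subst a b) = M.subst (M.scale c a) (fun i => M.scale d (b i)) := by
  rw [mul_scale, scale_subst_right, scale_subst_left]

lemma Hom.map_one {M' : GenRing} (f : Hom M M') : f.app (1 : M.op 1) = 1 := f.map_var 0

lemma Hom.map_mul {M' : GenRing} (f : Hom M M') (a b : M.op 1) :
    f.app (a * b) = f.app a * f.app b := f.map_subst a (fun _ => b)

lemma Hom.map_scale {M' : GenRing} (f : Hom M M') {n : ℕ} (a : M.op 1) (t : M.op n) :
    f.app (M.scale a t) = M'.scale (f.app a) (f.app t) := f.map_subst a (fun _ => t)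

/-! ### Localization -/

/-- Equality of fractions: `(a, s) ∼ (b, t)` iff `u t a = u s b` for some `u ∈ S`. -/
def fracSetoid (M : GenRing) (S : Submonoid (M.op 1)) (n : ℕ) : Setoid (M.op n × S) where
  r p q := ∃ u : S, M.scale (u * q.2 : M.op 1) p.1 = M.scale (u * p.2 : M.op 1) q.1
  iseqv :=
    { refl := fun _ => ⟨1, rfl⟩
      symm := fun ⟨u, h⟩ => ⟨u, h.symm⟩
      trans := by
        rintro ⟨a, s⟩ ⟨b, t⟩ ⟨c, r⟩ ⟨u, h⟩ ⟨v, k⟩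
        refine ⟨u * v * t, ?_⟩
        dsimp only at h k ⊢
        have h' := congrArg (M.scale (v * r : M.op 1)) h
        have k' := congrArg (M.scale (u * s : M.op 1)) k
        simp only [← mul_scale] at h' k'
        push_cast
        rw [show (u * v * t * r : M.op 1) = v * r * (u * t) by ac_rfl, h',
          show (v * r * (u * s) : M.op 1) = u * s * (v * r) by ac_rfl, k']
        congr 1
        ac_rfl }

/-- `M[S⁻¹](𝐧)`. -/
def Frac (M : GenRing) (S : Submonoid (M.op 1)) (n : ℕ) : Type := Quotient (fracSetoid M S n)

/-- The fraction `a / s`. -/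
def frac {S : Submonoid (M.op 1)} {n : ℕ} (a : M.op n) (s : S) : Frac M S n :=
  Quotient.mk (fracSetoid M S n) (a, s)

section
variable {S : Submonoid (M.op 1)}

lemma frac_eq {n : ℕ} {a b : M.op n} {s t : S} :
    frac a s = frac b t ↔
      ∃ u : S, M.scale (u * t : M.op 1) a = M.scale (u * s : M.op 1) b :=
  Quotient.eq (r := fracSetoid M S n)

lemma frac_scale {n : ℕ} (c : S) (a : M.op n) (s : S) :
    frac (M.scale c a) (c * s) = frac a s := by
  rw [frac_eq]
  refine ⟨1, ?_⟩
  rw [← mul_scale]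
  congr 1
  push_cast
  ac_rfl

lemma exists_frac {n : ℕ} (q : Frac M S n) : ∃ (a : M.op n) (s : S), q = frac a s := by
  induction q using Quotient.inductionOn with
  | h p => exact ⟨p.1, p.2, rfl⟩

/-- Finitely many fractions have a common denominator. -/
lemma exists_common {n m : ℕ} (x : Fin n → Frac M S m) :
    ∃ (b : Fin n → M.op m) (t : S), x = fun i => frac (b i) t := by
  choose a s h using fun i => exists_frac (x i)
  refine ⟨fun i => M.scale ((∏ j ∈ Finset.univ.erase i, s j : S) : M.op 1) (a i),
    ∏ j, s j, funext fun i => ?_⟩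
  rw [h i, ← Finset.prod_erase_mul Finset.univ s (Finset.mem_univ i), frac_scale]

/-- Substitution of fractions, `(a/s)(b₁/t, …, bₙ/t) = a(b₁, …, bₙ)/(s t)`. -/
def fracSubst {n m : ℕ} (q : Frac M S n) (x : Fin n → Frac M S m) : Frac M S m :=
  frac (M.subst (exists_frac q).choose (exists_common x).choose)
    ((exists_frac q).choose_spec.choose * (exists_common x).choose_spec.choose)

lemma fracSubst_frac {n m : ℕ} (a : M.op n) (s : S) (b : Fin n → M.op m) (t : S) :
    fracSubst (frac a s) (fun i => frac (b i) t) = frac (M.subst a b) (s * t) := by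
  unfold fracSubst
  have h1 := (exists_frac (frac a s)).choose_spec.choose_spec
  have h2 := (exists_common (fun i => frac (b i) t)).choose_spec.choose_spec
  generalize (exists_frac (frac a s)).choose_spec.choose = s' at *
  generalize (exists_frac (frac a s)).choose = a' at *
  generalize (exists_common (fun i => frac (b i) t)).choose_spec.choose = t' at *
  generalize (exists_common (fun i => frac (b i) t)).choose = b' at *
  obtain ⟨u, hu⟩ := frac_eq.1 h1
  choose v hv using fun i => frac_eq.1 (congrFun h2 i)
  have hw : ∀ i, M.scale ((∏ j, v j : S) * t' : M.op 1) (b i) =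
      M.scale ((∏ j, v j : S) * t : M.op 1) (b' i) := by
    intro i
    have := congrArg (M.scale ((∏ j ∈ Finset.univ.erase i, v j : S) : M.op 1)) (hv i)
    rw [← mul_scale, ← mul_scale, ← mul_assoc, ← mul_assoc] at this
    rw [← Finset.prod_erase_mul Finset.univ v (Finset.mem_univ i)]
    exact this
  symm
  rw [frac_eq]
  refine ⟨u * ∏ j, v j, ?_⟩
  rw [show ((u * ∏ j, v j : S) * (s' * t' : S) : M.op 1) = (u * s') * ((∏ j, v j : S) * t') by
      push_cast; ac_rfl,
    show ((u * ∏ j, v j : S) * (s * t : S) : M.op 1) = (u * s) * ((∏ j, v j : S) * t) by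
      push_cast; ac_rfl, mul_scale_subst, mul_scale_subst, hu]
  congr 1
  exact funext hw

end

/-- The localization `M[S⁻¹]`. -/
def localization (M : GenRing) (S : Submonoid (M.op 1)) : GenRing where
  op := Frac M S
  var i := frac (M.var i) 1
  subst := fracSubst
  var_subst i x := by
    obtain ⟨b, t, rfl⟩ := exists_common x
    rw [fracSubst_frac, M.var_subst, one_mul]
  subst_var q := by
    obtain ⟨a, s, rfl⟩ := exists_frac q
    rw [fracSubst_frac, mul_one]
    exact congrArg (frac · s) (M.subst_var a)
  subst_assoc q x y := by
    obtain ⟨a, s, rfl⟩ := exists_frac q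
    obtain ⟨b, t, rfl⟩ := exists_common x
    obtain ⟨c, r, rfl⟩ := exists_common y
    simp only [fracSubst_frac, M.subst_assoc, mul_assoc]
  comm {n m k} q p x := by
    obtain ⟨a, s, rfl⟩ := exists_frac q
    obtain ⟨c, r, rfl⟩ := exists_frac p
    obtain ⟨b, t, h⟩ := exists_common (fun i : Fin (n * m) =>
      x (finProdFinEquiv.symm i).1 (finProdFinEquiv.symm i).2)
    obtain rfl : x = fun i j => frac (b (finProdFinEquiv (i, j))) t := by
      funext i j
      have := congrFun h (finProdFinEquiv (i, j))
      simpa using this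
    simp only [fracSubst_frac, M.comm a c]
    rw [mul_left_comm]

/-- A morphism `f : M → M'` with `f(S) ⊆ S'` induces `M[S⁻¹] → M'[S'⁻¹]`. -/
def Hom.localize {M' : GenRing} (f : Hom M M') (S : Submonoid (M.op 1))
    (S' : Submonoid (M'.op 1)) (h : ∀ s ∈ S, f.app s ∈ S') :
    Hom (M.localization S) (M'.localization S') where
  app {n} := Quotient.map' (s₁ := fracSetoid M S n) (s₂ := fracSetoid M' S' n)
    (fun p => (f.app p.1, ⟨f.app p.2, h _ p.2.2⟩)) (by
      rintro ⟨a, s⟩ ⟨b, t⟩ ⟨u, hu⟩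
      refine ⟨⟨f.app u, h _ u.2⟩, ?_⟩
      have := congrArg f.app hu
      simpa only [f.map_scale, f.map_mul] using this)
  map_var i := by
    change frac (f.app (M.var i)) (⟨f.app (1 : M.op 1), _⟩ : S') = frac (M'.var i) 1
    rw [f.map_var]
    exact congrArg (frac _) (Subtype.ext f.map_one)
  map_subst q x := by
    obtain ⟨a, s, rfl⟩ := exists_frac q
    obtain ⟨b, t, rfl⟩ := exists_common x
    change Quotient.map' _ _ (fracSubst _ _) =
      fracSubst (frac (f.app a) (⟨f.app s, h _ s.2⟩ : S'))
        (fun i => frac (f.app (b i)) (⟨f.app t, h _ t.2⟩ : S'))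
    rw [fracSubst_frac, fracSubst_frac]
    change frac (f.app (M.subst a b)) (⟨f.app (s * t : M.op 1), _⟩ : S') = _
    rw [f.map_subst]
    exact congrArg (frac _) (Subtype.ext (f.map_mul _ _))

/-! ### The prime spectrum -/

/-- Prime ideals of `M`: `M`-submodules of `M(𝟏)` whose complement is a multiplicative
system. -/
@[ext]
structure PrimeSpec (M : GenRing) where
  carrier : Set (M.op 1)
  subst_mem : ∀ {n : ℕ} (t : M.op n) (x : Fin n → M.op 1),
    (∀ i, x i ∈ carrier) → M.subst t x ∈ carrier
  one_notMem : (1 : M.op 1) ∉ carrier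
  mul_notMem : ∀ a b : M.op 1, a ∉ carrier → b ∉ carrier → a * b ∉ carrier

namespace PrimeSpec

/-- The multiplicative system `M(𝟏) ∖ 𝔭`. -/
def compl (p : PrimeSpec M) : Submonoid (M.op 1) where
  carrier := p.carrierᶜ
  one_mem' := p.one_notMem
  mul_mem' ha hb := p.mul_notMem _ _ ha hb

/-- The basic open set `D_m`. -/
def basicOpen (m : M.op 1) : Set (PrimeSpec M) := {p | m ∉ p.carrier}

/-- The Zariski topology. -/
instance : TopologicalSpace (PrimeSpec M) := generateFrom (Set.range basicOpen)

/-- The map `Spec M' → Spec M` induced by `f : M → M'`. -/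
def comap {M' : GenRing} (f : Hom M M') (p : PrimeSpec M') : PrimeSpec M where
  carrier := {a | f.app a ∈ p.carrier}
  subst_mem t x hx := by
    change f.app (M.subst t x) ∈ p.carrier
    rw [f.map_subst]
    exact p.subst_mem _ _ hx
  one_notMem := by
    change f.app (1 : M.op 1) ∉ p.carrier
    rw [f.map_one]
    exact p.one_notMem
  mul_notMem a b ha hb := by
    change f.app (a * b) ∉ p.carrier
    rw [f.map_mul]
    exact p.mul_notMem _ _ ha hb

/-- The stalk `M_𝔭`. -/
def stalk (p : PrimeSpec M) : GenRing := M.localization p.compl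

/-- The map of stalks `M_{f⁻¹(𝔭)} → M'_𝔭`. -/
def stalkMap {M' : GenRing} (f : Hom M M') (p : PrimeSpec M') :
    Hom (comap f p).stalk p.stalk :=
  f.localize _ _ (fun _ hs => hs)

/-- A family of germs is a regular section if locally it is given by a single fraction `a/f`. -/
def IsRegular {n : ℕ} (U : Set (PrimeSpec M)) (s : (x : U) → x.1.stalk.op n) : Prop :=
  ∀ x : U, ∃ V : Set (PrimeSpec M), IsOpen V ∧ x.1 ∈ V ∧ V ⊆ U ∧
    ∃ (a : M.op n) (f : M.op 1), ∀ y : U, y.1 ∈ V →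
      ∃ hf : f ∈ y.1.compl, s y = frac a ⟨f, hf⟩

/-- The generalized ring `𝒪_{Spec M}(U)`: families of germs which are locally fractions.
It is the sheaf with `𝒪(D_m) = M[m⁻¹]`. -/
def sections (U : Set (PrimeSpec M)) (hU : IsOpen U) : GenRing where
  op n := {s : (x : U) → x.1.stalk.op n // IsRegular U s}
  var i := ⟨fun x => x.1.stalk.var i, fun x =>
    ⟨U, hU, x.2, subset_rfl, M.var i, 1, fun y _ => ⟨y.1.compl.one_mem, rfl⟩⟩⟩
  subst t x := ⟨fun y => y.1.stalk.subst (t.1 y) (fun i => (x i).1 y), fun p => by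
    obtain ⟨V, hV, hpV, hVU, a, f, ha⟩ := t.2 p
    choose W hW hpW hWU b g hb using fun i => (x i).2 p
    refine ⟨V ∩ ⋂ i, W i, hV.inter (isOpen_iInter_of_finite hW),
      ⟨hpV, Set.mem_iInter.2 hpW⟩, fun q hq => hVU hq.1,
      M.subst a (fun i => M.scale (∏ j ∈ Finset.univ.erase i, g j) (b i)),
      f * ∏ j, g j, fun y hy => ?_⟩
    obtain ⟨hf, h1⟩ := ha y hy.1
    choose hg h2 using fun i => hb i y (Set.mem_iInter.1 hy.2 i)
    have hgp : ∀ s : Finset _, ∏ j ∈ s, g j ∈ y.1.compl :=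
      fun s => Submonoid.prod_mem _ fun j _ => hg j
    refine ⟨Submonoid.mul_mem _ hf (hgp _), ?_⟩
    have h3 : (fun i => (x i).1 y) = fun i =>
        frac (M.scale (∏ j ∈ Finset.univ.erase i, g j) (b i))
          (⟨∏ j, g j, hgp _⟩ : y.1.compl) := by
      funext i
      rw [h2 i, ← frac_scale (⟨_, hgp (Finset.univ.erase i)⟩ : y.1.compl)]
      exact congrArg (frac _)
        (Subtype.ext (Finset.prod_erase_mul Finset.univ g (Finset.mem_univ i)))
    change fracSubst (t.1 y) (fun i => (x i).1 y) = _
    rw [h1, h3]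
    exact fracSubst_frac _ _ _ _⟩
  var_subst i x := Subtype.ext (funext fun y => y.1.stalk.var_subst i _)
  subst_var t := Subtype.ext (funext fun y => y.1.stalk.subst_var _)
  subst_assoc t x z := Subtype.ext (funext fun y => y.1.stalk.subst_assoc _ _ _)
  comm t s x := Subtype.ext (funext fun y => y.1.stalk.comm _ _ _)

end PrimeSpec

end GenRing

/-! ### Generalized ringed spaces, sheaves of modules, vector bundles -/

/-- A topological space with a sheaf of generalized rings. -/
structure GenRingedSpace where
  carrier : Type
  [top : TopologicalSpace carrier]
  O : Opens carrier → GenRing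
  res : {U V : Opens carrier} → U ≤ V → GenRing.Hom (O V) (O U)
  res_self : ∀ {U : Opens carrier} {n : ℕ} (s : (O U).op n), (res le_rfl).app s = s
  res_res : ∀ {U V W : Opens carrier} (h : U ≤ V) (k : V ≤ W) {n : ℕ} (s : (O W).op n),
    (res h).app ((res k).app s) = (res (h.trans k)).app s
  glue : ∀ {n : ℕ} {ι : Type} (U : ι → Opens carrier) (s : (i : ι) → (O (U i)).op n),
    (∀ i j, (res (inf_le_left : U i ⊓ U j ≤ U i)).app (s i) =
      (res (inf_le_right : U i ⊓ U j ≤ U j)).app (s j)) →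
    ∃! t : (O (⨆ i, U i)).op n, ∀ i, (res (le_iSup U i)).app t = s i

attribute [instance] GenRingedSpace.top

/-- A sheaf of `𝒪_X`-modules. -/
structure OModule (X : GenRingedSpace) where
  obj : Opens X.carrier → Type
  str : (U : Opens X.carrier) → (X.O U).ModuleStr (obj U)
  res : {U V : Opens X.carrier} → U ≤ V → obj V → obj U
  res_self : ∀ {U : Opens X.carrier} (s : obj U), res le_rfl s = s
  res_res : ∀ {U V W : Opens X.carrier} (h : U ≤ V) (k : V ≤ W) (s : obj W),
    res h (res k s) = res (h.trans k) s
  res_act : ∀ {U V : Opens X.carrier} (h : U ≤ V) {n : ℕ} (t : (X.O V).op n)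
    (x : Fin n → obj V), res h ((str V).act t x) =
      (str U).act ((X.res h).app t) (fun i => res h (x i))
  glue : ∀ {ι : Type} (U : ι → Opens X.carrier) (s : (i : ι) → obj (U i)),
    (∀ i j, res (inf_le_left : U i ⊓ U j ≤ U i) (s i) =
      res (inf_le_right : U i ⊓ U j ≤ U j) (s j)) →
    ∃! t : obj (⨆ i, U i), ∀ i, res (le_iSup U i) t = s i

namespace OModule

variable {X : GenRingedSpace}

/-- Morphisms of sheaves of `𝒪_X`-modules. -/
structure Hom (E F : OModule X) where
  app : (U : Opens X.carrier) → E.obj U → F.obj U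
  naturality : ∀ {U V : Opens X.carrier} (h : U ≤ V) (s : E.obj V),
    app U (E.res h s) = F.res h (app V s)
  map_act : ∀ (U : Opens X.carrier) {n : ℕ} (t : (X.O U).op n) (x : Fin n → E.obj U),
    app U ((E.str U).act t x) = (F.str U).act t (fun i => app U (x i))

/-- `E` and `F` are isomorphic as sheaves of `𝒪_X`-modules. -/
def IsIsoTo (E F : OModule X) : Prop :=
  ∃ (f : Hom E F) (g : Hom F E), (∀ U s, g.app U (f.app U s) = s) ∧
    ∀ U s, f.app U (g.app U s) = s

/-- An isomorphism `𝒪_{X|U}(𝐫) ≃ E|_U` of `𝒪_{X|U}`-modules. -/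
structure Trivialization (E : OModule X) (U : Opens X.carrier) (r : ℕ) where
  equiv : (V : Opens X.carrier) → V ≤ U → (X.O V).op r ≃ E.obj V
  naturality : ∀ {V W : Opens X.carrier} (h : V ≤ W) (hW : W ≤ U) (s : (X.O W).op r),
    equiv V (h.trans hW) ((X.res h).app s) = E.res h (equiv W hW s)
  map_act : ∀ (V : Opens X.carrier) (hV : V ≤ U) {n : ℕ} (t : (X.O V).op n)
    (x : Fin n → (X.O V).op r),
    equiv V hV ((X.O V).subst t x) = (E.str V).act t (fun i => equiv V hV (x i))

/-- The basis of `E(U)` defined by a trivialization. -/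
def Trivialization.basis {E : OModule X} {U : Opens X.carrier} {r : ℕ}
    (τ : Trivialization E U r) (i : Fin r) : E.obj U :=
  τ.equiv U le_rfl ((X.O U).var i)

/-- `E` is a vector bundle of rank `r`. -/
def IsVectorBundle (E : OModule X) (r : ℕ) : Prop :=
  ∀ x : X.carrier, ∃ U : Opens X.carrier, x ∈ U ∧ Nonempty (Trivialization E U r)

/-- Bilinear maps `E × F → G` of sheaves of `𝒪_X`-modules. -/
structure Bilin (E F G : OModule X) where
  app : (U : Opens X.carrier) → E.obj U → F.obj U → G.obj U
  naturality : ∀ {U V : Opens X.carrier} (h : U ≤ V) (s : E.obj V) (t : F.obj V),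
    app U (E.res h s) (F.res h t) = G.res h (app V s t)
  map_act_left : ∀ (U : Opens X.carrier) {n : ℕ} (a : (X.O U).op n) (x : Fin n → E.obj U)
    (y : F.obj U), app U ((E.str U).act a x) y = (G.str U).act a (fun i => app U (x i) y)
  map_act_right : ∀ (U : Opens X.carrier) {n : ℕ} (a : (X.O U).op n) (x : E.obj U)
    (y : Fin n → F.obj U), app U x ((F.str U).act a y) = (G.str U).act a (fun i => app U x (y i))

/-- `T` is a tensor product of `E` and `F`: there is a universal bilinear map `E × F → T`. -/
def IsTensorProduct (E F T : OModule X) : Prop :=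
  ∃ β : Bilin E F T, ∀ (G : OModule X) (γ : Bilin E F G),
    ∃! f : Hom T G, ∀ U x y, f.app U (β.app U x y) = γ.app U x y

lemma IsIsoTo.refl (E : OModule X) : IsIsoTo E E :=
  ⟨⟨fun _ s => s, fun _ _ => rfl, fun _ _ _ _ => rfl⟩,
    ⟨fun _ s => s, fun _ _ => rfl, fun _ _ _ _ => rfl⟩, fun _ _ => rfl, fun _ _ => rfl⟩

lemma IsIsoTo.symm {E F : OModule X} (h : IsIsoTo E F) : IsIsoTo F E := by
  obtain ⟨f, g, h1, h2⟩ := h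
  exact ⟨g, f, h2, h1⟩

lemma IsIsoTo.trans {E F G : OModule X} (h : IsIsoTo E F) (k : IsIsoTo F G) :
    IsIsoTo E G := by
  obtain ⟨f, g, h1, h2⟩ := h
  obtain ⟨f', g', h1', h2'⟩ := k
  exact ⟨⟨fun U s => f'.app U (f.app U s), fun h s => by rw [f.naturality, f'.naturality],
      fun U _ t x => by rw [f.map_act, f'.map_act]⟩,
    ⟨fun U s => g.app U (g'.app U s), fun h s => by rw [g'.naturality, g.naturality],
      fun U _ t x => by rw [g'.map_act, g.map_act]⟩,
    fun U s => by simp only [h1', h1], fun U s => by simp only [h2, h2']⟩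

end OModule

/-- Vector bundles of rank `r` on `X`. -/
def GenVectorBundle (X : GenRingedSpace) (r : ℕ) : Type 1 :=
  {E : OModule X // E.IsVectorBundle r}

/-- Isomorphism of vector bundles. -/
instance GenVectorBundle.setoid (X : GenRingedSpace) (r : ℕ) : Setoid (GenVectorBundle X r) where
  r E F := E.1.IsIsoTo F.1
  iseqv := ⟨fun E => .refl E.1, .symm, .trans⟩

/-- The set of isomorphism classes of vector bundles of rank `r` on `X`. -/
def GenVectorBundleClass (X : GenRingedSpace) (r : ℕ) : Type 1 :=
  Quotient (GenVectorBundle.setoid X r)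

/-- The isomorphism class of a vector bundle. -/
def GenVectorBundle.cls {X : GenRingedSpace} {r : ℕ} (E : GenVectorBundle X r) :
    GenVectorBundleClass X r :=
  Quotient.mk _ E

/-- The set underlying `Pic X`: isomorphism classes of line bundles. -/
abbrev Pic (X : GenRingedSpace) : Type 1 := GenVectorBundleClass X 1

/-! ### Gluing two spectra -/

section Glue

open GenRing PrimeSpec

variable {A B C : GenRing} (φ : Hom A B) (ψ : Hom C B)

/-- The topological pushout `Spec A ⊔_{Spec B} Spec C`. -/
def GluedSpec : Type :=
  Quot (fun a b : PrimeSpec A ⊕ PrimeSpec C =>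
    ∃ y : PrimeSpec B, a = .inl (comap φ y) ∧ b = .inr (comap ψ y))

instance : TopologicalSpace (GluedSpec φ ψ) :=
  inferInstanceAs (TopologicalSpace (Quot _))

namespace GluedSpec

/-- The map `Spec A → Spec A ⊔_{Spec B} Spec C`. -/
def inl (x : PrimeSpec A) : GluedSpec φ ψ := Quot.mk _ (.inl x)

/-- The map `Spec C → Spec A ⊔_{Spec B} Spec C`. -/
def inr (x : PrimeSpec C) : GluedSpec φ ψ := Quot.mk _ (.inr x)

lemma inl_comap (y : PrimeSpec B) : inl φ ψ (comap φ y) = inr φ ψ (comap ψ y) :=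
  Quot.sound ⟨y, rfl, rfl⟩

lemma continuous_inl : Continuous (inl φ ψ) := continuous_quot_mk.comp _root_.continuous_inl

lemma continuous_inr : Continuous (inr φ ψ) := continuous_quot_mk.comp _root_.continuous_inr

variable {φ ψ}

/-- `(s, t)` has the same image in `𝒪_{Spec B}`. -/
def Agree {n : ℕ} (U : Set (GluedSpec φ ψ))
    (s : (x : inl φ ψ ⁻¹' U) → x.1.stalk.op n) (t : (x : inr φ ψ ⁻¹' U) → x.1.stalk.op n) :
    Prop :=
  ∀ (y : PrimeSpec B) (h : inl φ ψ (comap φ y) ∈ U) (k : inr φ ψ (comap ψ y) ∈ U),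
    (stalkMap φ y).app (s ⟨comap φ y, h⟩) = (stalkMap ψ y).app (t ⟨comap ψ y, k⟩)

/-- The generalized ring `𝒪(U) = 𝒪_{Spec A}(U) ×_{𝒪_{Spec B}(U)} 𝒪_{Spec C}(U)` of pairs of
sections agreeing on `Spec B`, for `U` open in `Spec A ⊔_{Spec B} Spec C`. -/
def sections (U : Opens (GluedSpec φ ψ)) : GenRing where
  op n := {p : (PrimeSpec.sections (inl φ ψ ⁻¹' U) (U.2.preimage (continuous_inl φ ψ))).op n ×
      (PrimeSpec.sections (inr φ ψ ⁻¹' U) (U.2.preimage (continuous_inr φ ψ))).op n //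
    Agree (U : Set (GluedSpec φ ψ)) p.1.1 p.2.1}
  var i := ⟨(GenRing.var _ i, GenRing.var _ i), fun y _ _ =>
    ((stalkMap φ y).map_var i).trans ((stalkMap ψ y).map_var i).symm⟩
  subst t x := ⟨(GenRing.subst _ t.1.1 (fun i => (x i).1.1),
    GenRing.subst _ t.1.2 (fun i => (x i).1.2)), fun y h k => by
      refine ((stalkMap φ y).map_subst _ _).trans (Eq.trans ?_ ((stalkMap ψ y).map_subst _ _).symm)
      rw [t.2 y h k]
      exact congrArg _ (funext fun i => (x i).2 y h k)⟩
  var_subst i x := Subtype.ext (Prod.ext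
    (GenRing.var_subst _ i (fun i => (x i).1.1)) (GenRing.var_subst _ i (fun i => (x i).1.2)))
  subst_var t := Subtype.ext (Prod.ext (GenRing.subst_var _ t.1.1) (GenRing.subst_var _ t.1.2))
  subst_assoc t x z := Subtype.ext (Prod.ext
    (GenRing.subst_assoc _ t.1.1 (fun i => (x i).1.1) (fun i => (z i).1.1))
    (GenRing.subst_assoc _ t.1.2 (fun i => (x i).1.2) (fun i => (z i).1.2)))
  comm t s x := Subtype.ext (Prod.ext
    (GenRing.comm _ t.1.1 s.1.1 (fun i j => (x i j).1.1))
    (GenRing.comm _ t.1.2 s.1.2 (fun i j => (x i j).1.2)))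

/-- Restriction of a regular section. -/
lemma _root_.GenRing.PrimeSpec.IsRegular.restrict {M : GenRing} {n : ℕ} {U V : Set (PrimeSpec M)}
    (hU : IsOpen U) (h : U ⊆ V) {s : (x : V) → x.1.stalk.op n} (hs : IsRegular V s) :
    IsRegular U (fun x => s ⟨x.1, h x.2⟩) := fun x => by
  obtain ⟨W, hW, hx, hWV, a, f, ha⟩ := hs ⟨x.1, h x.2⟩
  exact ⟨W ∩ U, hW.inter hU, ⟨hx, x.2⟩, Set.inter_subset_right, a, f,
    fun y hy => ha ⟨y.1, h y.2⟩ hy.1⟩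

/-- Restriction of sections. -/
def res {U V : Opens (GluedSpec φ ψ)} (h : U ≤ V) : Hom (sections V) (sections U) where
  app p := ⟨(⟨fun x => p.1.1.1 ⟨x.1, h x.2⟩,
      p.1.1.2.restrict (U.2.preimage (continuous_inl φ ψ)) (fun _ hx => h hx)⟩,
    ⟨fun x => p.1.2.1 ⟨x.1, h x.2⟩,
      p.1.2.2.restrict (U.2.preimage (continuous_inr φ ψ)) (fun _ hx => h hx)⟩),
    fun y hy hy' => p.2 y (h hy) (h hy')⟩
  map_var _ := rfl
  map_subst _ _ := rfl

/-- Regular sections glue. -/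
lemma _root_.GenRing.PrimeSpec.IsRegular.of_cover {M : GenRing} {n : ℕ} {ι : Type}
    {W : Set (PrimeSpec M)} (U : ι → Set (PrimeSpec M)) (hUW : ∀ i, U i ⊆ W)
    (hW : ∀ x ∈ W, ∃ i, x ∈ U i) (s : (x : W) → x.1.stalk.op n)
    (hs : ∀ i, IsRegular (U i) (fun x => s ⟨x.1, hUW i x.2⟩)) : IsRegular W s := fun x => by
  obtain ⟨i, hi⟩ := hW x.1 x.2
  obtain ⟨V, hV, hx, hVU, a, f, ha⟩ := hs i ⟨x.1, hi⟩
  exact ⟨V, hV, hx, hVU.trans (hUW i), a, f, fun y hy => ha ⟨y.1, hVU hy⟩ hy⟩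

lemma glue {n : ℕ} {ι : Type} (U : ι → Opens (GluedSpec φ ψ))
    (s : (i : ι) → (sections (U i)).op n)
    (hs : ∀ i j, (res (inf_le_left : U i ⊓ U j ≤ U i)).app (s i) =
      (res (inf_le_right : U i ⊓ U j ≤ U j)).app (s j)) :
    ∃! t : (sections (⨆ i, U i)).op n, ∀ i, (res (le_iSup U i)).app t = s i := by
  have hl : ∀ i j (x : PrimeSpec A) (hi : inl φ ψ x ∈ U i) (hj : inl φ ψ x ∈ U j),
      (s i).1.1.1 ⟨x, hi⟩ = (s j).1.1.1 ⟨x, hj⟩ := fun i j x hi hj =>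
    congrArg (fun p : (sections (U i ⊓ U j)).op n => p.1.1.1 ⟨x, ⟨hi, hj⟩⟩) (hs i j)
  have hr : ∀ i j (x : PrimeSpec C) (hi : inr φ ψ x ∈ U i) (hj : inr φ ψ x ∈ U j),
      (s i).1.2.1 ⟨x, hi⟩ = (s j).1.2.1 ⟨x, hj⟩ := fun i j x hi hj =>
    congrArg (fun p : (sections (U i ⊓ U j)).op n => p.1.2.1 ⟨x, ⟨hi, hj⟩⟩) (hs i j)
  have hm : ∀ z ∈ (⨆ i, U i : Opens (GluedSpec φ ψ)), ∃ i, z ∈ U i :=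
    fun z hz => Opens.mem_iSup.1 hz
  have key1 : ∀ i (x : PrimeSpec A) (hi : inl φ ψ x ∈ U i)
      (hx : inl φ ψ x ∈ (⨆ i, U i : Opens (GluedSpec φ ψ))),
      (s (hm _ hx).choose).1.1.1 ⟨x, (hm _ hx).choose_spec⟩ = (s i).1.1.1 ⟨x, hi⟩ :=
    fun i x hi hx => hl _ _ x _ _
  have key2 : ∀ i (x : PrimeSpec C) (hi : inr φ ψ x ∈ U i)
      (hx : inr φ ψ x ∈ (⨆ i, U i : Opens (GluedSpec φ ψ))),
      (s (hm _ hx).choose).1.2.1 ⟨x, (hm _ hx).choose_spec⟩ = (s i).1.2.1 ⟨x, hi⟩ :=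
    fun i x hi hx => hr _ _ x _ _
  refine ⟨⟨(⟨fun x => (s (hm _ x.2).choose).1.1.1 ⟨x.1, (hm _ x.2).choose_spec⟩, ?_⟩,
    ⟨fun x => (s (hm _ x.2).choose).1.2.1 ⟨x.1, (hm _ x.2).choose_spec⟩, ?_⟩), ?_⟩, ?_, ?_⟩
  · refine IsRegular.of_cover (fun i => inl φ ψ ⁻¹' (U i)) (fun i _ hx => le_iSup U i hx)
      (fun x hx => hm _ hx) _ (fun i => ?_)
    have := (s i).1.1.2
    convert this using 1
    funext x
    exact key1 i x.1 x.2 (le_iSup U i x.2)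
  · refine IsRegular.of_cover (fun i => inr φ ψ ⁻¹' (U i)) (fun i _ hx => le_iSup U i hx)
      (fun x hx => hm _ hx) _ (fun i => ?_)
    have := (s i).1.2.2
    convert this using 1
    funext x
    exact key2 i x.1 x.2 (le_iSup U i x.2)
  · intro y h k
    obtain ⟨i, hi⟩ := hm _ h
    have hi' : inr φ ψ (comap ψ y) ∈ U i := by rw [← inl_comap]; exact hi
    dsimp only
    rw [key1 i _ hi h, key2 i _ hi' k]
    exact (s i).2 y hi hi'
  · intro i
    refine Subtype.ext (Prod.ext (Subtype.ext (funext fun x => ?_))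
      (Subtype.ext (funext fun x => ?_)))
    · exact key1 i x.1 x.2 (le_iSup U i x.2)
    · exact key2 i x.1 x.2 (le_iSup U i x.2)
  · intro t ht
    refine Subtype.ext (Prod.ext (Subtype.ext (funext fun x => ?_))
      (Subtype.ext (funext fun x => ?_)))
    · exact congrArg (fun p : (sections (U (hm _ x.2).choose)).op n =>
        p.1.1.1 ⟨x.1, (hm _ x.2).choose_spec⟩) (ht _)
    · exact congrArg (fun p : (sections (U (hm _ x.2).choose)).op n =>
        p.1.2.1 ⟨x.1, (hm _ x.2).choose_spec⟩) (ht _)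

/-- The section `c` over `U` pulls back to the global section `b` on the preimage of `U` in
`Spec B`. -/
def PullsBackTo {U : Opens (GluedSpec φ ψ)} {n : ℕ} (c : (sections U).op n) (b : B.op n) : Prop :=
  ∀ (y : PrimeSpec B) (h : inl φ ψ (comap φ y) ∈ U),
    (stalkMap φ y).app (c.1.1.1 ⟨comap φ y, h⟩) = frac b 1

end GluedSpec

/-- The pushout of `Spec A ← Spec B → Spec C` as a generalized ringed space. -/
def gluedSpace : GenRingedSpace where
  carrier := GluedSpec φ ψ
  O := GluedSpec.sections
  res := GluedSpec.res
  res_self _ := rfl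
  res_res _ _ _ _ := rfl
  glue := GluedSpec.glue

end Glue

/-! ### The generalized scheme `Spec ℤ^N`-hat -/

/-- The ring `ℤ[N⁻¹] ⊆ ℚ`. -/
abbrev ZInv (N : ℕ) : Subalgebra ℤ ℚ := Algebra.adjoin ℤ {(N : ℚ)⁻¹}

/-- The generalized ring `A_N`, `A_N(𝐧) = {λ ∈ ℤ[N⁻¹]ⁿ ; ∑ |λ_i| ≤ 1}`, with the operations
of `ℤ[N⁻¹]`. -/
def AN (N : ℕ) : GenRing where
  op n := {l : Fin n → ZInv N // ∑ i, |l i| ≤ 1}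
  var i := ⟨Pi.single i 1, by simp [Pi.single_apply, apply_ite]⟩
  subst t x := ⟨(GenRing.ofRing (ZInv N)).subst t.1 (fun i => (x i).1), by
    calc ∑ j, |∑ i, t.1 i * (x i).1 j| ≤ ∑ j, ∑ i, |t.1 i| * |(x i).1 j| := by
          refine Finset.sum_le_sum fun j _ => (Finset.abs_sum_le_sum_abs _ _).trans ?_
          simp only [abs_mul, le_refl]
      _ = ∑ i, |t.1 i| * ∑ j, |(x i).1 j| := by
          rw [Finset.sum_comm]; simp only [Finset.mul_sum]
      _ ≤ ∑ i, |t.1 i| :=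
          Finset.sum_le_sum fun i _ => mul_le_of_le_one_right (abs_nonneg _) (x i).2
      _ ≤ 1 := t.2⟩
  var_subst i x := Subtype.ext ((GenRing.ofRing (ZInv N)).var_subst i _)
  subst_var t := Subtype.ext ((GenRing.ofRing (ZInv N)).subst_var t.1)
  subst_assoc t x y := Subtype.ext ((GenRing.ofRing (ZInv N)).subst_assoc t.1 _ _)
  comm t s x := Subtype.ext ((GenRing.ofRing (ZInv N)).comm t.1 s.1 _)

/-- The inclusion `A_N → ℤ[N⁻¹]`. -/
def ANincl (N : ℕ) : GenRing.Hom (AN N) (GenRing.ofRing (ZInv N)) where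
  app t := t.1
  map_var _ := rfl
  map_subst _ _ := rfl

/-- The inclusion `ℤ → ℤ[N⁻¹]`. -/
def Zincl (N : ℕ) : GenRing.Hom (GenRing.ofRing ℤ) (GenRing.ofRing (ZInv N)) :=
  GenRing.ofRingHom (algebraMap ℤ (ZInv N))

/-- `Spec A_N` and `Spec ℤ` glued along `Spec ℤ[N⁻¹]`. -/
def SpecZHat (N : ℕ) : GenRingedSpace := gluedSpace (ANincl N) (Zincl N)

/-- The matrix `A = (a_ij)` over `ℤ[N⁻¹]` describes `E`: there are a basis `e` of `E` over
`Spec A_N` and a basis `f` of `E` over `Spec ℤ` such that `e_i = ∑_j a_ij f_j` on the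
intersection `Spec ℤ[N⁻¹]`. -/
def Describes {N r : ℕ} (A : Matrix (Fin r) (Fin r) (ZInv N)) (E : OModule (SpecZHat N)) : Prop :=
  ∃ U V : Opens (SpecZHat N).carrier,
    (U : Set (SpecZHat N).carrier) = Set.range (GluedSpec.inl (ANincl N) (Zincl N)) ∧
    (V : Set (SpecZHat N).carrier) = Set.range (GluedSpec.inr (ANincl N) (Zincl N)) ∧
    ∃ (e : E.Trivialization U r) (f : E.Trivialization V r), ∀ i : Fin r,
      ∃ c : ((SpecZHat N).O (U ⊓ V)).op r, GluedSpec.PullsBackTo c (A i) ∧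
        E.res inf_le_left (e.basis i) =
          (E.str (U ⊓ V)).act c (fun j => E.res inf_le_right (f.basis j))

/-! ### The groups -/

/-- The `r`-octahedron in `ℝ^r`. -/
def octahedron (r : ℕ) : Set (Fin r → ℝ) := {x | ∑ i, |x i| ≤ 1}

/-- The symmetry group of the `r`-octahedron: linear automorphisms of `ℝ^r` mapping the
octahedron onto itself. -/
def octReal (r : ℕ) : Subgroup (GL (Fin r) ℝ) where
  carrier := {g | (fun x => g.1.mulVec x) '' octahedron r = octahedron r}
  one_mem' := by simp
  mul_mem' {g h} hg hh := by
    change (fun x => (g.1 * h.1).mulVec x) '' octahedron r = octahedron r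
    simp only [← Matrix.mulVec_mulVec]
    rw [← Set.image_image (fun x => g.1.mulVec x) (fun x => h.1.mulVec x), hh, hg]
  inv_mem' {g} hg := by
    change (fun x => (g⁻¹).1.mulVec x) '' octahedron r = octahedron r
    have hg' : (fun x => g.1.mulVec x) '' octahedron r = octahedron r := hg
    conv_lhs => rw [← hg']
    rw [Set.image_image]
    simp [Matrix.mulVec_mulVec]

/-- The inclusion `ℤ[N⁻¹] → ℝ`. -/
def ZInv.toReal (N : ℕ) : ZInv N →+* ℝ := (algebraMap ℚ ℝ).comp (ZInv N).val.toRingHom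

/-- `Oct_r` as a subgroup of `GL_r(ℤ[N⁻¹])`. -/
def Oct (N r : ℕ) : Subgroup (GL (Fin r) (ZInv N)) :=
  (octReal r).comap (Matrix.GeneralLinearGroup.map (ZInv.toReal N))

/-- `GL_r(ℤ)` as a subgroup of `GL_r(ℤ[N⁻¹])`. -/
def GLZ (N r : ℕ) : Subgroup (GL (Fin r) (ZInv N)) :=
  (Matrix.GeneralLinearGroup.map (algebraMap ℤ (ZInv N))).range

/-- The subgroup `{±1}` of `ℤ[N⁻¹]^*`. -/
def pmOne (N : ℕ) : Subgroup (ZInv N)ˣ := Subgroup.zpowers (-1)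

end

/-!
A vector bundle on `X` is trivial on both charts. Every neighbourhood of the prime ideal
`{|λ| < 1}` of `A_N` contains all of `Spec A_N`, so a local trivialization there extends to the
whole chart. Over `Spec ℤ`, evaluation at the generic point identifies the sections with a
`ℤ`-lattice in `ℚ^r`, and a `ℤ`-basis of this lattice is a basis of the bundle. Hence a bundle is
determined by a transition matrix in `GL_r(ℤ[N⁻¹])`, unique up to automorphisms of the free modules
over the two charts. Over `Spec ℤ` these are `GL_r(ℤ)`; over `Spec A_N` they are the invertible
matrices `A` such that every row of `A` and of `A⁻¹` has absolute sum at most `1`. This forces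
`A⁻¹ = Aᵀ`, so the columns satisfy the same bound, which says that `A` and `A⁻¹` preserve the
octahedron. In rank one, the tensor product multiplies the transition units.
-/

noncomputable section

namespace GenRing

variable {M M' : GenRing} {r s n m : ℕ}

/-- The families `c` and `d`, read as matrices with rows `c i` and `d j`, are inverse to each
other. -/
def IsInverse (M : GenRing) (c : Fin r → M.op s) (d : Fin s → M.op r) : Prop :=
  (∀ i, M.subst (c i) d = M.var i) ∧ ∀ j, M.subst (d j) c = M.var j

namespace IsInverse

variable {c : Fin r → M.op s} {d : Fin s → M.op r}

lemma symm (h : M.IsInverse c d) : M.IsInverse d c := ⟨h.2, h.1⟩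

lemma map (h : M.IsInverse c d) (f : Hom M M') :
    M'.IsInverse (fun i => f.app (c i)) (fun j => f.app (d j)) :=
  ⟨fun i => by rw [← f.map_subst, h.1, f.map_var], fun j => by rw [← f.map_subst, h.2, f.map_var]⟩

lemma subst_subst (h : M.IsInverse c d) (t : M.op r) : M.subst (M.subst t c) d = t := by
  rw [M.subst_assoc, funext h.1, M.subst_var]

lemma bijective (h : M.IsInverse c d) : Function.Bijective fun t : M.op r => M.subst t c :=
  Function.bijective_iff_has_inverse.2 ⟨(M.subst · d), h.subst_subst, h.symm.subst_subst⟩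

end IsInverse

lemma ModuleStr.act_comm {Y : Type} (S : M.ModuleStr Y) (t : M.op n) (u : M.op m)
    (x : Fin n → Fin m → Y) :
    S.act t (fun i => S.act u (x i)) = S.act u (fun j => S.act t (fun i => x i j)) := by
  let y : Fin (n * m) → Y := fun k => x (finProdFinEquiv.symm k).1 (finProdFinEquiv.symm k).2
  have hx : x = fun i j => S.act (M.var (finProdFinEquiv (i, j))) y := by
    funext i j
    simp only [S.var_act, y, Equiv.symm_apply_apply]
  simp only [hx, ← S.act_assoc, M.comm t u]

end GenRing

namespace OModule

variable {X : GenRingedSpace} {E F G T T' : OModule X} {r s : ℕ} {U V W : Opens X.carrier}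

/-- The free module `𝒪_X(𝐫)`. -/
def free (X : GenRingedSpace) (r : ℕ) : OModule X where
  obj U := (X.O U).op r
  str U := ⟨(X.O U).subst, (X.O U).var_subst, (X.O U).subst_assoc⟩
  res h := (X.res h).app
  res_self := X.res_self
  res_res h k s := X.res_res h k s
  res_act h _ t x := (X.res h).map_subst t x
  glue := X.glue

/-! ### Gluing sections and maps -/

lemma existsUnique_glue {ι : Type} {W : Opens X.carrier} (U : ι → Opens X.carrier)
    (hW : W = ⨆ i, U i) (hU : ∀ i, U i ≤ W) (s : (i : ι) → E.obj (U i))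
    (hs : ∀ i j (W' : Opens X.carrier) (hi : W' ≤ U i) (hj : W' ≤ U j),
      E.res hi (s i) = E.res hj (s j)) :
    ∃! t : E.obj W, ∀ i, E.res (hU i) t = s i := by
  subst hW
  exact E.glue U s fun i j => hs i j _ _ _

lemma ext_of_cover {ι : Type} {W : Opens X.carrier} (U : ι → Opens X.carrier)
    (hW : W = ⨆ i, U i) (hU : ∀ i, U i ≤ W) {s t : E.obj W}
    (h : ∀ i, E.res (hU i) s = E.res (hU i) t) : s = t :=
  (existsUnique_glue U hW hU (fun i => E.res (hU i) t)
    fun i j W' hi hj => by rw [E.res_res, E.res_res]).unique h fun _ => rfl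

lemma eq_iSup_of_mem (V : W → Opens X.carrier) (hV : ∀ x, V x ≤ W) (hx : ∀ x : W, x.1 ∈ V x) :
    W = ⨆ x, V x :=
  le_antisymm (fun x hxW => Opens.mem_iSup.2 ⟨⟨x, hxW⟩, hx _⟩) (iSup_le hV)

lemma ext_of_mem {s t : E.obj W}
    (h : ∀ x ∈ W, ∃ (V : Opens X.carrier) (hV : V ≤ W), x ∈ V ∧ E.res hV s = E.res hV t) :
    s = t := by
  choose V hV hx hst using fun x : W => h x.1 x.2
  exact ext_of_cover V (eq_iSup_of_mem V hV hx) hV hst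

lemma exists_glue_of_mem (V : W → Opens X.carrier) (hV : ∀ x, V x ≤ W) (hx : ∀ x : W, x.1 ∈ V x)
    (s : (x : W) → E.obj (V x))
    (hs : ∀ i j (W' : Opens X.carrier) (hi : W' ≤ V i) (hj : W' ≤ V j),
      E.res hi (s i) = E.res hj (s j)) :
    ∃ t : E.obj W, ∀ x, E.res (hV x) t = s x :=
  (existsUnique_glue V (eq_iSup_of_mem V hV hx) hV s hs).exists

lemma eq_iSup_bool (hUV : U ⊔ V = ⊤) (W : Opens X.carrier) :
    W = ⨆ b : Bool, bif b then W ⊓ U else W ⊓ V := by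
  rw [iSup_bool_eq, cond_true, cond_false, ← inf_sup_left, hUV, inf_top_eq]

lemma ext_of_sup_eq_top (hUV : U ⊔ V = ⊤) {s t : E.obj W}
    (h₁ : E.res (inf_le_left : W ⊓ U ≤ W) s = E.res inf_le_left t)
    (h₂ : E.res (inf_le_left : W ⊓ V ≤ W) s = E.res inf_le_left t) : s = t :=
  ext_of_cover _ (eq_iSup_bool hUV W) (Bool.forall_bool.2 ⟨inf_le_left, inf_le_left⟩)
    (Bool.forall_bool.2 ⟨h₂, h₁⟩)

lemma exists_glue_of_sup_eq_top (hUV : U ⊔ V = ⊤) (a : E.obj (W ⊓ U)) (b : E.obj (W ⊓ V))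
    (hab : ∀ (W' : Opens X.carrier) (h₁ : W' ≤ W ⊓ U) (h₂ : W' ≤ W ⊓ V),
      E.res h₁ a = E.res h₂ b) :
    ∃ t : E.obj W, E.res inf_le_left t = a ∧ E.res inf_le_left t = b := by
  obtain ⟨t, ht, -⟩ := existsUnique_glue (E := E) _ (eq_iSup_bool hUV W)
    (Bool.forall_bool.2 ⟨inf_le_left, inf_le_left⟩)
    (fun | true => a | false => b) (by
      rintro (_ | _) (_ | _) W' hi hj
      · rfl
      · exact (hab W' hj hi).symm
      · exact hab W' hi hj
      · rfl)
  exact ⟨t, ht true, ht false⟩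

lemma exists_glue_map (hUV : U ⊔ V = ⊤) (P : Opens X.carrier → Type)
    (pres : ∀ {W W' : Opens X.carrier}, W ≤ W' → P W' → P W)
    (pres_res : ∀ {W₁ W₂ W₃ : Opens X.carrier} (h : W₁ ≤ W₂) (k : W₂ ≤ W₃) (x : P W₃),
      pres h (pres k x) = pres (h.trans k) x)
    (α : (W : Opens X.carrier) → W ≤ U → P W → F.obj W)
    (hα : ∀ {W W' : Opens X.carrier} (h : W ≤ W') (hW : W' ≤ U) (x : P W'),
      α W (h.trans hW) (pres h x) = F.res h (α W' hW x))
    (β : (W : Opens X.carrier) → W ≤ V → P W → F.obj W)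
    (hβ : ∀ {W W' : Opens X.carrier} (h : W ≤ W') (hW : W' ≤ V) (x : P W'),
      β W (h.trans hW) (pres h x) = F.res h (β W' hW x))
    (hαβ : ∀ (W : Opens X.carrier) (h₁ : W ≤ U) (h₂ : W ≤ V) (x : P W), α W h₁ x = β W h₂ x) :
    ∃ γ : (W : Opens X.carrier) → P W → F.obj W,
      (∀ {W W' : Opens X.carrier} (h : W ≤ W') (x : P W'), γ W (pres h x) = F.res h (γ W' x)) ∧
      (∀ W h x, γ W x = α W h x) ∧ ∀ W h x, γ W x = β W h x := by
  have exists_glue : ∀ (W : Opens X.carrier) (x : P W), ∃ t : F.obj W,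
      F.res inf_le_left t = α (W ⊓ U) inf_le_right (pres inf_le_left x) ∧
      F.res inf_le_left t = β (W ⊓ V) inf_le_right (pres inf_le_left x) := fun W x =>
    exists_glue_of_sup_eq_top hUV _ _ fun W' h₁ h₂ => by
      rw [← hα, ← hβ, pres_res, pres_res, hαβ]
  choose γ hγ₁ hγ₂ using exists_glue
  have res_γ₁ : ∀ {W W' : Opens X.carrier} (h : W' ≤ W) (h' : W' ≤ U) (x : P W),
      F.res h (γ W x) = α W' h' (pres h x) := fun h h' x => by
    rw [← F.res_res (le_inf h h') inf_le_left, hγ₁, ← hα, pres_res]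
  have res_γ₂ : ∀ {W W' : Opens X.carrier} (h : W' ≤ W) (h' : W' ≤ V) (x : P W),
      F.res h (γ W x) = β W' h' (pres h x) := fun h h' x => by
    rw [← F.res_res (le_inf h h') inf_le_left, hγ₂, ← hβ, pres_res]
  refine ⟨γ, fun h x => ext_of_sup_eq_top hUV ?_ ?_, fun W h x => ext_of_sup_eq_top hUV ?_ ?_,
    fun W h x => ext_of_sup_eq_top hUV ?_ ?_⟩
  · rw [hγ₁, pres_res, F.res_res, res_γ₁]
  · rw [hγ₂, pres_res, F.res_res, res_γ₂]
  · rw [hγ₁, hα]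
  · rw [hγ₂, ← hα, hαβ]
  · rw [hγ₁, ← hβ, hαβ]
  · rw [hγ₂, hβ]

/-! ### Local and global morphisms -/

/-- Morphisms `E|_U → F|_U` of `𝒪_{X|U}`-modules. -/
structure HomOn (E F : OModule X) (U : Opens X.carrier) where
  app : (W : Opens X.carrier) → W ≤ U → E.obj W → F.obj W
  naturality : ∀ {W W' : Opens X.carrier} (h : W ≤ W') (hW : W' ≤ U) (x : E.obj W'),
    app W (h.trans hW) (E.res h x) = F.res h (app W' hW x)
  map_act : ∀ {W : Opens X.carrier} (hW : W ≤ U) {n : ℕ} (t : (X.O W).op n) (x : Fin n → E.obj W),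
    app W hW ((E.str W).act t x) = (F.str W).act t (fun i => app W hW (x i))

/-- Bilinear maps `E|_U × F|_U → G|_U` of `𝒪_{X|U}`-modules. -/
structure BilinOn (E F G : OModule X) (U : Opens X.carrier) where
  app : (W : Opens X.carrier) → W ≤ U → E.obj W → F.obj W → G.obj W
  naturality : ∀ {W W' : Opens X.carrier} (h : W ≤ W') (hW : W' ≤ U) (x : E.obj W') (y : F.obj W'),
    app W (h.trans hW) (E.res h x) (F.res h y) = G.res h (app W' hW x y)
  map_act_left : ∀ {W : Opens X.carrier} (hW : W ≤ U) {n : ℕ} (t : (X.O W).op n)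
    (x : Fin n → E.obj W) (y : F.obj W),
    app W hW ((E.str W).act t x) y = (G.str W).act t (fun i => app W hW (x i) y)
  map_act_right : ∀ {W : Opens X.carrier} (hW : W ≤ U) {n : ℕ} (t : (X.O W).op n)
    (x : E.obj W) (y : Fin n → F.obj W),
    app W hW x ((F.str W).act t y) = (G.str W).act t (fun i => app W hW x (y i))

lemma Hom.ext_app {φ ψ : Hom E F} (h : ∀ U s, φ.app U s = ψ.app U s) : φ = ψ := by
  obtain ⟨a, _, _⟩ := φ
  obtain ⟨b, _, _⟩ := ψ
  obtain rfl : a = b := funext fun U => funext fun s => h U s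
  rfl

/-- The identity morphism. -/
def Hom.id (E : OModule X) : Hom E E := ⟨fun _ s => s, fun _ _ => rfl, fun _ _ _ _ => rfl⟩

/-- The composition of morphisms. -/
def Hom.comp (ψ : Hom F G) (φ : Hom E F) : Hom E G :=
  ⟨fun U s => ψ.app U (φ.app U s), fun h s => by rw [φ.naturality, ψ.naturality],
    fun U _ t x => by rw [φ.map_act, ψ.map_act]⟩

/-- The restriction of a morphism to an open subset. -/
def Hom.restrict (φ : Hom E F) (U : Opens X.carrier) : HomOn E F U :=
  ⟨fun W _ => φ.app W, fun h _ => φ.naturality h, fun _ _ => φ.map_act _⟩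

/-- The restriction of a bilinear map to an open subset. -/
def Bilin.restrict (β : Bilin E F G) (U : Opens X.carrier) : BilinOn E F G U :=
  ⟨fun W _ => β.app W, fun h _ => β.naturality h, fun _ _ => β.map_act_left _,
    fun _ _ => β.map_act_right _⟩

/-- The composition of a bilinear map with a morphism. -/
def HomOn.compBilin (φ : HomOn T G U) (β : BilinOn E F T U) : BilinOn E F G U where
  app W h x y := φ.app W h (β.app W h x y)
  naturality h hW x y := by rw [β.naturality, φ.naturality]
  map_act_left hW _ t x y := by rw [β.map_act_left, φ.map_act]
  map_act_right hW _ t x y := by rw [β.map_act_right, φ.map_act]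

lemma exists_hom_of_homOn (hUV : U ⊔ V = ⊤) (α : HomOn E F U) (β : HomOn E F V)
    (hαβ : ∀ (W : Opens X.carrier) (h₁ : W ≤ U) (h₂ : W ≤ V) (x : E.obj W),
      α.app W h₁ x = β.app W h₂ x) :
    ∃ φ : Hom E F, (∀ W h x, φ.app W x = α.app W h x) ∧ ∀ W h x, φ.app W x = β.app W h x := by
  obtain ⟨γ, hγ, hγα, hγβ⟩ := exists_glue_map hUV E.obj E.res E.res_res
    α.app α.naturality β.app β.naturality hαβ
  refine ⟨⟨γ, hγ, fun W _ t x => ext_of_sup_eq_top hUV ?_ ?_⟩, hγα, hγβ⟩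
  · simp only [← hγ, E.res_act, F.res_act, hγα _ inf_le_right, α.map_act]
  · simp only [← hγ, E.res_act, F.res_act, hγβ _ inf_le_right, β.map_act]

lemma exists_bilin_of_bilinOn (hUV : U ⊔ V = ⊤) (α : BilinOn E F G U) (β : BilinOn E F G V)
    (hαβ : ∀ (W : Opens X.carrier) (h₁ : W ≤ U) (h₂ : W ≤ V) (x : E.obj W) (y : F.obj W),
      α.app W h₁ x y = β.app W h₂ x y) :
    ∃ φ : Bilin E F G, (∀ W h x y, φ.app W x y = α.app W h x y) ∧
      ∀ W h x y, φ.app W x y = β.app W h x y := by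
  obtain ⟨γ, hγ, hγα, hγβ⟩ := exists_glue_map hUV (fun W => E.obj W × F.obj W)
    (fun h x => (E.res h x.1, F.res h x.2)) (fun h k x => by simp only [E.res_res, F.res_res])
    (fun W h x => α.app W h x.1 x.2) (fun h hW x => α.naturality h hW x.1 x.2)
    (fun W h x => β.app W h x.1 x.2) (fun h hW x => β.naturality h hW x.1 x.2)
    fun W h₁ h₂ x => hαβ W h₁ h₂ x.1 x.2
  have nat : ∀ {W W' : Opens X.carrier} (h : W ≤ W') (x : E.obj W') (y : F.obj W'),
      γ W (E.res h x, F.res h y) = G.res h (γ W' (x, y)) := fun h x y => hγ h (x, y)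
  refine ⟨⟨fun W x y => γ W (x, y), nat, fun W _ t x y => ext_of_sup_eq_top hUV ?_ ?_,
    fun W _ t x y => ext_of_sup_eq_top hUV ?_ ?_⟩, fun W h x y => hγα W h (x, y),
    fun W h x y => hγβ W h (x, y)⟩
  · simp only [← nat, E.res_act, G.res_act, hγα _ inf_le_right, α.map_act_left]
  · simp only [← nat, E.res_act, G.res_act, hγβ _ inf_le_right, β.map_act_left]
  · simp only [← nat, F.res_act, G.res_act, hγα _ inf_le_right, α.map_act_right]
  · simp only [← nat, F.res_act, G.res_act, hγβ _ inf_le_right, β.map_act_right]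

/-! ### Bases -/

/-- `e` is a basis of `E|_U`. -/
def IsBasis (E : OModule X) (U : Opens X.carrier) (e : Fin r → E.obj U) : Prop :=
  ∀ (W : Opens X.carrier) (h : W ≤ U), Function.Bijective
    (fun t : (X.O W).op r => (E.str W).act t (fun i => E.res h (e i)))

lemma Trivialization.equiv_apply (τ : Trivialization E U r) (h : W ≤ U) (t : (X.O W).op r) :
    τ.equiv W h t = (E.str W).act t (fun i => E.res h (τ.basis i)) := by
  have equiv_var : ∀ i, τ.equiv W h ((X.O W).var i) = E.res h (τ.basis i) := fun i => by
    rw [← (X.res h).map_var i]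
    exact τ.naturality h le_rfl _
  conv_lhs => rw [← (X.O W).subst_var t, τ.map_act]
  simp only [equiv_var]

lemma Trivialization.isBasis (τ : Trivialization E U r) : IsBasis E U τ.basis := fun W h => by
  rw [← funext (τ.equiv_apply h)]
  exact (τ.equiv W h).bijective

namespace IsBasis

variable {e : Fin r → E.obj U}

/-- The trivialization defined by a basis. -/
def trivialization (he : IsBasis E U e) : Trivialization E U r where
  equiv W h := Equiv.ofBijective _ (he W h)
  naturality h hW s := by
    simp only [Equiv.ofBijective_apply, E.res_act, E.res_res]
  map_act V hV _ t x := by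
    simp only [Equiv.ofBijective_apply, (E.str V).act_assoc]

lemma basis_trivialization (he : IsBasis E U e) : he.trivialization.basis = e := by
  funext i
  change (E.str U).act ((X.O U).var i) (fun i => E.res le_rfl (e i)) = e i
  rw [(E.str U).var_act, E.res_self]

lemma restrict (he : IsBasis E U e) (h : V ≤ U) : IsBasis E V (fun i => E.res h (e i)) :=
  fun W hW => by simpa only [E.res_res] using he W (hW.trans h)

/-- Coordinates with respect to a basis. -/
def coord (he : IsBasis E U e) (h : W ≤ U) (x : E.obj W) : (X.O W).op r :=
  (Equiv.ofBijective _ (he W h)).symm x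

lemma act_coord (he : IsBasis E U e) (h : W ≤ U) (x : E.obj W) :
    (E.str W).act (he.coord h x) (fun i => E.res h (e i)) = x :=
  (Equiv.ofBijective _ (he W h)).apply_symm_apply x

lemma coord_eq (he : IsBasis E U e) (h : W ≤ U) {x : E.obj W} {t : (X.O W).op r}
    (ht : (E.str W).act t (fun i => E.res h (e i)) = x) : he.coord h x = t :=
  (he W h).1 ((he.act_coord h x).trans ht.symm)

lemma coord_basis (he : IsBasis E U e) (i : Fin r) :
    he.coord le_rfl (e i) = (X.O U).var i :=
  he.coord_eq le_rfl (by rw [(E.str U).var_act, E.res_self])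

lemma coord_res (he : IsBasis E U e) (h : V ≤ W) (hW : W ≤ U) (x : E.obj W) :
    he.coord (h.trans hW) (E.res h x) = (X.res h).app (he.coord hW x) := by
  apply he.coord_eq
  conv_rhs => rw [← he.act_coord hW x]
  simp only [E.res_act, E.res_res]

lemma coord_act (he : IsBasis E U e) (h : W ≤ U) {n : ℕ} (t : (X.O W).op n)
    (x : Fin n → E.obj W) :
    he.coord h ((E.str W).act t x) = (X.O W).subst t (fun i => he.coord h (x i)) :=
  he.coord_eq h (by simp only [(E.str W).act_assoc, act_coord])

lemma change (he : IsBasis E U e) {c : Fin s → (X.O U).op r} {d : Fin r → (X.O U).op s}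
    (h : (X.O U).IsInverse c d) : IsBasis E U (fun i => (E.str U).act (c i) e) := fun W hW => by
  convert (he W hW).comp (h.map (X.res hW)).bijective using 2 with t
  simp only [Function.comp, (E.str W).act_assoc, E.res_act]

lemma isInverse_coord {f : Fin s → E.obj U} (he : IsBasis E U e) (hf : IsBasis E U f) :
    (X.O U).IsInverse (fun i => he.coord le_rfl (f i)) (fun j => hf.coord le_rfl (e j)) := by
  have subst_coord : ∀ {r s : ℕ} {e : Fin r → E.obj U} {f : Fin s → E.obj U}
      (he : IsBasis E U e) (hf : IsBasis E U f) (i : Fin s),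
      (X.O U).subst (he.coord le_rfl (f i)) (fun j => hf.coord le_rfl (e j)) = (X.O U).var i :=
    fun {_ _ e f} he hf i => by
      rw [← hf.coord_act, ← hf.coord_basis]
      simpa only [E.res_self] using congrArg (hf.coord le_rfl) (he.act_coord le_rfl (f i))
  exact ⟨subst_coord he hf, subst_coord hf he⟩

lemma map (he : IsBasis E U e) {φ : Hom E F} {ψ : Hom F E} (h₁ : ∀ U s, ψ.app U (φ.app U s) = s)
    (h₂ : ∀ U s, φ.app U (ψ.app U s) = s) : IsBasis F U (fun i => φ.app U (e i)) := fun W h => by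
  have hφ : Function.Bijective (φ.app W) :=
    Function.bijective_iff_has_inverse.2 ⟨ψ.app W, h₁ W, h₂ W⟩
  convert hφ.comp (he W h) using 2 with t
  simp only [Function.comp, φ.map_act, φ.naturality]

/-- The morphism taking prescribed values on a basis. -/
def homOn (he : IsBasis E U e) (y : Fin r → F.obj U) : HomOn E F U where
  app W h x := (F.str W).act (he.coord h x) (fun i => F.res h (y i))
  naturality h hW x := by simp only [he.coord_res h hW, F.res_act, F.res_res]
  map_act hW _ t x := by simp only [he.coord_act, (F.str _).act_assoc]

lemma homOn_app (he : IsBasis E U e) (y : Fin r → F.obj U) (i : Fin r) :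
    (he.homOn y).app U le_rfl (e i) = y i := by
  simp only [homOn, he.coord_basis, (F.str U).var_act, F.res_self]

/-- The bilinear map taking prescribed values on a pair of bases. -/
def bilinOn (he : IsBasis E U e) {f : Fin s → F.obj U} (hf : IsBasis F U f)
    (b : Fin r → Fin s → G.obj U) : BilinOn E F G U where
  app W h x y := (G.str W).act (he.coord h x) fun i =>
    (G.str W).act (hf.coord h y) fun j => G.res h (b i j)
  naturality h hW x y := by
    simp only [he.coord_res h hW, hf.coord_res h hW, G.res_act, G.res_res]
  map_act_left hW _ t x y := by simp only [he.coord_act, (G.str _).act_assoc]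
  map_act_right hW _ t x y := by
    simp only [hf.coord_act, (G.str _).act_assoc, (G.str _).act_comm t]

lemma bilinOn_app (he : IsBasis E U e) {f : Fin s → F.obj U} (hf : IsBasis F U f)
    (b : Fin r → Fin s → G.obj U) (i : Fin r) (j : Fin s) :
    (he.bilinOn hf b).app U le_rfl (e i) (f j) = b i j := by
  simp only [bilinOn, he.coord_basis, hf.coord_basis, (G.str U).var_act, G.res_self]

lemma homOn_ext {W₀ : Opens X.carrier} {e : Fin r → E.obj W₀} (he : IsBasis E W₀ e)
    {φ : HomOn E F U} {ψ : HomOn E F V} (hU : W₀ ≤ U) (hV : W₀ ≤ V)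
    (h : ∀ i, φ.app W₀ hU (e i) = ψ.app W₀ hV (e i)) (hW : W ≤ W₀) (x : E.obj W) :
    φ.app W (hW.trans hU) x = ψ.app W (hW.trans hV) x := by
  rw [← he.act_coord hW x]
  simp only [φ.map_act, ψ.map_act, φ.naturality hW hU, ψ.naturality hW hV, h]

lemma bilinOn_ext {W₀ : Opens X.carrier} {e : Fin r → E.obj W₀} {f : Fin s → F.obj W₀}
    (he : IsBasis E W₀ e) (hf : IsBasis F W₀ f) {β : BilinOn E F G U} {γ : BilinOn E F G V}
    (hU : W₀ ≤ U) (hV : W₀ ≤ V)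
    (h : ∀ i j, β.app W₀ hU (e i) (f j) = γ.app W₀ hV (e i) (f j)) (hW : W ≤ W₀) (x : E.obj W)
    (y : F.obj W) : β.app W (hW.trans hU) x y = γ.app W (hW.trans hV) x y := by
  rw [← he.act_coord hW x, ← hf.act_coord hW y]
  simp only [β.map_act_left, β.map_act_right, γ.map_act_left, γ.map_act_right,
    β.naturality hW hU, γ.naturality hW hV, h]

end IsBasis

lemma Hom.ext_of_isBasis (hUV : U ⊔ V = ⊤) {e : Fin r → E.obj U} {f : Fin s → E.obj V}
    (he : IsBasis E U e) (hf : IsBasis E V f) {φ ψ : Hom E F}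
    (h₁ : ∀ i, φ.app U (e i) = ψ.app U (e i)) (h₂ : ∀ i, φ.app V (f i) = ψ.app V (f i)) :
    φ = ψ :=
  Hom.ext_app fun W x => by
    refine ext_of_sup_eq_top hUV ?_ ?_ <;> rw [← φ.naturality, ← ψ.naturality]
    · exact he.homOn_ext (φ := φ.restrict U) (ψ := ψ.restrict U) le_rfl le_rfl h₁ inf_le_right _
    · exact hf.homOn_ext (φ := φ.restrict V) (ψ := ψ.restrict V) le_rfl le_rfl h₂ inf_le_right _

/-! ### Transition matrices -/

/-- `c` is the matrix of the family `e` in terms of the family `f`: `e i = ∑ j, c i j • f j` on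
`U ⊓ V`. -/
def IsTransition (c : Fin r → (X.O (U ⊓ V)).op s) (e : Fin r → E.obj U) (f : Fin s → E.obj V) :
    Prop :=
  ∀ i, E.res inf_le_left (e i) = (E.str (U ⊓ V)).act (c i) (fun j => E.res inf_le_right (f j))

lemma exists_hom_of_isTransition (hUV : U ⊔ V = ⊤) {e : Fin r → E.obj U} {f : Fin s → E.obj V}
    (he : IsBasis E U e) (hf : IsBasis E V f) {e' : Fin r → F.obj U} {f' : Fin s → F.obj V}
    {c : Fin r → (X.O (U ⊓ V)).op s} (hc : IsTransition c e f) (hc' : IsTransition c e' f') :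
    ∃ φ : Hom E F, (∀ i, φ.app U (e i) = e' i) ∧ ∀ i, φ.app V (f i) = f' i := by
  have agree : ∀ i, (he.homOn e').app (U ⊓ V) inf_le_left (E.res inf_le_left (e i)) =
      (hf.homOn f').app (U ⊓ V) inf_le_right (E.res inf_le_left (e i)) := fun i => by
    rw [(he.homOn e').naturality _ le_rfl, he.homOn_app, hc i, hc' i, (hf.homOn f').map_act]
    simp only [(hf.homOn f').naturality inf_le_right le_rfl, hf.homOn_app]
  obtain ⟨φ, hφ₁, hφ₂⟩ := exists_hom_of_homOn hUV (he.homOn e') (hf.homOn f')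
    fun W h₁ h₂ x => (he.restrict inf_le_left).homOn_ext _ _ agree (le_inf h₁ h₂) x
  exact ⟨φ, fun i => (hφ₁ _ le_rfl _).trans (he.homOn_app _ i),
    fun i => (hφ₂ _ le_rfl _).trans (hf.homOn_app _ i)⟩

lemma isIsoTo_of_isTransition (hUV : U ⊔ V = ⊤) {e : Fin r → E.obj U} {f : Fin s → E.obj V}
    (he : IsBasis E U e) (hf : IsBasis E V f) {e' : Fin r → F.obj U} {f' : Fin s → F.obj V}
    (he' : IsBasis F U e') (hf' : IsBasis F V f') {c : Fin r → (X.O (U ⊓ V)).op s}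
    (hc : IsTransition c e f) (hc' : IsTransition c e' f') : IsIsoTo E F := by
  obtain ⟨φ, hφe, hφf⟩ := exists_hom_of_isTransition hUV he hf hc hc'
  obtain ⟨ψ, hψe, hψf⟩ := exists_hom_of_isTransition hUV he' hf' hc' hc
  have hψφ : ψ.comp φ = Hom.id E := Hom.ext_of_isBasis hUV he hf
    (fun i => by simp only [Hom.comp, Hom.id, hφe, hψe])
    (fun i => by simp only [Hom.comp, Hom.id, hφf, hψf])
  have hφψ : φ.comp ψ = Hom.id F := Hom.ext_of_isBasis hUV he' hf'
    (fun i => by simp only [Hom.comp, Hom.id, hφe, hψe])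
    (fun i => by simp only [Hom.comp, Hom.id, hφf, hψf])
  exact ⟨φ, ψ, fun U s => congrArg (·.app U s) hψφ, fun U s => congrArg (·.app U s) hφψ⟩

lemma exists_bilin_of_isTransition (hUV : U ⊔ V = ⊤) {r' s' : ℕ}
    {e : Fin r → E.obj U} {f : Fin s → E.obj V} {e' : Fin r' → F.obj U} {f' : Fin s' → F.obj V}
    (he : IsBasis E U e) (hf : IsBasis E V f) (he' : IsBasis F U e') (hf' : IsBasis F V f')
    {c : Fin r → (X.O (U ⊓ V)).op s} {c' : Fin r' → (X.O (U ⊓ V)).op s'}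
    (hc : IsTransition c e f) (hc' : IsTransition c' e' f')
    (b : Fin r → Fin r' → G.obj U) (b' : Fin s → Fin s' → G.obj V)
    (hb : ∀ i j, G.res inf_le_left (b i j) = (G.str (U ⊓ V)).act (c i) fun k =>
      (G.str (U ⊓ V)).act (c' j) fun l => G.res inf_le_right (b' k l)) :
    ∃ β : Bilin E F G, (∀ i j, β.app U (e i) (e' j) = b i j) ∧
      ∀ i j, β.app V (f i) (f' j) = b' i j := by
  have agree : ∀ i j, (he.bilinOn he' b).app (U ⊓ V) inf_le_left
        (E.res inf_le_left (e i)) (F.res inf_le_left (e' j)) =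
      (hf.bilinOn hf' b').app (U ⊓ V) inf_le_right
        (E.res inf_le_left (e i)) (F.res inf_le_left (e' j)) := fun i j => by
    rw [(he.bilinOn he' b).naturality _ le_rfl, he.bilinOn_app, hb, hc i, hc' j,
      (hf.bilinOn hf' b').map_act_left]
    simp only [(hf.bilinOn hf' b').map_act_right,
      (hf.bilinOn hf' b').naturality inf_le_right le_rfl, hf.bilinOn_app]
  obtain ⟨β, hβ₁, hβ₂⟩ := exists_bilin_of_bilinOn hUV (he.bilinOn he' b) (hf.bilinOn hf' b')
    fun W h₁ h₂ x y => (he.restrict inf_le_left).bilinOn_ext (he'.restrict inf_le_left) _ _ agree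
      (le_inf h₁ h₂) x y
  exact ⟨β, fun i j => (hβ₁ _ le_rfl _ _).trans (he.bilinOn_app _ _ i j),
    fun i j => (hβ₂ _ le_rfl _ _).trans (hf.bilinOn_app _ _ i j)⟩

/-! ### Tensor products -/

lemma IsTensorProduct.isIsoTo (h : IsTensorProduct E F T) (h' : IsTensorProduct E F T') :
    IsIsoTo T T' := by
  obtain ⟨β, hβ⟩ := h
  obtain ⟨β', hβ'⟩ := h'
  obtain ⟨φ, hφ, -⟩ := hβ T' β'
  obtain ⟨ψ, hψ, -⟩ := hβ' T β
  have hψφ : ψ.comp φ = Hom.id T := (hβ T β).unique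
    (fun U x y => by simp only [Hom.comp, hφ, hψ]) (fun U x y => rfl)
  have hφψ : φ.comp ψ = Hom.id T' := (hβ' T' β').unique
    (fun U x y => by simp only [Hom.comp, hφ, hψ]) (fun U x y => rfl)
  exact ⟨φ, ψ, fun U s => congrArg (·.app U s) hψφ, fun U s => congrArg (·.app U s) hφψ⟩

/-- The family `β(e i, e' j)` of products of the members of `e` and `e'`. -/
def Bilin.products (β : Bilin E F T) (e : Fin r → E.obj U) (e' : Fin s → F.obj U)
    (k : Fin (r * s)) : T.obj U :=
  β.app U (e (finProdFinEquiv.symm k).1) (e' (finProdFinEquiv.symm k).2)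

lemma Bilin.products_mk (β : Bilin E F T) (e : Fin r → E.obj U) (e' : Fin s → F.obj U)
    (i : Fin r) (j : Fin s) : β.products e e' (finProdFinEquiv (i, j)) = β.app U (e i) (e' j) := by
  rw [products, Equiv.symm_apply_apply]

lemma IsBasis.homOn_products_app {β : Bilin E F T} {γ : Bilin E F G} {e : Fin r → E.obj U}
    {e' : Fin s → F.obj U} (he : IsBasis E U e) (he' : IsBasis F U e')
    (hβ : IsBasis T U (β.products e e')) (hW : W ≤ U) (x : E.obj W) (y : F.obj W) :
    (hβ.homOn (γ.products e e')).app W hW (β.app W x y) = γ.app W x y := by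
  refine he.bilinOn_ext he' (β := (hβ.homOn (γ.products e e')).compBilin (β.restrict U))
    (γ := γ.restrict U) le_rfl le_rfl (fun i j => ?_) hW x y
  change (hβ.homOn _).app U le_rfl (β.app U (e i) (e' j)) = γ.app U (e i) (e' j)
  rw [← β.products_mk, hβ.homOn_app, γ.products_mk]

lemma isTensorProduct_of_isBasis (hUV : U ⊔ V = ⊤) {r' s' : ℕ} (β : Bilin E F T)
    {e : Fin r → E.obj U} {f : Fin s → E.obj V} {e' : Fin r' → F.obj U} {f' : Fin s' → F.obj V}
    (he : IsBasis E U e) (hf : IsBasis E V f) (he' : IsBasis F U e') (hf' : IsBasis F V f')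
    (hU : IsBasis T U (β.products e e')) (hV : IsBasis T V (β.products f f')) :
    IsTensorProduct E F T := by
  refine ⟨β, fun G γ => ?_⟩
  have agree : ∀ k, (hU.homOn (γ.products e e')).app (U ⊓ V) inf_le_left
        (T.res inf_le_left (β.products e e' k)) =
      (hV.homOn (γ.products f f')).app (U ⊓ V) inf_le_right
        (T.res inf_le_left (β.products e e' k)) := fun k => by
    rw [Bilin.products, ← β.naturality, he.homOn_products_app he', hf.homOn_products_app hf']
  obtain ⟨φ, hφ₁, hφ₂⟩ := exists_hom_of_homOn hUV (hU.homOn (γ.products e e'))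
    (hV.homOn (γ.products f f'))
    fun W h₁ h₂ x => (hU.restrict inf_le_left).homOn_ext _ _ agree (le_inf h₁ h₂) x
  have hφ : ∀ W x y, φ.app W (β.app W x y) = γ.app W x y := fun W x y => by
    refine ext_of_sup_eq_top hUV ?_ ?_
    · rw [← φ.naturality, ← β.naturality, ← γ.naturality, hφ₁ _ inf_le_right,
        he.homOn_products_app he']
    · rw [← φ.naturality, ← β.naturality, ← γ.naturality, hφ₂ _ inf_le_right,
        hf.homOn_products_app hf']
  exact ⟨φ, hφ, fun ψ hψ => Hom.ext_of_isBasis hUV hU hV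
    (fun k => (hψ U _ _).trans (hφ U _ _).symm) (fun k => (hψ V _ _).trans (hφ V _ _).symm)⟩

lemma isTensorProduct_of_isTransition (hUV : U ⊔ V = ⊤)
    {e : Fin 1 → E.obj U} {f : Fin 1 → E.obj V} {e' : Fin 1 → F.obj U} {f' : Fin 1 → F.obj V}
    {e'' : Fin 1 → T.obj U} {f'' : Fin 1 → T.obj V}
    (he : IsBasis E U e) (hf : IsBasis E V f) (he' : IsBasis F U e') (hf' : IsBasis F V f')
    (he'' : IsBasis T U e'') (hf'' : IsBasis T V f'') {c c' : Fin 1 → (X.O (U ⊓ V)).op 1}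
    (hc : IsTransition c e f) (hc' : IsTransition c' e' f')
    (hc'' : IsTransition (fun i => c i * c' i) e'' f'') : IsTensorProduct E F T := by
  obtain ⟨β, hβe, hβf⟩ := exists_bilin_of_isTransition hUV he hf he' hf' hc hc'
    (fun _ => e'') (fun _ => f'') fun i j => by
      rw [hc'' j, Subsingleton.elim i j]
      exact (T.str _).act_assoc (c j) (fun _ => c' j) _
  refine isTensorProduct_of_isBasis hUV β he hf he' hf' ?_ ?_
  · convert he'' using 1
    exact funext fun k => (hβe _ _).trans (congrArg e'' (Subsingleton.elim _ _))
  · convert hf'' using 1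
    exact funext fun k => (hβf _ _).trans (congrArg f'' (Subsingleton.elim _ _))

/-! ### Gluing two free modules -/

section Glued

/-- The compatibility `a c = b` of coordinates `a` over `W ∩ U` and `b` over `W ∩ V`. -/
def Compatible (c : Fin r → (X.O (U ⊓ V)).op r) (W : Opens X.carrier) (a : (X.O (W ⊓ U)).op r)
    (b : (X.O (W ⊓ V)).op r) : Prop :=
  ∀ (W' : Opens X.carrier) (h₁ : W' ≤ W ⊓ U) (h₂ : W' ≤ W ⊓ V),
    (X.O W').subst ((X.res h₁).app a) (fun i => (X.res (le_inf (h₁.trans inf_le_right)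
      (h₂.trans inf_le_right))).app (c i)) = (X.res h₂).app b

variable (c : Fin r → (X.O (U ⊓ V)).op r)

/-- Sections over `W` of the gluing of `𝒪_U(𝐫)` and `𝒪_V(𝐫)` along the matrix `c`: pairs of
coordinates over `W ∩ U` and over `W ∩ V` which correspond to each other under `c`. -/
def GluedSection (W : Opens X.carrier) : Type :=
  {p : (X.O (W ⊓ U)).op r × (X.O (W ⊓ V)).op r // Compatible c W p.1 p.2}

namespace GluedSection

variable {c}

lemma ext {p q : GluedSection c W} (h₁ : p.1.1 = q.1.1) (h₂ : p.1.2 = q.1.2) : p = q :=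
  Subtype.ext (Prod.ext h₁ h₂)

/-- Restriction of sections of the gluing. -/
def res {W W' : Opens X.carrier} (h : W ≤ W') (p : GluedSection c W') : GluedSection c W :=
  ⟨((X.res (inf_le_inf_right _ h)).app p.1.1, (X.res (inf_le_inf_right _ h)).app p.1.2),
    fun W'' h₁ h₂ => by simpa only [X.res_res] using p.2 W'' _ _⟩

variable (c) in
/-- The operations on sections of the gluing. -/
def moduleStr (W : Opens X.carrier) : (X.O W).ModuleStr (GluedSection c W) where
  act t x := ⟨((X.O _).subst ((X.res inf_le_left).app t) (fun i => (x i).1.1),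
    (X.O _).subst ((X.res inf_le_left).app t) (fun i => (x i).1.2)), fun W' h₁ h₂ => by
      simp only [(X.res _).map_subst, X.res_res, (X.O W').subst_assoc, (x _).2 W' h₁ h₂]⟩
  var_act i x := ext (by simp only [(X.res _).map_var, (X.O _).var_subst])
    (by simp only [(X.res _).map_var, (X.O _).var_subst])
  act_assoc t s x := ext (by simp only [(X.res _).map_subst, (X.O _).subst_assoc])
    (by simp only [(X.res _).map_subst, (X.O _).subst_assoc])

lemma existsUnique_glue {ι : Type} (W : ι → Opens X.carrier)
    (p : (i : ι) → GluedSection c (W i))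
    (hp : ∀ i j, res (inf_le_left : W i ⊓ W j ≤ W i) (p i) = res inf_le_right (p j)) :
    ∃! q : GluedSection c (⨆ i, W i), ∀ i, res (le_iSup W i) q = p i := by
  obtain ⟨(a : (X.O ((⨆ i, W i) ⊓ U)).op r), ha, ha'⟩ :=
    OModule.existsUnique_glue (E := free X r) (fun i => W i ⊓ U) (iSup_inf_eq W U)
      (fun i => inf_le_inf_right U (le_iSup W i)) (fun i => (p i).1.1)
    fun i j W' hi hj => by
      simpa only [res, free, X.res_res] using congrArg (fun q => (X.res (le_inf (le_inf (hi.trans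
        inf_le_left) (hj.trans inf_le_left)) (hi.trans inf_le_right))).app q.1.1) (hp i j)
  obtain ⟨(b : (X.O ((⨆ i, W i) ⊓ V)).op r), hb, hb'⟩ :=
    OModule.existsUnique_glue (E := free X r) (fun i => W i ⊓ V) (iSup_inf_eq W V)
      (fun i => inf_le_inf_right V (le_iSup W i)) (fun i => (p i).1.2)
    fun i j W' hi hj => by
      simpa only [res, free, X.res_res] using congrArg (fun q => (X.res (le_inf (le_inf (hi.trans
        inf_le_left) (hj.trans inf_le_left)) (hi.trans inf_le_right))).app q.1.2) (hp i j)
  have compatible : Compatible c (⨆ i, W i) a b := fun W' h₁ h₂ => by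
    refine ext_of_cover (E := free X r) (fun i => W' ⊓ W i) ?_ (fun i => inf_le_left) fun i => ?_
    · rw [← inf_iSup_eq, inf_eq_left.2 (h₁.trans inf_le_left)]
    · have hi := (p i).2 (W' ⊓ W i)
        (le_inf inf_le_right (inf_le_left.trans (h₁.trans inf_le_right)))
        (le_inf inf_le_right (inf_le_left.trans (h₂.trans inf_le_right)))
      rw [← ha i, ← hb i] at hi
      dsimp only [free] at hi ⊢
      simpa only [(X.res _).map_subst, X.res_res] using hi
  exact ⟨⟨(a, b), compatible⟩, fun i => ext (ha i) (hb i), fun q hq =>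
    ext (ha' _ fun i => congrArg (·.1.1) (hq i)) (hb' _ fun i => congrArg (·.1.2) (hq i))⟩

end GluedSection

/-- The module obtained by gluing `𝒪_U(𝐫)` and `𝒪_V(𝐫)` along the matrix `c`. -/
def glued : OModule X where
  obj := GluedSection c
  str := GluedSection.moduleStr c
  res := GluedSection.res
  res_self p := GluedSection.ext (X.res_self _) (X.res_self _)
  res_res h k p := GluedSection.ext (X.res_res _ _ _) (X.res_res _ _ _)
  res_act h _ t x := GluedSection.ext
    (by simp only [GluedSection.res, GluedSection.moduleStr, (X.res _).map_subst, X.res_res])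
    (by simp only [GluedSection.res, GluedSection.moduleStr, (X.res _).map_subst, X.res_res])
  glue := GluedSection.existsUnique_glue

/-- The standard basis of the gluing over `U`. -/
def gluedLeft (i : Fin r) : (glued c).obj U :=
  ⟨((X.O _).var i, c i), fun W' h₁ h₂ => by rw [(X.res _).map_var, (X.O _).var_subst]⟩

variable {c} {d : Fin r → (X.O (U ⊓ V)).op r}

/-- The standard basis of the gluing over `V`. -/
def gluedRight (h : (X.O (U ⊓ V)).IsInverse c d) (i : Fin r) : (glued c).obj V :=
  ⟨((X.res (inf_comm V U).le).app (d i), (X.O _).var i), fun W' h₁ h₂ => by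
    rw [(X.res _).map_var, X.res_res, ← (X.res _).map_subst, h.2, (X.res _).map_var]⟩

lemma act_gluedLeft (h : W ≤ U) (t : (X.O W).op r) :
    (((glued c).str W).act t fun i => (glued c).res h (gluedLeft c i)).1 =
      ((X.res inf_le_left).app t, (X.O _).subst ((X.res inf_le_left).app t) fun i =>
        (X.res (inf_le_inf_right V h)).app (c i)) := by
  refine Prod.ext ?_ rfl
  simp only [glued, gluedLeft, GluedSection.moduleStr, GluedSection.res, (X.res _).map_var]
  exact (X.O _).subst_var _

lemma act_gluedRight (hcd : (X.O (U ⊓ V)).IsInverse c d) (h : W ≤ V) (t : (X.O W).op r) :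
    (((glued c).str W).act t fun i => (glued c).res h (gluedRight hcd i)).1 =
      ((X.O _).subst ((X.res inf_le_left).app t) fun i =>
        (X.res (le_inf inf_le_right (inf_le_left.trans h))).app (d i),
        (X.res inf_le_left).app t) := by
  refine Prod.ext ?_ ?_
  · simp only [glued, gluedRight, GluedSection.moduleStr, GluedSection.res, X.res_res]
  · simp only [glued, gluedRight, GluedSection.moduleStr, GluedSection.res, (X.res _).map_var]
    exact (X.O _).subst_var _

lemma isBasis_gluedLeft : IsBasis (glued c) U (gluedLeft c) := fun W h => by
  refine ⟨fun s t hst => ?_, fun p => ⟨(X.res (le_inf le_rfl h)).app p.1.1, ?_⟩⟩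
  · have := congrArg (fun p => (X.res (le_inf le_rfl h)).app p.1.1) hst
    simpa only [act_gluedLeft, X.res_res, X.res_self] using this
  · have hp := p.2 (W ⊓ V) (le_inf inf_le_left (inf_le_left.trans h)) le_rfl
    refine Subtype.ext ((act_gluedLeft h _).trans (Prod.ext ?_ ?_))
    · simp only [X.res_res, X.res_self]
    · simpa only [X.res_res, X.res_self] using hp

lemma isBasis_gluedRight (hcd : (X.O (U ⊓ V)).IsInverse c d) :
    IsBasis (glued c) V (gluedRight hcd) := fun W h => by
  refine ⟨fun s t hst => ?_, fun p => ⟨(X.res (le_inf le_rfl h)).app p.1.2, ?_⟩⟩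
  · have := congrArg (fun p => (X.res (le_inf le_rfl h)).app p.1.2) hst
    simpa only [act_gluedRight, X.res_res, X.res_self] using this
  · have hp := p.2 (W ⊓ U) le_rfl (le_inf inf_le_left (inf_le_left.trans h))
    refine Subtype.ext ((act_gluedRight hcd h _).trans (Prod.ext ?_ ?_))
    · simp only [X.res_res]
      rw [← hp, X.res_self]
      exact (hcd.map (X.res _)).subst_subst _
    · simp only [X.res_res, X.res_self]

lemma isTransition_glued (hcd : (X.O (U ⊓ V)).IsInverse c d) :
    IsTransition c (gluedLeft c) (gluedRight hcd) := fun i => by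
  refine Subtype.ext (Eq.trans (Prod.ext ?_ ?_) (act_gluedRight hcd inf_le_right (c i)).symm)
  · exact ((X.res _).map_var i).trans (((hcd.map (X.res _)).1 i).symm)
  · rfl

end Glued

end OModule

/-! ### Generalized rings embedded in a field -/

namespace GenRing

/-- An embedding of a generalized ring `M` into a field `K`. The constant `zero` excludes the
generalized rings with `M(𝟎) = ∅`, which may have an empty prime ideal. -/
structure FieldEmbedding (M : GenRing) (K : Type) [Field K] extends Hom M (ofRing K) where
  injective : ∀ n, Function.Injective (app : M.op n → (ofRing K).op n)
  zero : M.op 0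

namespace FieldEmbedding

variable {M : GenRing} {K : Type} [Field K] (j : FieldEmbedding M K)

/-- The coordinates in `K` of an element of `M(𝐧)`. -/
def coe {n : ℕ} (a : M.op n) : Fin n → K := j.app a

lemma coe_injective {n : ℕ} {a b : M.op n} (h : j.coe a = j.coe b) : a = b := j.injective n h

lemma eq_of_coe_zero_eq {a b : M.op 1} (h : j.coe a 0 = j.coe b 0) : a = b :=
  j.coe_injective (funext fun i => by rwa [Subsingleton.elim i 0])

lemma coe_var {n : ℕ} (i : Fin n) : j.coe (M.var i) = Pi.single i 1 := j.map_var i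

lemma coe_subst {n m : ℕ} (t : M.op n) (x : Fin n → M.op m) (k : Fin m) :
    j.coe (M.subst t x) k = ∑ i, j.coe t i * j.coe (x i) k := congrFun (j.map_subst t x) k

lemma coe_scale {n : ℕ} (a : M.op 1) (t : M.op n) (k : Fin n) :
    j.coe (M.scale a t) k = j.coe a 0 * j.coe t k :=
  (j.coe_subst a (fun _ => t) k).trans (by simp)

lemma coe_mul (a b : M.op 1) : j.coe (a * b) 0 = j.coe a 0 * j.coe b 0 := j.coe_scale a b 0

lemma coe_one : j.coe (1 : M.op 1) 0 = 1 := by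
  have := congrFun (j.coe_var (0 : Fin 1)) 0
  rwa [Pi.single_eq_same] at this

lemma coe_pow (a : M.op 1) (k : ℕ) : j.coe (a ^ k) 0 = j.coe a 0 ^ k := by
  induction k with
  | zero => rw [pow_zero, pow_zero, coe_one]
  | succ k ih => rw [pow_succ, pow_succ, coe_mul, ih]

lemma coe_ne_zero {p : PrimeSpec M} {s : M.op 1} (hs : s ∉ p.carrier) : j.coe s 0 ≠ 0 := by
  intro h
  have h_mem : M.subst j.zero (Fin.elim0 : Fin 0 → M.op 1) ∈ p.carrier :=
    p.subst_mem _ _ fun i => i.elim0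
  have h_eq : s = M.subst j.zero (Fin.elim0 : Fin 0 → M.op 1) :=
    j.eq_of_coe_zero_eq (by rw [h, coe_subst, Fin.sum_univ_zero])
  exact hs (h_eq ▸ h_mem)

/-- The zero ideal, which is the generic point of the spectrum. -/
def generic : PrimeSpec M where
  carrier := {a | j.coe a 0 = 0}
  subst_mem t x hx := by
    change j.coe (M.subst t x) 0 = 0
    rw [coe_subst]
    exact Finset.sum_eq_zero fun i _ => by rw [show j.coe (x i) 0 = 0 from hx i, mul_zero]
  one_notMem := by
    change j.coe (1 : M.op 1) 0 ≠ 0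
    rw [coe_one]
    exact one_ne_zero
  mul_notMem a b ha hb := by
    change j.coe (a * b) 0 ≠ 0
    rw [coe_mul]
    exact mul_ne_zero ha hb

lemma generic_le (p : PrimeSpec M) : j.generic.carrier ⊆ p.carrier := fun s hs => by
  by_contra h
  exact j.coe_ne_zero h hs

/-- The value in `Kⁿ` of an element of the stalk `M_𝔭(𝐧)`. -/
def fracVal (p : PrimeSpec M) {n : ℕ} : p.stalk.op n → Fin n → K :=
  Quotient.lift (s := fracSetoid M p.compl n)
    (fun (q : M.op n × p.compl) k => j.coe q.1 k / j.coe (q.2 : M.op 1) 0) (by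
    rintro ⟨a, s⟩ ⟨b, t⟩ ⟨u, hu⟩
    funext k
    have h := congrFun (congrArg j.coe hu) k
    simp only [coe_scale, coe_mul, mul_assoc] at h
    rw [div_eq_div_iff (j.coe_ne_zero s.2) (j.coe_ne_zero t.2)]
    linear_combination mul_left_cancel₀ (j.coe_ne_zero u.2) h)

lemma fracVal_frac (p : PrimeSpec M) {n : ℕ} (a : M.op n) (s : p.compl) :
    j.fracVal p (frac a s) = fun k => j.coe a k / j.coe (s : M.op 1) 0 := rfl

lemma fracVal_injective (p : PrimeSpec M) {n : ℕ} {q q' : p.stalk.op n}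
    (h : j.fracVal p q = j.fracVal p q') : q = q' := by
  obtain ⟨a, s, rfl⟩ := exists_frac q
  obtain ⟨b, t, rfl⟩ := exists_frac q'
  refine frac_eq.2 ⟨1, j.coe_injective (funext fun k => ?_)⟩
  have h := congrFun h k
  rw [fracVal_frac, fracVal_frac, div_eq_div_iff (j.coe_ne_zero s.2) (j.coe_ne_zero t.2)] at h
  simp only [coe_scale, OneMemClass.coe_one, one_mul]
  linear_combination h

/-- The embedding of the stalk in `K`. -/
def fracHom (p : PrimeSpec M) : Hom p.stalk (ofRing K) where
  app := j.fracVal p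
  map_var i := by
    change j.fracVal p (frac (M.var i) 1) = Pi.single i 1
    rw [fracVal_frac, coe_var]
    funext k
    simp [coe_one]
  map_subst t x := by
    obtain ⟨a, s, rfl⟩ := exists_frac t
    obtain ⟨b, u, rfl⟩ := exists_common x
    change j.fracVal p (fracSubst _ _) = fun k => ∑ i, j.fracVal p (frac a s) i *
      j.fracVal p (frac (b i) u) k
    rw [fracSubst_frac]
    funext k
    simp only [fracVal_frac, coe_subst, Submonoid.coe_mul, coe_mul, Finset.sum_div]
    exact Finset.sum_congr rfl fun i _ => by rw [div_mul_div_comm]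

/-- The image of the stalk `M_𝔭(𝐧)` in `Kⁿ`. -/
def stalkSet (p : PrimeSpec M) (n : ℕ) : Set (Fin n → K) :=
  {v | ∃ (a : M.op n) (s : M.op 1), s ∉ p.carrier ∧ ∀ k, j.coe s 0 * v k = j.coe a k}

lemma fracVal_mem (p : PrimeSpec M) {n : ℕ} (q : p.stalk.op n) :
    j.fracVal p q ∈ j.stalkSet p n := by
  obtain ⟨a, s, rfl⟩ := exists_frac q
  exact ⟨a, s, s.2, fun k => by rw [fracVal_frac, mul_div_cancel₀ _ (j.coe_ne_zero s.2)]⟩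

lemma fracVal_frac_eq {p : PrimeSpec M} {n : ℕ} {a : M.op n} {s : M.op 1} {v : Fin n → K}
    (h : ∀ k, j.coe s 0 * v k = j.coe a k) (hs : s ∉ p.carrier) :
    j.fracVal p (frac a (⟨s, hs⟩ : p.compl)) = v := by
  funext k
  change j.coe a k / j.coe s 0 = v k
  rw [← h, mul_div_cancel_left₀ _ (j.coe_ne_zero hs)]

lemma coe_mem (p : PrimeSpec M) {n : ℕ} (a : M.op n) : j.coe a ∈ j.stalkSet p n :=
  ⟨a, 1, p.one_notMem, fun k => by rw [coe_one, one_mul]⟩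

end FieldEmbedding

/-- The morphism `f` commutes with the embeddings of `M` and `M'` in `K`. -/
def Hom.IsOver {M M' : GenRing} {K : Type} [Field K] (f : Hom M M') (j : FieldEmbedding M K)
    (j' : FieldEmbedding M' K) : Prop :=
  ∀ ⦃n : ℕ⦄ (a : M.op n), j'.coe (f.app a) = j.coe a

namespace PrimeSpec

variable {M M' : GenRing} {K : Type} [Field K] {f : Hom M M'} {j : FieldEmbedding M K}
  {j' : FieldEmbedding M' K}

lemma mem_of_le {V : Set (PrimeSpec M)} (hV : IsOpen V) {p q : PrimeSpec M}
    (h : q.carrier ⊆ p.carrier) (hp : p ∈ V) : q ∈ V := by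
  induction hV with
  | basic s hs =>
    obtain ⟨m, rfl⟩ := hs
    exact fun hm => hp (h hm)
  | univ => trivial
  | inter s t _ _ ihs iht => exact ⟨ihs hp.1, iht hp.2⟩
  | sUnion S _ ih =>
    obtain ⟨s, hs, hps⟩ := hp
    exact ⟨s, hs, ih s hs hps⟩

lemma isOpen_basicOpen (m : M.op 1) : IsOpen (basicOpen m) :=
  isOpen_generateFrom_of_mem ⟨m, rfl⟩

lemma pow_notMem (p : PrimeSpec M) {m : M.op 1} (h : m ∉ p.carrier) (k : ℕ) :
    m ^ k ∉ p.carrier :=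
  p.compl.pow_mem h k

lemma mul_mem (p : PrimeSpec M) (a : M.op 1) {b : M.op 1} (h : b ∈ p.carrier) :
    a * b ∈ p.carrier := p.subst_mem a (fun _ => b) fun _ => h

lemma comap_generic (hf : f.IsOver j j') : comap f j'.generic = j.generic := by
  refine PrimeSpec.ext (Set.ext fun a => ?_)
  change j'.coe (f.app a) 0 = 0 ↔ j.coe a 0 = 0
  rw [hf]

lemma fracVal_stalkMap (hf : f.IsOver j j') (y : PrimeSpec M') {n : ℕ}
    (q : (comap f y).stalk.op n) :
    j'.fracVal y ((stalkMap f y).app q) = j.fracVal (comap f y) q := by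
  obtain ⟨a, s, rfl⟩ := exists_frac q
  funext k
  rw [j.fracVal_frac, ← hf, ← hf]
  rfl

lemma IsRegular.fracVal_eq (j : FieldEmbedding M K) {n : ℕ} {U : Set (PrimeSpec M)}
    {s : (x : U) → x.1.stalk.op n} (hs : IsRegular U s) (x : U) (h : j.generic ∈ U) :
    j.fracVal x.1 (s x) = j.fracVal j.generic (s ⟨j.generic, h⟩) := by
  obtain ⟨V, hV, hxV, -, a, f, hsV⟩ := hs x
  obtain ⟨_, hx⟩ := hsV x hxV
  obtain ⟨_, hη⟩ := hsV ⟨j.generic, h⟩ (mem_of_le hV (j.generic_le _) hxV)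
  rw [hx, hη]
  rfl

lemma exists_isRegular (j : FieldEmbedding M K) {n : ℕ} {U : Set (PrimeSpec M)} (hU : IsOpen U)
    {v : Fin n → K} (hv : ∀ x ∈ U, v ∈ j.stalkSet x n) :
    ∃ s : (x : U) → x.1.stalk.op n, IsRegular U s ∧ ∀ x, j.fracVal x.1 (s x) = v := by
  choose a f hf h using hv
  refine ⟨fun x => frac (a x.1 x.2) (⟨f x.1 x.2, hf _ _⟩ : x.1.compl), fun x => ?_,
    fun x => j.fracVal_frac_eq (h _ _) (hf _ _)⟩
  refine ⟨U ∩ basicOpen (f x.1 x.2), hU.inter (isOpen_basicOpen _), ⟨x.2, hf _ _⟩,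
    Set.inter_subset_left, a x.1 x.2, f x.1 x.2, fun y hy => ⟨hy.2, ?_⟩⟩
  apply j.fracVal_injective y.1
  exact (j.fracVal_frac_eq (h _ _) (hf _ _)).trans (j.fracVal_frac_eq (h _ _) hy.2).symm

end PrimeSpec

open PrimeSpec

/-- `f : M → M'` has the properties of the localization `M → M[m⁻¹]` that do not concern its
kernel: `f(m)` is invertible and every element of `M'` is a fraction `f(a) / f(m)ᵏ`. -/
structure IsAway {M M' : GenRing} (f : Hom M M') (m : M.op 1) : Prop where
  isUnit : ∃ u, u * f.app m = 1
  surj : ∀ {n : ℕ} (b : M'.op n), ∃ (k : ℕ) (a : M.op n), f.app a = M'.scale (f.app (m ^ k)) b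

namespace IsAway

variable {M M' : GenRing} {f : Hom M M'} {m : M.op 1} {K : Type} [Field K]
  {j : FieldEmbedding M K} {j' : FieldEmbedding M' K}

lemma comap_mem (hm : IsAway f m) (y : PrimeSpec M') : comap f y ∈ basicOpen m := by
  obtain ⟨u, hu⟩ := hm.isUnit
  intro h
  exact y.one_notMem (hu ▸ y.mul_mem u h)

lemma coe_eq (hf : f.IsOver j j') {n k : ℕ} {a : M.op n} {b : M'.op n}
    (h : f.app a = M'.scale (f.app (m ^ k)) b) (i : Fin n) :
    j.coe a i = j.coe m 0 ^ k * j'.coe b i := by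
  rw [← hf a, h, j'.coe_scale, hf, j.coe_pow]

lemma exists_coe_eq (hm : IsAway f m) (hf : f.IsOver j j') {n : ℕ} (b : M'.op n) :
    ∃ (k : ℕ) (a : M.op n), ∀ i, j.coe a i = j.coe m 0 ^ k * j'.coe b i := by
  obtain ⟨k, a, h⟩ := hm.surj b
  exact ⟨k, a, coe_eq hf h⟩

lemma stalkSet_eq (hm : IsAway f m) (hf : f.IsOver j j') (y : PrimeSpec M') (n : ℕ) :
    j'.stalkSet y n = j.stalkSet (comap f y) n := by
  ext v
  constructor
  · rintro ⟨b, s, hs, h⟩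
    obtain ⟨k, a, ha⟩ := hm.exists_coe_eq hf b
    obtain ⟨l, t, ht⟩ := hm.surj s
    have ht_notMem : f.app t ∉ y.carrier := by
      rw [ht]
      exact y.mul_notMem _ _ (pow_notMem (comap f y) (hm.comap_mem y) l) hs
    refine ⟨M.scale (m ^ l) a, m ^ k * t,
      (comap f y).mul_notMem _ _ (pow_notMem _ (hm.comap_mem y) k) ht_notMem, fun i => ?_⟩
    rw [j.coe_mul, j.coe_pow, j.coe_scale, j.coe_pow, ha, coe_eq hf ht, ← h]
    ring
  · rintro ⟨a, s, hs, h⟩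
    exact ⟨f.app a, f.app s, hs, fun i => by rw [hf, hf, h]⟩

/-- The prime ideal of `M'` generated by a prime ideal `𝔭` of `M` with `m ∉ 𝔭`. It consists of
the `b` with `mᵏ b = a` in `K` for some `k` and some `a ∈ 𝔭`. -/
def extend (hm : IsAway f m) (hf : f.IsOver j j') (p : PrimeSpec M) (hp : p ∈ basicOpen m) :
    PrimeSpec M' where
  carrier := {b | ∃ (k : ℕ) (a : M.op 1), a ∈ p.carrier ∧
    j.coe a 0 = j.coe m 0 ^ k * j'.coe b 0}
  subst_mem := by
    intro n t x hx
    choose k a ha h using hx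
    obtain ⟨l, t', ht'⟩ := hm.exists_coe_eq hf t
    refine ⟨l + ∑ i, k i, M.subst t' (fun i => m ^ (∑ i' ∈ Finset.univ.erase i, k i') * a i),
      p.subst_mem _ _ fun i => p.mul_mem _ (ha i), ?_⟩
    rw [j.coe_subst, j'.coe_subst, Finset.mul_sum]
    refine Finset.sum_congr rfl fun i _ => ?_
    rw [j.coe_mul, j.coe_pow, ht', h, ← Finset.sum_erase_add _ _ (Finset.mem_univ i)]
    ring
  one_notMem := by
    rintro ⟨k, a, ha, h⟩
    obtain rfl : a = m ^ k := j.eq_of_coe_zero_eq (by rw [h, j.coe_pow, j'.coe_one, mul_one])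
    exact pow_notMem p hp k ha
  mul_notMem := by
    rintro b b' hb hb' ⟨l, c, hc, h⟩
    obtain ⟨k, a, ha⟩ := hm.exists_coe_eq hf b
    obtain ⟨k', a', ha'⟩ := hm.exists_coe_eq hf b'
    have ha_notMem : a ∉ p.carrier := fun h' => hb ⟨k, a, h', ha 0⟩
    have ha'_notMem : a' ∉ p.carrier := fun h' => hb' ⟨k', a', h', ha' 0⟩
    have h_eq : m ^ l * (a * a') = m ^ (k + k') * c := j.eq_of_coe_zero_eq (by
      simp only [j.coe_mul, j.coe_pow, ha, ha', h, j'.coe_mul]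
      ring)
    exact p.mul_notMem _ _ (pow_notMem p hp l) (p.mul_notMem _ _ ha_notMem ha'_notMem)
      (h_eq ▸ p.mul_mem _ hc)

lemma comap_extend (hm : IsAway f m) (hf : f.IsOver j j') {p : PrimeSpec M}
    (hp : p ∈ basicOpen m) : comap f (hm.extend hf p hp) = p := by
  refine PrimeSpec.ext (Set.ext fun a => ⟨?_, fun ha => ⟨0, a, ha, ?_⟩⟩)
  · rintro ⟨k, a', ha', h⟩
    obtain rfl : a' = m ^ k * a :=
      j.eq_of_coe_zero_eq (by rw [h, hf, j.coe_mul, j.coe_pow])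
    by_contra ha
    exact p.mul_notMem _ _ (pow_notMem p hp k) ha ha'
  · rw [pow_zero, one_mul, hf]

lemma range_comap (hm : IsAway f m) (hf : f.IsOver j j') :
    Set.range (comap f) = basicOpen m :=
  Set.Subset.antisymm (Set.range_subset_iff.2 hm.comap_mem)
    fun p hp => ⟨hm.extend hf p hp, hm.comap_extend hf hp⟩

end IsAway

end GenRing

/-! ### Sections of a glued spectrum as vectors over a field -/

namespace GluedSpec

open GenRing PrimeSpec

variable {A B C : GenRing} {φ : Hom A B} {ψ : Hom C B}

lemma inl_mem_range_inr_iff {x : PrimeSpec A} :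
    inl φ ψ x ∈ Set.range (inr φ ψ) ↔ x ∈ Set.range (comap φ) := by
  constructor
  · rintro ⟨c, hc⟩
    -- a predicate on the glued space that holds on `Spec C` and tests membership on `Spec A`
    let P : GluedSpec φ ψ → Prop := Quot.lift
      (fun a => Sum.elim (fun x => x ∈ Set.range (comap φ)) (fun _ => True) a) (by
        rintro _ _ ⟨y, rfl, rfl⟩
        simp)
    have h : P (inr φ ψ c) := trivial
    rw [hc] at h
    exact h
  · rintro ⟨y, rfl⟩
    exact ⟨comap ψ y, (inl_comap φ ψ y).symm⟩

lemma inr_mem_range_inl_iff {x : PrimeSpec C} :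
    inr φ ψ x ∈ Set.range (inl φ ψ) ↔ x ∈ Set.range (comap ψ) := by
  constructor
  · rintro ⟨c, hc⟩
    let P : GluedSpec φ ψ → Prop := Quot.lift
      (fun a => Sum.elim (fun _ => True) (fun x => x ∈ Set.range (comap ψ)) a) (by
        rintro _ _ ⟨y, rfl, rfl⟩
        simp)
    have h : P (inl φ ψ c) := trivial
    rw [hc] at h
    exact h
  · rintro ⟨y, rfl⟩
    exact ⟨comap φ y, inl_comap φ ψ y⟩

lemma isOpen_iff {S : Set (GluedSpec φ ψ)} :
    IsOpen S ↔ IsOpen (inl φ ψ ⁻¹' S) ∧ IsOpen (inr φ ψ ⁻¹' S) :=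
  (isQuotientMap_quot_mk.isOpen_preimage (s := S)).symm.trans isOpen_sum_iff

lemma isOpen_range_inl (h : IsOpen (Set.range (comap ψ))) : IsOpen (Set.range (inl φ ψ)) := by
  refine isOpen_iff.2 ⟨?_, ?_⟩
  · rw [Set.preimage_range]
    exact isOpen_univ
  · rwa [show inr φ ψ ⁻¹' Set.range (inl φ ψ) = Set.range (comap ψ) from
      Set.ext fun _ => inr_mem_range_inl_iff]

lemma isOpen_range_inr (h : IsOpen (Set.range (comap φ))) : IsOpen (Set.range (inr φ ψ)) := by
  refine isOpen_iff.2 ⟨?_, ?_⟩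
  · rwa [show inl φ ψ ⁻¹' Set.range (inr φ ψ) = Set.range (comap φ) from
      Set.ext fun _ => inl_mem_range_inr_iff]
  · rw [Set.preimage_range]
    exact isOpen_univ

lemma exists_rep (z : GluedSpec φ ψ) : (∃ x, inl φ ψ x = z) ∨ ∃ x, inr φ ψ x = z := by
  induction z using Quot.ind with
  | mk a =>
    cases a with
    | inl x => exact .inl ⟨x, rfl⟩
    | inr x => exact .inr ⟨x, rfl⟩

variable {K : Type} [Field K] {jA : FieldEmbedding A K} {jB : FieldEmbedding B K}
  {jC : FieldEmbedding C K} {U : Opens (GluedSpec φ ψ)} {n : ℕ}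

lemma inl_generic (hφ : φ.IsOver jA jB) (hψ : ψ.IsOver jC jB) :
    inl φ ψ jA.generic = inr φ ψ jC.generic := by
  rw [← comap_generic hφ, ← comap_generic hψ, inl_comap]

lemma generic_mem (hφ : φ.IsOver jA jB) (hψ : ψ.IsOver jC jB) {z : GluedSpec φ ψ} (hz : z ∈ U) :
    inr φ ψ jC.generic ∈ U := by
  obtain ⟨x, rfl⟩ | ⟨x, rfl⟩ := exists_rep z
  · rw [← inl_generic hφ hψ]
    exact mem_of_le (U.2.preimage (continuous_inl φ ψ)) (jA.generic_le x) hz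
  · exact mem_of_le (U.2.preimage (continuous_inr φ ψ)) (jC.generic_le x) hz

variable (jC) in
/-- The value of a section at the generic point. -/
def val (U : Opens (GluedSpec φ ψ)) (hU : inr φ ψ jC.generic ∈ U) :
    Hom (sections U) (ofRing K) where
  app c := jC.fracVal jC.generic (c.1.2.1 ⟨jC.generic, hU⟩)
  map_var i := (jC.fracHom jC.generic).map_var i
  map_subst _ _ := (jC.fracHom jC.generic).map_subst _ _

lemma val_inr (hU : inr φ ψ jC.generic ∈ U) (c : (sections U).op n) (x : PrimeSpec C)
    (hx : inr φ ψ x ∈ U) :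
    jC.fracVal x (c.1.2.1 ⟨x, hx⟩) = (val jC U hU).app c :=
  c.1.2.2.fracVal_eq jC ⟨x, hx⟩ hU

lemma val_comap (hφ : φ.IsOver jA jB) (hψ : ψ.IsOver jC jB) (hU : inr φ ψ jC.generic ∈ U)
    (c : (sections U).op n) (y : PrimeSpec B) (hy : inl φ ψ (comap φ y) ∈ U) :
    jA.fracVal (comap φ y) (c.1.1.1 ⟨comap φ y, hy⟩) = (val jC U hU).app c := by
  have hy' : inr φ ψ (comap ψ y) ∈ U := by rwa [← inl_comap]
  rw [← fracVal_stalkMap hφ, c.2 y hy hy', fracVal_stalkMap hψ, val_inr hU]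

lemma val_inl (hφ : φ.IsOver jA jB) (hψ : ψ.IsOver jC jB) (hU : inr φ ψ jC.generic ∈ U)
    (c : (sections U).op n) (x : PrimeSpec A) (hx : inl φ ψ x ∈ U) :
    jA.fracVal x (c.1.1.1 ⟨x, hx⟩) = (val jC U hU).app c := by
  have hη : inl φ ψ jA.generic ∈ U := by rwa [inl_generic hφ hψ]
  have hη' : inl φ ψ (comap φ jB.generic) ∈ U := by rwa [comap_generic hφ]
  have h_eq := (c.1.1.2.fracVal_eq jA ⟨x, hx⟩ hη).trans (c.1.1.2.fracVal_eq jA ⟨_, hη'⟩ hη).symm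
  exact h_eq.trans (val_comap hφ hψ hU c jB.generic hη')

lemma val_injective (hφ : φ.IsOver jA jB) (hψ : ψ.IsOver jC jB) (hU : inr φ ψ jC.generic ∈ U)
    {c c' : (sections U).op n} (h : (val jC U hU).app c = (val jC U hU).app c') : c = c' := by
  refine Subtype.ext (Prod.ext (Subtype.ext (funext fun x => ?_))
    (Subtype.ext (funext fun x => ?_)))
  · apply jA.fracVal_injective
    exact (val_inl hφ hψ hU c x.1 x.2).trans (h.trans (val_inl hφ hψ hU c' x.1 x.2).symm)
  · apply jC.fracVal_injective
    exact (val_inr hU c x.1 x.2).trans (h.trans (val_inr hU c' x.1 x.2).symm)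

lemma exists_val_eq (hφ : φ.IsOver jA jB) (hψ : ψ.IsOver jC jB) (hU : inr φ ψ jC.generic ∈ U)
    {v : Fin n → K} (hA : ∀ x, inl φ ψ x ∈ U → v ∈ jA.stalkSet x n)
    (hC : ∀ x, inr φ ψ x ∈ U → v ∈ jC.stalkSet x n) :
    ∃ c : (sections U).op n, (val jC U hU).app c = v := by
  obtain ⟨s, hs, hsv⟩ := exists_isRegular jA (U.2.preimage (continuous_inl φ ψ)) hA
  obtain ⟨t, ht, htv⟩ := exists_isRegular jC (U.2.preimage (continuous_inr φ ψ)) hC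
  refine ⟨⟨(⟨s, hs⟩, ⟨t, ht⟩), fun y h k => ?_⟩, htv ⟨_, hU⟩⟩
  apply jB.fracVal_injective
  rw [fracVal_stalkMap hφ, fracVal_stalkMap hψ]
  exact (hsv ⟨_, h⟩).trans (htv ⟨_, k⟩).symm

lemma pullsBackTo_iff (hφ : φ.IsOver jA jB) (hψ : ψ.IsOver jC jB)
    (hU : inr φ ψ jC.generic ∈ U) (c : (sections U).op n) (b : B.op n) :
    PullsBackTo c b ↔ (val jC U hU).app c = jB.coe b := by
  have key : ∀ y (h : inl φ ψ (comap φ y) ∈ U),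
      (stalkMap φ y).app (c.1.1.1 ⟨comap φ y, h⟩) = frac b 1 ↔
        (val jC U hU).app c = jB.coe b := by
    intro y h
    have hb : jB.fracVal y (frac b 1) = jB.coe b := by
      rw [jB.fracVal_frac]
      funext k
      rw [OneMemClass.coe_one, jB.coe_one, div_one]
    rw [← val_comap hφ hψ hU c y h, ← hb, ← fracVal_stalkMap hφ]
    exact ⟨fun h => congrArg _ h, fun h => jB.fracVal_injective y h⟩
  have hη : inl φ ψ (comap φ jB.generic) ∈ U := by rwa [comap_generic hφ, inl_generic hφ hψ]
  exact ⟨fun h => (key _ hη).1 (h _ hη), fun h y hy => (key y hy).2 h⟩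

end GluedSpec

/-! ### The spectrum of a commutative ring as a generalized ring -/

namespace GenRing

open PrimeSpec

variable {R : Type} [CommRing R]

/-- A vector over `R` as an operation of the generalized ring `R`. -/
def vec {n : ℕ} (v : Fin n → R) : (ofRing R).op n := v

lemma vec_apply_zero (a : (ofRing R).op 1) : vec (fun _ => a 0) = a :=
  funext fun i => congrArg a (Subsingleton.elim 0 i)

lemma ofRing_mul_apply (a b : (ofRing R).op 1) : (a * b) 0 = a 0 * b 0 :=
  Fin.sum_univ_one (fun i => a i * b 0)

lemma ofRing_one_apply : (1 : (ofRing R).op 1) 0 = (1 : R) :=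
  Pi.single_eq_same (M := fun _ => R) (0 : Fin 1) 1

/-- A prime ideal of a ring as a prime ideal of the associated generalized ring. -/
def ofPrime (p : PrimeSpectrum R) : PrimeSpec (ofRing R) where
  carrier := {a | a 0 ∈ p.asIdeal}
  subst_mem t x hx := by
    change ∑ i, t i * x i 0 ∈ p.asIdeal
    exact Ideal.sum_mem _ fun i _ => p.asIdeal.mul_mem_left _ (hx i)
  one_notMem := by
    change (1 : (ofRing R).op 1) 0 ∉ p.asIdeal
    rw [ofRing_one_apply]
    exact p.asIdeal.ne_top_iff_one.1 p.2.ne_top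
  mul_notMem a b ha hb := by
    change (a * b) 0 ∉ p.asIdeal
    rw [ofRing_mul_apply]
    exact fun h => (p.2.mem_or_mem h).elim ha hb

lemma PrimeSpec.sum_mul_mem (q : PrimeSpec (ofRing R)) {n : ℕ} (t x : Fin n → R)
    (hx : ∀ i, vec (fun _ : Fin 1 => x i) ∈ q.carrier) :
    vec (fun _ : Fin 1 => ∑ i, t i * x i) ∈ q.carrier :=
  q.subst_mem (vec t) (fun i => vec fun _ => x i) hx

/-- A prime ideal of the generalized ring `R` as an ideal of the ring `R`. -/
def PrimeSpec.toIdeal (q : PrimeSpec (ofRing R)) : Ideal R where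
  carrier := {r | vec (fun _ : Fin 1 => r) ∈ q.carrier}
  add_mem' {a b} ha hb := by
    simpa using q.sum_mul_mem ![1, 1] ![a, b] (Fin.forall_fin_two.2 ⟨ha, hb⟩)
  zero_mem' := by simpa using q.sum_mul_mem (Fin.elim0 : Fin 0 → R) Fin.elim0 fun i => i.elim0
  smul_mem' a b hb := by simpa using q.sum_mul_mem ![a] ![b] (Fin.forall_fin_one.2 hb)

lemma PrimeSpec.apply_zero_mem_toIdeal {q : PrimeSpec (ofRing R)} {a : (ofRing R).op 1} :
    a 0 ∈ q.toIdeal ↔ a ∈ q.carrier := by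
  change vec (fun _ => a 0) ∈ q.carrier ↔ a ∈ q.carrier
  rw [vec_apply_zero]

lemma PrimeSpec.isPrime_toIdeal (q : PrimeSpec (ofRing R)) : q.toIdeal.IsPrime := by
  refine ⟨fun h => q.one_notMem ?_, fun {a b} hab => ?_⟩
  · rw [← apply_zero_mem_toIdeal, ofRing_one_apply]
    exact q.toIdeal.eq_top_iff_one.1 h
  · by_contra! h
    refine q.mul_notMem (vec fun _ => a) (vec fun _ => b) h.1 h.2 ?_
    rw [← apply_zero_mem_toIdeal, ofRing_mul_apply]
    exact hab

lemma ofPrime_surjective : Function.Surjective (ofPrime (R := R)) := fun q =>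
  ⟨⟨q.toIdeal, q.isPrime_toIdeal⟩, PrimeSpec.ext (Set.ext fun _ => apply_zero_mem_toIdeal)⟩

lemma continuous_ofPrime : Continuous (ofPrime (R := R)) := by
  refine continuous_generateFrom_iff.2 ?_
  rintro _ ⟨m, rfl⟩
  exact (PrimeSpectrum.basicOpen (m 0)).2

instance : CompactSpace (PrimeSpec (ofRing R)) :=
  ofPrime_surjective.compactSpace continuous_ofPrime

variable {K : Type} [Field K]

/-- An injective ring homomorphism to a field as an embedding of generalized rings. -/
def ringEmbedding (f : R →+* K) (hf : Function.Injective f) : FieldEmbedding (ofRing R) K where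
  toHom := ofRingHom f
  injective _ _ _ h := funext fun i => hf (congrFun h i)
  zero := Fin.elim0

/-- The ideal of denominators of a vector `v` over `K` with respect to `f : R → K`. -/
def denominators (f : R →+* K) {n : ℕ} (v : Fin n → K) : Ideal R where
  carrier := {s | ∃ a : Fin n → R, ∀ k, f s * v k = f (a k)}
  add_mem' := by
    rintro s t ⟨a, ha⟩ ⟨b, hb⟩
    exact ⟨a + b, fun k => by rw [map_add, add_mul, ha, hb, Pi.add_apply, map_add]⟩
  zero_mem' := ⟨0, fun k => by simp⟩
  smul_mem' := by
    rintro c s ⟨a, ha⟩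
    exact ⟨c • a, fun k => by
      rw [smul_eq_mul, map_mul, mul_assoc, ha, Pi.smul_apply, smul_eq_mul, map_mul]⟩

lemma exists_eq_map_of_forall_mem_stalkSet (f : R →+* K) (hf : Function.Injective f) {n : ℕ}
    {v : Fin n → K} (hv : ∀ p, v ∈ (ringEmbedding f hf).stalkSet p n) :
    ∃ a : Fin n → R, ∀ k, v k = f (a k) := by
  have h_top : denominators f v = ⊤ := by
    by_contra h
    obtain ⟨m, hm, h_le⟩ := Ideal.exists_le_maximal _ h
    obtain ⟨a, s, hs, has⟩ := hv (ofPrime ⟨m, hm.isPrime⟩)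
    exact hs (h_le ⟨a, has⟩ : s 0 ∈ m)
  obtain ⟨a, ha⟩ := (Ideal.eq_top_iff_one _).1 h_top
  exact ⟨a, fun k => by rw [← ha, map_one, one_mul]⟩

end GenRing

/-! ### The charts of `Spec ℤ^N`-hat -/

namespace SpecZHat

open GenRing PrimeSpec

variable (N : ℕ)

/-- The embedding of `ℤ[N⁻¹]` in `ℚ`. -/
def embB : FieldEmbedding (ofRing (ZInv N)) ℚ :=
  ringEmbedding (ZInv N).val.toRingHom Subtype.val_injective

/-- The embedding of `A_N` in `ℚ`. -/
def embA : FieldEmbedding (AN N) ℚ where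
  app a := (embB N).app ((ANincl N).app a)
  map_var i := (embB N).map_var i
  map_subst t x := (embB N).map_subst t.1 _
  injective n a b h := Subtype.ext ((embB N).injective n h)
  zero := ⟨Fin.elim0, by simp⟩

/-- The embedding of `ℤ` in `ℚ`. -/
def embZ : FieldEmbedding (ofRing ℤ) ℚ :=
  ringEmbedding (Int.castRingHom ℚ) Int.cast_injective

variable {N}

lemma embA_coe {n : ℕ} (a : (AN N).op n) (i : Fin n) : (embA N).coe a i = (a.1 i : ℚ) := rfl

lemma isOver_ANincl : (ANincl N).IsOver (embA N) (embB N) := fun _ _ => rfl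

lemma isOver_Zincl : (Zincl N).IsOver embZ (embB N) := fun n z => by
  funext i
  change ((algebraMap ℤ (ZInv N) (z i) : ZInv N) : ℚ) = (z i : ℚ)
  simp

lemma exists_pow_mul_eq (hN : N ≠ 0) (b : ZInv N) : ∃ (k : ℕ) (z : ℤ), (N : ℚ) ^ k * b = z := by
  obtain ⟨b, hb⟩ := b
  induction hb using Algebra.adjoin_induction with
  | mem x hx =>
    rw [Set.mem_singleton_iff] at hx
    exact ⟨1, 1, by simp [hx, hN]⟩
  | algebraMap z => exact ⟨0, z, by simp⟩
  | add x y hx hy ihx ihy =>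
    obtain ⟨k, z, h⟩ := ihx
    obtain ⟨l, w, h'⟩ := ihy
    refine ⟨k + l, N ^ l * z + N ^ k * w, ?_⟩
    push_cast
    rw [← h, ← h']
    ring
  | mul x y hx hy ihx ihy =>
    obtain ⟨k, z, h⟩ := ihx
    obtain ⟨l, w, h'⟩ := ihy
    refine ⟨k + l, z * w, ?_⟩
    push_cast
    rw [← h, ← h']
    ring

lemma exists_pow_mul_eq_pi (hN : N ≠ 0) {n : ℕ} (b : Fin n → ZInv N) :
    ∃ (k : ℕ) (z : Fin n → ℤ), ∀ i, (N : ℚ) ^ k * b i = z i := by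
  choose k z h using fun i => exists_pow_mul_eq hN (b i)
  refine ⟨∑ i, k i, fun i => N ^ (∑ i' ∈ Finset.univ.erase i, k i') * z i, fun i => ?_⟩
  push_cast
  rw [← h, ← Finset.sum_erase_add _ _ (Finset.mem_univ i)]
  ring

/-- The element `N⁻¹` of `ℤ[N⁻¹]`. -/
def invN (N : ℕ) : ZInv N := ⟨(N : ℚ)⁻¹, Algebra.subset_adjoin rfl⟩

variable (N) in
/-- The element `N⁻¹` of `A_N(𝟏)`; it is `0` for `N = 0`. -/
def invA : (AN N).op 1 := ⟨fun _ => invN N, by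
  rw [Fin.sum_univ_one]
  change |(N : ℚ)⁻¹| ≤ 1
  rw [abs_of_nonneg (by positivity)]
  exact Nat.cast_inv_le_one N⟩

lemma isAway_Zincl (hN : N ≠ 0) : IsAway (Zincl N) (vec fun _ => (N : ℤ)) where
  isUnit := by
    refine ⟨vec fun _ => invN N, (embB N).eq_of_coe_zero_eq ?_⟩
    rw [(embB N).coe_mul, (embB N).coe_one, isOver_Zincl]
    exact inv_mul_cancel₀ (Nat.cast_ne_zero.2 hN)
  surj b := by
    obtain ⟨k, z, h⟩ := exists_pow_mul_eq_pi hN b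
    refine ⟨k, vec z, (embB N).coe_injective (funext fun i => ?_)⟩
    rw [(embB N).coe_scale, isOver_Zincl, isOver_Zincl, embZ.coe_pow]
    exact (h i).symm

lemma exists_sum_abs_invN_pow_mul_le_one (hN : 1 < N) {n : ℕ} (b : Fin n → ZInv N) :
    ∃ k : ℕ, ∑ i, |invN N ^ k * b i| ≤ 1 := by
  obtain ⟨k, hk⟩ := pow_unbounded_of_one_lt (∑ i, |(b i : ℚ)|) (Nat.one_lt_cast.2 hN)
  have hN_pos : (0 : ℚ) < N ^ k := by positivity
  have h_abs : |invN N ^ k| = invN N ^ k :=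
    abs_of_nonneg (pow_nonneg (show (0 : ℚ) ≤ (N : ℚ)⁻¹ by positivity) k)
  refine ⟨k, ?_⟩
  simp only [abs_mul, h_abs, ← Finset.mul_sum]
  change ((invN N ^ k * ∑ i, |b i| : ZInv N) : ℚ) ≤ 1
  push_cast
  change ((N : ℚ)⁻¹) ^ k * ∑ i, |(b i : ℚ)| ≤ 1
  rw [inv_pow, inv_mul_le_iff₀ hN_pos, mul_one]
  exact hk.le

lemma isAway_ANincl (hN : 1 < N) : IsAway (ANincl N) (invA N) where
  isUnit := by
    refine ⟨vec fun _ => (N : ZInv N), (embB N).eq_of_coe_zero_eq ?_⟩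
    rw [(embB N).coe_mul, (embB N).coe_one]
    exact mul_inv_cancel₀ (Nat.cast_ne_zero.2 (by lia))
  surj {n} b := by
    obtain ⟨k, hk⟩ := exists_sum_abs_invN_pow_mul_le_one hN b
    let a : (AN N).op n := ⟨fun i => invN N ^ k * b i, hk⟩
    refine ⟨k, a, (embB N).coe_injective (funext fun i => ?_)⟩
    rw [(embB N).coe_scale, isOver_ANincl, isOver_ANincl, (embA N).coe_pow]
    rfl

/-- The chart `Spec A_N`. -/
def chartA (hN : 1 < N) : Opens (SpecZHat N).carrier :=
  ⟨Set.range (GluedSpec.inl (ANincl N) (Zincl N)), GluedSpec.isOpen_range_inl (by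
    rw [(isAway_Zincl (by lia)).range_comap isOver_Zincl]
    exact isOpen_basicOpen _)⟩

/-- The chart `Spec ℤ`. -/
def chartZ (hN : 1 < N) : Opens (SpecZHat N).carrier :=
  ⟨Set.range (GluedSpec.inr (ANincl N) (Zincl N)), GluedSpec.isOpen_range_inr (by
    rw [(isAway_ANincl hN).range_comap isOver_ANincl]
    exact isOpen_basicOpen _)⟩

lemma chartA_sup_chartZ (hN : 1 < N) : chartA hN ⊔ chartZ hN = ⊤ := by
  refine eq_top_iff.2 fun z _ => ?_
  obtain ⟨x, rfl⟩ | ⟨x, rfl⟩ := GluedSpec.exists_rep z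
  · exact Or.inl ⟨x, rfl⟩
  · exact Or.inr ⟨x, rfl⟩

variable (N) in
/-- The generic point. -/
def gen : (SpecZHat N).carrier := GluedSpec.inr (ANincl N) (Zincl N) embZ.generic

lemma gen_mem {U : Opens (SpecZHat N).carrier} {z : (SpecZHat N).carrier} (hz : z ∈ U) :
    gen N ∈ U := GluedSpec.generic_mem isOver_ANincl isOver_Zincl hz

lemma gen_mem_chartA (hN : 1 < N) : gen N ∈ chartA hN :=
  gen_mem (z := GluedSpec.inl (ANincl N) (Zincl N) (embA N).generic) ⟨_, rfl⟩

lemma gen_mem_chartZ (hN : 1 < N) : gen N ∈ chartZ hN := ⟨_, rfl⟩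

/-- The value at the generic point of a section of `𝒪(𝐧)`. -/
def val {U : Opens (SpecZHat N).carrier} (hU : gen N ∈ U) {n : ℕ}
    (c : ((SpecZHat N).O U).op n) : Fin n → ℚ :=
  (GluedSpec.val embZ U hU).app c

variable {U : Opens (SpecZHat N).carrier} (hU : gen N ∈ U) {n : ℕ}

lemma val_var (i : Fin n) : val hU (((SpecZHat N).O U).var i) = Pi.single i 1 :=
  (GluedSpec.val embZ U hU).map_var i

lemma val_subst {m : ℕ} (t : ((SpecZHat N).O U).op n) (x : Fin n → ((SpecZHat N).O U).op m) :
    val hU (((SpecZHat N).O U).subst t x) = ∑ i, val hU t i • val hU (x i) := by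
  refine ((GluedSpec.val embZ U hU).map_subst t x).trans (funext fun k => ?_)
  rw [Finset.sum_apply]
  rfl

lemma val_res {V : Opens (SpecZHat N).carrier} (h : V ≤ U) (hV : gen N ∈ V)
    (c : ((SpecZHat N).O U).op n) : val hV (((SpecZHat N).res h).app c) = val hU c := rfl

lemma val_injective {c c' : ((SpecZHat N).O U).op n} (h : val hU c = val hU c') : c = c' :=
  GluedSpec.val_injective isOver_ANincl isOver_Zincl hU h

lemma pullsBackTo_iff (c : ((SpecZHat N).O U).op n) (b : Fin n → ZInv N) :
    GluedSpec.PullsBackTo c b ↔ val hU c = fun i => (b i : ℚ) :=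
  GluedSpec.pullsBackTo_iff isOver_ANincl isOver_Zincl hU c b

lemma stalkSet_eq (hN : 1 < N) (y : PrimeSpec (ofRing (ZInv N))) :
    (embA N).stalkSet (comap (ANincl N) y) n = embZ.stalkSet (comap (Zincl N) y) n := by
  rw [← (isAway_ANincl hN).stalkSet_eq isOver_ANincl,
    ← (isAway_Zincl (by lia)).stalkSet_eq isOver_Zincl]

lemma exists_val_eq_of_le_chartZ (hN : 1 < N) (hUV : U ≤ chartZ hN) {v : Fin n → ℚ}
    (hv : ∀ x, GluedSpec.inr (ANincl N) (Zincl N) x ∈ U → v ∈ embZ.stalkSet x n) :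
    ∃ c : ((SpecZHat N).O U).op n, val hU c = v := by
  refine GluedSpec.exists_val_eq isOver_ANincl isOver_Zincl hU (fun x hx => ?_) hv
  obtain ⟨y, rfl⟩ := GluedSpec.inl_mem_range_inr_iff.1 (hUV hx)
  rw [stalkSet_eq hN]
  apply hv
  rwa [← GluedSpec.inl_comap]

lemma exists_val_eq_of_le_chartA (hN : 1 < N) (hUV : U ≤ chartA hN) {v : Fin n → ℚ}
    (hv : ∀ x, GluedSpec.inl (ANincl N) (Zincl N) x ∈ U → v ∈ (embA N).stalkSet x n) :
    ∃ c : ((SpecZHat N).O U).op n, val hU c = v := by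
  refine GluedSpec.exists_val_eq isOver_ANincl isOver_Zincl hU hv (fun x hx => ?_)
  obtain ⟨y, rfl⟩ := GluedSpec.inr_mem_range_inl_iff.1 (hUV hx)
  rw [← stalkSet_eq hN]
  apply hv
  rwa [GluedSpec.inl_comap]

lemma val_mem_stalkSet (c : ((SpecZHat N).O U).op n) {x : PrimeSpec (ofRing ℤ)}
    (hx : GluedSpec.inr (ANincl N) (Zincl N) x ∈ U) : val hU c ∈ embZ.stalkSet x n := by
  rw [val, ← GluedSpec.val_inr hU c x hx]
  exact embZ.fracVal_mem _ _

lemma exists_val_eq_int (hN : 1 < N) (hUV : U ≤ chartZ hN) (z : Fin n → ℤ) :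
    ∃ c : ((SpecZHat N).O U).op n, val hU c = fun i => (z i : ℚ) :=
  exists_val_eq_of_le_chartZ hU hN hUV fun x _ => embZ.coe_mem x z

lemma exists_int_val_eq (hN : 1 < N) (hUV : chartZ hN ≤ U) (c : ((SpecZHat N).O U).op n) :
    ∃ z : Fin n → ℤ, ∀ i, val hU c i = z i :=
  exists_eq_map_of_forall_mem_stalkSet (Int.castRingHom ℚ) Int.cast_injective
    fun x => val_mem_stalkSet hU c (hUV ⟨x, rfl⟩)

lemma exists_val_eq_AN (hN : 1 < N) (hUV : U ≤ chartA hN) (a : (AN N).op n) :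
    ∃ c : ((SpecZHat N).O U).op n, val hU c = fun i => (a.1 i : ℚ) :=
  exists_val_eq_of_le_chartA hU hN hUV fun x _ => (embA N).coe_mem x a

lemma exists_val_eq_ZInv (hN : 1 < N) (hUV : U ≤ chartA hN ⊓ chartZ hN) (b : Fin n → ZInv N) :
    ∃ c : ((SpecZHat N).O U).op n, val hU c = fun i => (b i : ℚ) := by
  refine exists_val_eq_of_le_chartZ hU hN (hUV.trans inf_le_right) fun x hx => ?_
  obtain ⟨y, rfl⟩ := GluedSpec.inr_mem_range_inl_iff.1 (hUV hx).1
  rw [← (isAway_Zincl (by lia)).stalkSet_eq isOver_Zincl]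
  exact (embB N).coe_mem y b

lemma exists_ZInv_val_eq (hN : 1 < N) (hUV : chartA hN ⊓ chartZ hN ≤ U)
    (c : ((SpecZHat N).O U).op n) : ∃ b : Fin n → ZInv N, ∀ i, val hU c i = b i := by
  refine exists_eq_map_of_forall_mem_stalkSet (ZInv N).val.toRingHom Subtype.val_injective
    fun y => ?_
  change _ ∈ (embB N).stalkSet y n
  rw [(isAway_Zincl (by lia)).stalkSet_eq isOver_Zincl]
  exact val_mem_stalkSet hU c (hUV ⟨⟨_, GluedSpec.inl_comap _ _ y⟩, ⟨_, rfl⟩⟩)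

lemma abs_sum_mul_lt_one {S : Type*} [Ring S] [LinearOrder S] [IsStrictOrderedRing S]
    {t x : Fin n → S} (ht : ∑ i, |t i| ≤ 1) (hx : ∀ i, |x i| < 1) : |∑ i, t i * x i| < 1 := by
  by_cases h : ∀ i, t i = 0
  · simp [h]
  · push Not at h
    obtain ⟨i, hi⟩ := h
    calc |∑ k, t k * x k| ≤ ∑ k, |t k| * |x k| := by
          simpa only [abs_mul] using Finset.abs_sum_le_sum_abs (fun k => t k * x k) Finset.univ
      _ < ∑ k, |t k| := Finset.sum_lt_sum
          (fun k _ => mul_le_of_le_one_right (abs_nonneg _) (hx k).le)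
          ⟨i, Finset.mem_univ i, mul_lt_of_lt_one_right (abs_pos.2 hi) (hx i)⟩
      _ ≤ 1 := ht

lemma AN_mul_apply (a b : (AN N).op 1) : (a * b).1 0 = a.1 0 * b.1 0 :=
  ofRing_mul_apply a.1 b.1

lemma AN_mul_self_eq_one {a : (AN N).op 1} (ha : ¬ |a.1 0| < 1) : a * a = 1 := by
  have h_le : |a.1 0| ≤ 1 := by simpa using a.2
  refine Subtype.ext (funext fun i => ?_)
  rw [Subsingleton.elim i 0, AN_mul_apply, ← abs_mul_abs_self, le_antisymm h_le (not_lt.1 ha),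
    one_mul]
  exact ofRing_one_apply.symm

variable (N) in
/-- The prime ideal `{|λ| < 1}` of `A_N`, the point at infinity of `SpecZHat N`. It is the only
closed point of `Spec A_N`: the elements outside it are the units `±1`. -/
def infty : PrimeSpec (AN N) where
  carrier := {a | |a.1 0| < 1}
  subst_mem t _ hx := abs_sum_mul_lt_one t.2 hx
  one_notMem := by
    change ¬ |(1 : (ofRing (ZInv N)).op 1) 0| < 1
    simp [ofRing_one_apply]
  mul_notMem a b ha hb := fun h => by
    have h_abs : ∀ {c : (AN N).op 1}, ¬ |c.1 0| < 1 → 1 ≤ |c.1 0| := not_lt.1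
    change |(a * b).1 0| < 1 at h
    rw [AN_mul_apply, abs_mul] at h
    exact (one_le_mul_of_one_le_of_one_le (h_abs ha) (h_abs hb)).not_gt h

lemma chartA_le_of_infty_mem (hN : 1 < N)
    (h : GluedSpec.inl (ANincl N) (Zincl N) (infty N) ∈ U) : chartA hN ≤ U := by
  rintro _ ⟨x, rfl⟩
  refine mem_of_le (U.2.preimage (GluedSpec.continuous_inl _ _)) (fun a ha => ?_) h
  by_contra ha'
  exact x.one_notMem (AN_mul_self_eq_one ha' ▸ x.mul_mem a ha)

lemma exists_AN_val_eq (hN : 1 < N) (hUV : chartA hN ≤ U) (c : ((SpecZHat N).O U).op n) :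
    ∃ a : (AN N).op n, ∀ i, val hU c i = a.1 i := by
  have hx : GluedSpec.inl (ANincl N) (Zincl N) (infty N) ∈ U := hUV ⟨_, rfl⟩
  have h := (embA N).fracVal_mem (infty N) (c.1.1.1 ⟨_, hx⟩)
  rw [GluedSpec.val_inl isOver_ANincl isOver_Zincl hU c _ hx] at h
  obtain ⟨a, s, hs, h⟩ := h
  refine ⟨(AN N).scale s a, fun i => ?_⟩
  rw [← embA_coe, (embA N).coe_scale, ← h, ← mul_assoc, ← (embA N).coe_mul,
    AN_mul_self_eq_one hs, (embA N).coe_one, one_mul]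
  rfl

end SpecZHat

/-! ### Vector bundles over `Spec ℤ` are free -/

lemma exists_eq_mul_notMem_ideal {R : Type*} [CommRing R] [IsDomain R] [IsPrincipalIdealRing R]
    (p : Ideal R) [hp : p.IsPrime] {d : R} (hd : d ≠ 0) :
    ∃ a b : R, d = a * b ∧ b ∉ p ∧ ∀ q : Ideal R, q.IsPrime → q ≠ p → a ∉ q := by
  obtain rfl | hp_bot := eq_or_ne p ⊥
  · exact ⟨1, d, (one_mul d).symm, hd, fun q hq _ => q.ne_top_iff_one.1 hq.ne_top⟩
  · obtain ⟨π, rfl⟩ := (inferInstance : p.IsPrincipal)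
    have hπ : Prime π := (Ideal.span_singleton_prime fun h => hp_bot (by simp [h])).1 hp
    obtain ⟨b, h_eq, hb⟩ := (FiniteMultiplicity.of_not_isUnit hπ.not_isUnit
      hd).exists_eq_pow_mul_and_not_dvd
    refine ⟨_, b, h_eq, fun h => hb (Ideal.mem_span_singleton.1 h), fun q hq hne h => hne ?_⟩
    have h_le := (Ideal.span_singleton_le_iff_mem q).2 (hq.mem_of_pow_mem _ h)
    exact ((hp.isMaximal hp_bot).eq_of_le hq.ne_top h_le).symm

lemma exists_common_denominator {ι : Type*} [Finite ι] (v : ι → ℚ) :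
    ∃ d : ℤ, d ≠ 0 ∧ ∀ i, ∃ a : ℤ, (d : ℚ) * v i = a := by
  obtain ⟨d, hd⟩ := IsLocalization.exist_integer_multiples_of_finite (nonZeroDivisors ℤ) v
  refine ⟨d, nonZeroDivisors.ne_zero d.2, fun i => ?_⟩
  obtain ⟨a, ha⟩ := hd i
  exact ⟨a, by simpa [Algebra.smul_def] using ha.symm⟩

lemma fg_of_forall_mul_eq_int {r : ℕ} (L : Submodule ℤ (Fin r → ℚ)) {D : ℤ} (hD : D ≠ 0)
    (hL : ∀ v ∈ L, ∃ a : Fin r → ℤ, ∀ k, (D : ℚ) * v k = a k) : L.FG := by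
  let φ : (Fin r → ℚ) →ₗ[ℤ] (Fin r → ℚ) := LinearMap.lsmul ℤ _ D
  have hφ : Function.Injective φ := smul_right_injective _ hD
  let ι : (Fin r → ℤ) →ₗ[ℤ] (Fin r → ℚ) := (Algebra.linearMap ℤ ℚ).compLeft (Fin r)
  refine Submodule.fg_of_fg_map_injective φ hφ ?_
  have h_le : L.map φ ≤ LinearMap.range ι := by
    rintro _ ⟨v, hv, rfl⟩
    obtain ⟨a, ha⟩ := hL v hv
    exact ⟨a, funext fun k => by simpa [φ, ι] using (ha k).symm⟩
  have := isNoetherian_of_le h_le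
  exact (Submodule.fg_top _).1 (Module.Finite.fg_top (R := ℤ) (M := L.map φ))

lemma span_eq_top_of_forall_smul_mem {V : Type*} [AddCommGroup V] [Module ℚ V]
    {L : Submodule ℤ V} (hL : ∀ v : V, ∃ d : ℤ, d ≠ 0 ∧ d • v ∈ L) :
    Submodule.span ℚ (L : Set V) = ⊤ := by
  refine eq_top_iff.2 fun v _ => ?_
  obtain ⟨d, hd, hdv⟩ := hL v
  have hd' : (d : ℚ) ≠ 0 := Int.cast_ne_zero.2 hd
  rw [← inv_smul_smul₀ hd' v, Int.cast_smul_eq_zsmul]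
  exact Submodule.smul_mem _ _ (Submodule.subset_span hdv)

lemma extendOfIsLattice_repr_apply {ι V : Type*} [Finite ι] [AddCommGroup V] [Module ℚ V]
    {L : Submodule ℤ V} [L.IsLattice ℚ] (b : Module.Basis ι ℤ L) {v : V} (hv : v ∈ L) (i : ι) :
    (b.extendOfIsLattice ℚ).repr v i = b.repr ⟨v, hv⟩ i := by
  have := Fintype.ofFinite ι
  have h_sum : v = ∑ i, (b.repr ⟨v, hv⟩ i : ℚ) • b.extendOfIsLattice ℚ i := by
    have h := congrArg Subtype.val (b.sum_repr ⟨v, hv⟩)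
    simp only [AddSubmonoidClass.coe_finsetSum, Submodule.coe_smul] at h
    simp only [Module.Basis.extendOfIsLattice_apply, Int.cast_smul_eq_zsmul, h]
  conv_lhs => rw [h_sum, Module.Basis.repr_sum_self]

namespace GenRing

variable {R : Type} [CommRing R]

lemma PrimeSpec.toIdeal_injective {p q : PrimeSpec (ofRing R)} (h : p.toIdeal = q.toIdeal) :
    p = q :=
  PrimeSpec.ext (Set.ext fun a => by
    rw [← apply_zero_mem_toIdeal, h, apply_zero_mem_toIdeal])

end GenRing

namespace SpecZHat

open GenRing PrimeSpec OModule

variable {N r : ℕ} {E : OModule (SpecZHat N)} {x : PrimeSpec (ofRing ℤ)}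

/-- The stalk of `𝒪(𝐫)` at a point of `Spec ℤ` as a subgroup of `ℚ^r`. -/
def stalkModule (x : PrimeSpec (ofRing ℤ)) (r : ℕ) : Submodule ℤ (Fin r → ℚ) where
  carrier := {v | ∃ s ∉ x.toIdeal, ∃ a : Fin r → ℤ, ∀ k, (s : ℚ) * v k = a k}
  zero_mem' := ⟨1, x.toIdeal.ne_top_iff_one.1 x.isPrime_toIdeal.ne_top, 0, fun k => by simp⟩
  add_mem' := by
    rintro v w ⟨s, hs, a, ha⟩ ⟨t, ht, b, hb⟩
    refine ⟨s * t, x.isPrime_toIdeal.mul_notMem hs ht, fun k => t * a k + s * b k, fun k => ?_⟩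
    push_cast
    rw [← ha, ← hb, Pi.add_apply]
    ring
  smul_mem' := by
    rintro c v ⟨s, hs, a, ha⟩
    refine ⟨s, hs, c • a, fun k => ?_⟩
    rw [Pi.smul_apply, Pi.smul_apply, zsmul_eq_mul, smul_eq_mul, Int.cast_mul, ← ha]
    ring

lemma mem_stalkModule_iff {v : Fin r → ℚ} : v ∈ stalkModule x r ↔ v ∈ embZ.stalkSet x r := by
  constructor
  · rintro ⟨s, hs, a, ha⟩
    exact ⟨vec a, vec fun _ => s, hs, ha⟩
  · rintro ⟨a, s, hs, ha⟩
    exact ⟨s 0, mt apply_zero_mem_toIdeal.1 hs, a, ha⟩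

lemma intCast_mem_stalkModule {v : Fin r → ℚ} {a : Fin r → ℤ} (h : ∀ k, v k = a k) :
    v ∈ stalkModule x r :=
  ⟨1, x.toIdeal.ne_top_iff_one.1 x.isPrime_toIdeal.ne_top, a, fun k => by
    rw [h, Int.cast_one, one_mul]⟩

lemma mem_stalkModule_of_smul {q : ℤ} (hq : q ∉ x.toIdeal) {v : Fin r → ℚ}
    (h : q • v ∈ stalkModule x r) : v ∈ stalkModule x r := by
  obtain ⟨s, hs, a, ha⟩ := h
  refine ⟨s * q, x.isPrime_toIdeal.mul_notMem hs hq, a, fun k => ?_⟩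
  rw [← ha, Pi.smul_apply, zsmul_eq_mul, Int.cast_mul, mul_assoc]

lemma sum_smul_mem_stalkModule {n : ℕ} {c : Fin n → ℚ} (hc : c ∈ stalkModule x n)
    {w : Fin n → Fin r → ℚ} (hw : ∀ i, w i ∈ stalkModule x r) :
    ∑ i, c i • w i ∈ stalkModule x r := by
  obtain ⟨s, hs, a, ha⟩ := hc
  refine mem_stalkModule_of_smul hs ?_
  have h_eq : s • ∑ i, c i • w i = ∑ i, a i • w i := by
    simp only [Finset.smul_sum, ← Int.cast_smul_eq_zsmul ℚ, smul_smul, ha]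
  rw [h_eq]
  exact Submodule.sum_mem _ fun i _ => Submodule.smul_mem _ _ (hw i)

lemma nonempty_unique_obj (F : OModule (SpecZHat N)) {W : Opens (SpecZHat N).carrier}
    (hW : gen N ∉ W) : Nonempty (Unique (F.obj W)) := by
  have h_empty : ∀ z, z ∉ W := fun z hz => hW (gen_mem hz)
  obtain ⟨s, -⟩ := exists_glue_of_mem (E := F) (W := W) (fun _ => W) (fun _ => le_rfl)
    (fun z => z.2) (fun z => absurd z.2 (h_empty z)) fun z => absurd z.2 (h_empty z)
  exact ⟨⟨⟨s⟩, fun t => ext_of_mem fun z hz => absurd hz (h_empty z)⟩⟩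

section

variable {W₀ : Opens (SpecZHat N).carrier} {e₀ : Fin r → E.obj W₀} (h₀ : gen N ∈ W₀)
  (he₀ : IsBasis E W₀ e₀) {U V W : Opens (SpecZHat N).carrier} {e : Fin r → E.obj U}

lemma gen_mem_inf (hU : gen N ∈ U) (hV : gen N ∈ V) : gen N ∈ U ⊓ V := ⟨hU, hV⟩

/-- The value at the generic point of a section of `E`, in coordinates with respect to a fixed
basis near this point. -/
def bval (hW : gen N ∈ W) (s : E.obj W) : Fin r → ℚ :=
  val (gen_mem_inf hW h₀) (he₀.coord inf_le_right (E.res inf_le_left s))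

lemma bval_act (hW : gen N ∈ W) {n : ℕ} (t : ((SpecZHat N).O W).op n) (s : Fin n → E.obj W) :
    bval h₀ he₀ hW ((E.str W).act t s) = ∑ i, val hW t i • bval h₀ he₀ hW (s i) := by
  rw [bval, E.res_act, he₀.coord_act, val_subst]
  rfl

lemma bval_res (h : V ≤ W) (hV : gen N ∈ V) (hW : gen N ∈ W) (s : E.obj W) :
    bval h₀ he₀ hV (E.res h s) = bval h₀ he₀ hW s := by
  have h_res : E.res (inf_le_left : V ⊓ W₀ ≤ V) (E.res h s) =
      E.res (inf_le_inf_right W₀ h) (E.res (inf_le_left : W ⊓ W₀ ≤ W) s) := by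
    rw [E.res_res, E.res_res]
  rw [bval, h_res, he₀.coord_res (inf_le_inf_right W₀ h) inf_le_right]
  rfl

lemma bval_basis (i : Fin r) : bval h₀ he₀ h₀ (e₀ i) = Pi.single i 1 := by
  rw [bval, he₀.coord_eq inf_le_right (t := ((SpecZHat N).O _).var i) ((E.str _).var_act _ _),
    val_var]

lemma res_eq_of_isBasis_of_bval_eq (he : IsBasis E U e) (hg : gen N ∈ W ⊓ U) {s t : E.obj W}
    (h : bval h₀ he₀ hg.1 s = bval h₀ he₀ hg.1 t) :
    E.res (inf_le_left : W ⊓ U ≤ W) s = E.res inf_le_left t := by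
  have h_near : E.res (inf_le_left : W ⊓ W₀ ≤ W) s = E.res inf_le_left t := by
    rw [← he₀.act_coord inf_le_right (E.res inf_le_left s),
      ← he₀.act_coord inf_le_right (E.res inf_le_left t), val_injective _ h]
  have h_le : W ⊓ U ⊓ W₀ ≤ W ⊓ W₀ := inf_le_inf_right W₀ inf_le_left
  have h_coord : he.coord inf_le_right (E.res (inf_le_left : W ⊓ U ≤ W) s) =
      he.coord inf_le_right (E.res inf_le_left t) := by
    apply val_injective hg
    have hg' : gen N ∈ W ⊓ U ⊓ W₀ := ⟨hg, h₀⟩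
    rw [← val_res _ inf_le_left hg', ← val_res _ inf_le_left hg',
      ← he.coord_res inf_le_left inf_le_right, ← he.coord_res inf_le_left inf_le_right,
      E.res_res, E.res_res, ← E.res_res h_le inf_le_left s, h_near, E.res_res]
  rw [← he.act_coord inf_le_right (E.res inf_le_left s), h_coord, he.act_coord]

lemma eq_of_bval_eq (hE : E.IsVectorBundle r) {s t : E.obj W}
    (h : ∀ hW : gen N ∈ W, bval h₀ he₀ hW s = bval h₀ he₀ hW t) : s = t :=
  ext_of_mem fun z hz => by
    obtain ⟨U, hzU, ⟨τ⟩⟩ := hE z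
    exact ⟨W ⊓ U, inf_le_left, ⟨hz, hzU⟩, res_eq_of_isBasis_of_bval_eq h₀ he₀ τ.isBasis
      (gen_mem (U := W ⊓ U) ⟨hz, hzU⟩) (h _)⟩

lemma span_bval (hU : gen N ∈ U) (he : IsBasis E U e) :
    ⊤ ≤ Submodule.span ℚ (Set.range fun i => bval h₀ he₀ hU (e i)) := by
  rw [← (Pi.basisFun ℚ (Fin r)).span_eq, Submodule.span_le]
  rintro _ ⟨i, rfl⟩
  have hg : gen N ∈ U ⊓ W₀ := ⟨hU, h₀⟩
  have h_eq := congrArg (bval h₀ he₀ hg) (he.act_coord inf_le_left (E.res inf_le_right (e₀ i)))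
  rw [bval_act, bval_res _ _ _ _ h₀, bval_basis] at h_eq
  rw [Pi.basisFun_apply, ← h_eq]
  refine Submodule.sum_mem _ fun k _ => Submodule.smul_mem _ _ (Submodule.subset_span ⟨k, ?_⟩)
  rw [bval_res _ _ _ _ hU]

/-- The basis of `ℚ^r` given by a basis of `E` over an open set. -/
def ratBasis (hU : gen N ∈ U) (he : IsBasis E U e) : Module.Basis (Fin r) ℚ (Fin r → ℚ) :=
  basisOfTopLeSpanOfCardEqFinrank _ (span_bval h₀ he₀ hU he) (by simp)

lemma ratBasis_apply (hU : gen N ∈ U) (he : IsBasis E U e) (i : Fin r) :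
    ratBasis h₀ he₀ hU he i = bval h₀ he₀ hU (e i) :=
  congrFun (coe_basisOfTopLeSpanOfCardEqFinrank _ (span_bval h₀ he₀ hU he) (by simp)) i

lemma ratBasis_repr_act (hU : gen N ∈ U) (he : IsBasis E U e) (hW : gen N ∈ W) (h : W ≤ U)
    (t : ((SpecZHat N).O W).op r) :
    ⇑((ratBasis h₀ he₀ hU he).repr
      (bval h₀ he₀ hW ((E.str W).act t fun i => E.res h (e i)))) = val hW t := by
  rw [bval_act]
  simp only [bval_res _ _ _ _ hU, ← ratBasis_apply h₀ he₀ hU he]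
  exact (ratBasis h₀ he₀ hU he).repr_sum_self _

lemma ratBasis_repr_mem (hU : gen N ∈ U) (he : IsBasis E U e) (hW : gen N ∈ W) (s : E.obj W)
    (hxW : GluedSpec.inr (ANincl N) (Zincl N) x ∈ W)
    (hxU : GluedSpec.inr (ANincl N) (Zincl N) x ∈ U) :
    ⇑((ratBasis h₀ he₀ hU he).repr (bval h₀ he₀ hW s)) ∈ stalkModule x r := by
  have hg : gen N ∈ W ⊓ U := ⟨hW, hU⟩
  rw [mem_stalkModule_iff, ← bval_res h₀ he₀ inf_le_left hg hW,
    ← he.act_coord inf_le_right (E.res inf_le_left s),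
    ratBasis_repr_act h₀ he₀ hU he hg inf_le_right]
  exact val_mem_stalkSet hg _ ⟨hxW, hxU⟩

/-- The stalk of `E` at a point of `Spec ℤ` as a subgroup of `ℚ^r`: the vectors whose coordinates
with respect to the bases of `E` near this point lie in the stalk of `𝒪(𝐫)`. -/
def stalk (x : PrimeSpec (ofRing ℤ)) : Submodule ℤ (Fin r → ℚ) where
  carrier := {v | ∀ ⦃U⦄ ⦃e : Fin r → E.obj U⦄ (hU : gen N ∈ U) (he : IsBasis E U e),
    GluedSpec.inr (ANincl N) (Zincl N) x ∈ U →
      ⇑((ratBasis h₀ he₀ hU he).repr v) ∈ stalkModule x r}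
  zero_mem' _ _ hU he _ := by
    simp only [map_zero, Finsupp.coe_zero]
    exact zero_mem _
  add_mem' hv hw _ _ hU he hx := by
    simp only [map_add, Finsupp.coe_add]
    exact add_mem (hv hU he hx) (hw hU he hx)
  smul_mem' c _ hv _ _ hU he hx := by
    simp only [map_zsmul, Finsupp.coe_smul]
    exact Submodule.smul_mem _ c (hv hU he hx)

variable {h₀ he₀}

lemma mem_stalk_of_repr_mem (hU : gen N ∈ U) (he : IsBasis E U e)
    (hx : GluedSpec.inr (ANincl N) (Zincl N) x ∈ U) {v : Fin r → ℚ}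
    (hv : ⇑((ratBasis h₀ he₀ hU he).repr v) ∈ stalkModule x r) : v ∈ stalk h₀ he₀ x := by
  intro U' e' hU' he' hx'
  have h_sum := congrArg (ratBasis h₀ he₀ hU' he').repr ((ratBasis h₀ he₀ hU he).sum_repr v)
  rw [← h_sum, map_sum, Finsupp.coe_finsetSum]
  simp only [map_smul, Finsupp.coe_smul]
  refine sum_smul_mem_stalkModule hv fun i => ?_
  rw [ratBasis_apply]
  exact ratBasis_repr_mem h₀ he₀ hU' he' hU (e i) hx hx'

lemma bval_mem_stalk (hW : gen N ∈ W) (s : E.obj W)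
    (hx : GluedSpec.inr (ANincl N) (Zincl N) x ∈ W) : bval h₀ he₀ hW s ∈ stalk h₀ he₀ x :=
  fun _ _ hU he hxU => ratBasis_repr_mem h₀ he₀ hU he hW s hx hxU

lemma mem_stalk_of_smul {q : ℤ} (hq : q ∉ x.toIdeal) {v : Fin r → ℚ}
    (h : q • v ∈ stalk h₀ he₀ x) : v ∈ stalk h₀ he₀ x := fun _ _ hU he hx => by
  have h_repr := h hU he hx
  rw [map_zsmul, Finsupp.coe_smul] at h_repr
  exact mem_stalkModule_of_smul hq h_repr

variable (h₀ he₀) in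
/-- The sections of `E` over `Spec ℤ` as a subgroup of `ℚ^r`. -/
def lattice : Submodule ℤ (Fin r → ℚ) := ⨅ x, stalk h₀ he₀ x

lemma exists_bval_eq_of_isBasis (hN : 1 < N) (he : IsBasis E U e)
    (hg : gen N ∈ U ⊓ chartZ hN) {v : Fin r → ℚ} (hv : v ∈ lattice h₀ he₀) :
    ∃ s : E.obj (U ⊓ chartZ hN), bval h₀ he₀ hg s = v := by
  obtain ⟨c, hc⟩ := exists_val_eq_of_le_chartZ hg hN inf_le_right fun x hx =>
    mem_stalkModule_iff.1 ((Submodule.mem_iInf _).1 hv x hg.1 he hx.1)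
  refine ⟨(E.str _).act c fun i => E.res inf_le_left (e i), ?_⟩
  apply (ratBasis h₀ he₀ hg.1 he).repr.injective
  apply DFunLike.coe_injective
  rw [ratBasis_repr_act, hc]

lemma exists_bval_eq (hN : 1 < N) (hE : E.IsVectorBundle r) {v : Fin r → ℚ}
    (hv : v ∈ lattice h₀ he₀) :
    ∃ s : E.obj (chartZ hN), bval h₀ he₀ (gen_mem_chartZ hN) s = v := by
  choose U hU τ using fun z => hE z
  have hg : ∀ z, gen N ∈ U z ⊓ chartZ hN := fun z => ⟨gen_mem (hU z), gen_mem_chartZ hN⟩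
  choose s hs using fun z => exists_bval_eq_of_isBasis hN (τ z).some.isBasis (hg z) hv
  obtain ⟨t, ht⟩ := exists_glue_of_mem (E := E) (fun z : chartZ hN => U z ⊓ chartZ hN)
    (fun _ => inf_le_right) (fun z => ⟨hU z, z.2⟩) (fun z => s z)
    (fun y z W hy hz => eq_of_bval_eq h₀ he₀ hE fun hW => by
      rw [bval_res _ _ _ _ (hg y), bval_res _ _ _ _ (hg z), hs, hs])
  refine ⟨t, ?_⟩
  rw [← bval_res h₀ he₀ inf_le_right (hg (gen N)) _ t, ht ⟨gen N, gen_mem_chartZ hN⟩, hs]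

lemma exists_finite_cover (hE : E.IsVectorBundle r) :
    ∃ (T : Finset (PrimeSpec (ofRing ℤ))) (U : T → Opens (SpecZHat N).carrier)
      (e : (k : T) → Fin r → E.obj (U k)), (∀ k, IsBasis E (U k) (e k)) ∧
      (∀ k, gen N ∈ U k) ∧ ∀ x, ∃ k, GluedSpec.inr (ANincl N) (Zincl N) x ∈ U k := by
  choose U hU τ using fun x => hE (GluedSpec.inr (ANincl N) (Zincl N) x)
  obtain ⟨T, hT⟩ := isCompact_univ.elim_finite_subcover
    (fun x => {x' | GluedSpec.inr (ANincl N) (Zincl N) x' ∈ U x})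
    (fun x => (U x).2.preimage (GluedSpec.continuous_inr _ _))
    (fun x _ => Set.mem_iUnion.2 ⟨x, hU x⟩)
  refine ⟨T, fun k => U k, fun k => (τ k).some.basis, fun k => (τ k).some.isBasis,
    fun k => gen_mem (hU k), fun x => ?_⟩
  obtain ⟨y, hy, hxy⟩ := Set.mem_iUnion₂.1 (hT (Set.mem_univ x))
  exact ⟨⟨y, hy⟩, hxy⟩

lemma exists_smul_mem_lattice (hE : E.IsVectorBundle r) (v : Fin r → ℚ) :
    ∃ d : ℤ, d ≠ 0 ∧ d • v ∈ lattice h₀ he₀ := by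
  obtain ⟨T, U, e, he, hU, hT⟩ := exists_finite_cover hE
  obtain ⟨d, hd, hdv⟩ := exists_common_denominator
    fun p : T × Fin r => (ratBasis h₀ he₀ (hU p.1) (he p.1)).repr v p.2
  choose a ha using hdv
  refine ⟨d, hd, (Submodule.mem_iInf _).2 fun x => ?_⟩
  obtain ⟨k, hk⟩ := hT x
  refine mem_stalk_of_repr_mem (hU k) (he k) hk
    (intCast_mem_stalkModule (a := fun i => a (k, i)) fun i => ?_)
  rw [map_zsmul, Finsupp.smul_apply, zsmul_eq_mul]
  exact ha (k, i)

lemma fg_lattice (hE : E.IsVectorBundle r) : (lattice h₀ he₀).FG := by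
  obtain ⟨T, U, e, he, hU, hT⟩ := exists_finite_cover hE
  obtain ⟨D, hD, hDe⟩ := exists_common_denominator
    fun p : T × Fin r × Fin r => bval h₀ he₀ (hU p.1) (e p.1 p.2.1) p.2.2
  choose A hA using hDe
  refine fg_of_forall_mul_eq_int _ hD fun v hv => exists_eq_map_of_forall_mem_stalkSet
    (Int.castRingHom ℚ) Int.cast_injective fun x => mem_stalkModule_iff.1 ?_
  obtain ⟨k, hk⟩ := hT x
  let b := ratBasis h₀ he₀ (hU k) (he k)
  have h_sum : (fun i => (D : ℚ) * v i) = ∑ l, b.repr v l • (D : ℚ) • b l := by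
    simp only [smul_comm _ (D : ℚ), ← Finset.smul_sum, b.sum_repr]
    rfl
  rw [h_sum]
  refine sum_smul_mem_stalkModule ((Submodule.mem_iInf _).1 hv x (hU k) (he k) hk) fun l =>
    intCast_mem_stalkModule (a := fun i => A (k, l, i)) fun i => ?_
  rw [← hA, Pi.smul_apply, smul_eq_mul, ratBasis_apply]

lemma isLattice_lattice (hE : E.IsVectorBundle r) : (lattice h₀ he₀).IsLattice ℚ where
  fg := fg_lattice hE
  span_eq_top := span_eq_top_of_forall_smul_mem (exists_smul_mem_lattice hE)

-- The part of a denominator of the section that is supported at `x` can be dropped, because the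
-- section is already integral at `x`.
lemma exists_smul_bval_mem_lattice (hE : E.IsVectorBundle r) (hW : gen N ∈ W) (s : E.obj W)
    (hx : GluedSpec.inr (ANincl N) (Zincl N) x ∈ W) :
    ∃ q ∉ x.toIdeal, q • bval h₀ he₀ hW s ∈ lattice h₀ he₀ := by
  obtain ⟨d, hd, hds⟩ := exists_smul_mem_lattice (h₀ := h₀) (he₀ := he₀) hE (bval h₀ he₀ hW s)
  have := x.isPrime_toIdeal
  obtain ⟨p, q, rfl, hq, hp⟩ := exists_eq_mul_notMem_ideal x.toIdeal hd
  refine ⟨q, hq, (Submodule.mem_iInf _).2 fun y => ?_⟩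
  obtain rfl | hyx := eq_or_ne y x
  · exact Submodule.smul_mem _ q (bval_mem_stalk hW s hx)
  · refine mem_stalk_of_smul (hp _ y.isPrime_toIdeal fun h => hyx (toIdeal_injective h)) ?_
    rw [smul_smul]
    exact (Submodule.mem_iInf _).1 hds y

lemma repr_bval_mem_stalkModule (hE : E.IsVectorBundle r) [(lattice h₀ he₀).IsLattice ℚ]
    (b : Module.Basis (Fin r) ℤ (lattice h₀ he₀)) (hW : gen N ∈ W) (s : E.obj W)
    (hx : GluedSpec.inr (ANincl N) (Zincl N) x ∈ W) :
    ⇑((b.extendOfIsLattice ℚ).repr (bval h₀ he₀ hW s)) ∈ stalkModule x r := by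
  obtain ⟨q, hq, hqs⟩ := exists_smul_bval_mem_lattice (h₀ := h₀) (he₀ := he₀) hE hW s hx
  refine mem_stalkModule_of_smul hq ?_
  rw [← Finsupp.coe_smul, ← map_zsmul]
  exact intCast_mem_stalkModule (extendOfIsLattice_repr_apply b hqs)

lemma isBasis_of_lattice_basis (hN : 1 < N) (hE : E.IsVectorBundle r)
    [(lattice h₀ he₀).IsLattice ℚ] (b : Module.Basis (Fin r) ℤ (lattice h₀ he₀))
    {f : Fin r → E.obj (chartZ hN)} (hf : ∀ i, bval h₀ he₀ (gen_mem_chartZ hN) (f i) = b i) :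
    IsBasis E (chartZ hN) f := by
  intro W hW
  by_cases hg : gen N ∈ W
  · let h := b.extendOfIsLattice ℚ
    have h_act (t : ((SpecZHat N).O W).op r) :
        bval h₀ he₀ hg ((E.str W).act t fun i => E.res hW (f i)) = ∑ i, val hg t i • h i := by
      rw [bval_act]
      simp only [bval_res _ _ _ _ (gen_mem_chartZ hN), hf, h, Module.Basis.extendOfIsLattice_apply]
    refine ⟨fun t t' htt => val_injective hg ?_, fun s => ?_⟩
    · have h_eq := congrArg (fun s => ⇑(h.repr (bval h₀ he₀ hg s))) htt
      simp only [h_act, h.repr_sum_self] at h_eq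
      exact h_eq
    · obtain ⟨t, ht⟩ := exists_val_eq_of_le_chartZ hg hN hW fun x hx =>
        mem_stalkModule_iff.1 (repr_bval_mem_stalkModule hE b hg s hx)
      refine ⟨t, eq_of_bval_eq h₀ he₀ hE fun _ => ?_⟩
      rw [h_act, ht]
      exact h.sum_repr _
  · obtain ⟨_⟩ := nonempty_unique_obj (free _ r) hg
    obtain ⟨_⟩ := nonempty_unique_obj E hg
    exact ⟨fun _ _ _ => Subsingleton.elim (α := (free _ r).obj W) _ _,
      fun s => ⟨(default : (free _ r).obj W), Subsingleton.elim _ _⟩⟩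

end

lemma exists_isBasis_chartZ (hN : 1 < N) (hE : E.IsVectorBundle r) :
    ∃ f : Fin r → E.obj (chartZ hN), IsBasis E (chartZ hN) f := by
  obtain ⟨W₀, h₀, ⟨τ₀⟩⟩ := hE (gen N)
  have := isLattice_lattice (h₀ := h₀) (he₀ := τ₀.isBasis) hE
  have h_rank : Module.finrank ℤ (lattice h₀ τ₀.isBasis) = r := by
    simpa using Submodule.IsLattice.finrank_of_pi ℚ (lattice h₀ τ₀.isBasis)
  let b := (Module.finBasis ℤ (lattice h₀ τ₀.isBasis)).reindex (finCongr h_rank)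
  choose f hf using fun i => exists_bval_eq hN hE (b i).2
  exact ⟨f, isBasis_of_lattice_basis hN hE b hf⟩

lemma exists_isBasis_chartA (hN : 1 < N) (hE : E.IsVectorBundle r) :
    ∃ e : Fin r → E.obj (chartA hN), IsBasis E (chartA hN) e := by
  obtain ⟨U, hU, ⟨τ⟩⟩ := hE (GluedSpec.inl (ANincl N) (Zincl N) (infty N))
  exact ⟨_, τ.isBasis.restrict (chartA_le_of_infty_mem hN hU)⟩

end SpecZHat

/-! ### The symmetries of the octahedron -/

section Octahedron

section Matrix

variable {ι R : Type*} [Fintype ι] [DecidableEq ι] [CommRing R] [LinearOrder R]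
  [IsStrictOrderedRing R] {P Q : Matrix ι ι R}

lemma apply_mul_apply_eq_abs_of_row_sum_le (hPQ : P * Q = 1) (hP : ∀ i, ∑ j, |P i j| ≤ 1)
    (hQ : ∀ i, ∑ j, |Q i j| ≤ 1) (i j : ι) : P i j * Q j i = |P i j| := by
  have abs_le : ∀ j, |Q j i| ≤ 1 := fun j =>
    (Finset.single_le_sum (fun k _ => abs_nonneg (Q j k)) (Finset.mem_univ i)).trans (hQ j)
  have le_abs : ∀ j, P i j * Q j i ≤ |P i j| := fun j =>
    calc P i j * Q j i ≤ |P i j| * |Q j i| := (le_abs_self _).trans (abs_mul _ _).le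
      _ ≤ |P i j| := mul_le_of_le_one_right (abs_nonneg _) (abs_le j)
  have sum_eq_one : ∑ j, P i j * Q j i = 1 := by
    rw [← Matrix.mul_apply, hPQ, Matrix.one_apply_eq]
  have sum_eq : ∑ j, P i j * Q j i = ∑ j, |P i j| :=
    (Finset.sum_le_sum fun j _ => le_abs j).antisymm (sum_eq_one ▸ hP i)
  exact (Finset.sum_eq_sum_iff_of_le fun j _ => le_abs j).1 sum_eq j (Finset.mem_univ j)

lemma eq_transpose_of_row_sum_le (hPQ : P * Q = 1) (hQP : Q * P = 1)
    (hP : ∀ i, ∑ j, |P i j| ≤ 1) (hQ : ∀ i, ∑ j, |Q i j| ≤ 1) : Q = P.transpose := by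
  ext j i
  have hp : P i j * Q j i = |P i j| := apply_mul_apply_eq_abs_of_row_sum_le hPQ hP hQ i j
  have hq : Q j i * P i j = |Q j i| := apply_mul_apply_eq_abs_of_row_sum_le hQP hQ hP j i
  have habs : |P i j| = |Q j i| := by rw [← hp, ← hq, mul_comm]
  have habs' : |P i j| * |Q j i| = |P i j| := by rw [← abs_mul, hp, abs_abs]
  refine sub_eq_zero.1 (pow_eq_zero_iff two_ne_zero |>.1 ?_)
  calc (Q j i - P i j) ^ 2 = |P i j| * |P i j| + |Q j i| * |Q j i| - 2 * (P i j * Q j i) := by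
        rw [abs_mul_abs_self, abs_mul_abs_self]
        ring
    _ = 2 * (|P i j| * |Q j i|) - 2 * |P i j| := by
        rw [hp, ← habs]
        ring
    _ = 0 := by rw [habs', sub_self]

lemma row_sum_le_iff_col_sum_le (hPQ : P * Q = 1) (hQP : Q * P = 1) :
    ((∀ i, ∑ j, |P i j| ≤ 1) ∧ ∀ i, ∑ j, |Q i j| ≤ 1) ↔
      (∀ j, ∑ i, |P i j| ≤ 1) ∧ ∀ j, ∑ i, |Q i j| ≤ 1 := by
  have col_sum_le : ∀ {P Q : Matrix ι ι R}, P * Q = 1 → Q * P = 1 →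
      (∀ i, ∑ j, |P i j| ≤ 1) → (∀ i, ∑ j, |Q i j| ≤ 1) →
        (∀ j, ∑ i, |P i j| ≤ 1) ∧ ∀ j, ∑ i, |Q i j| ≤ 1 := fun hPQ hQP hP hQ => by
    obtain rfl := eq_transpose_of_row_sum_le hPQ hQP hP hQ
    exact ⟨hQ, hP⟩
  refine ⟨fun h => col_sum_le hPQ hQP h.1 h.2, fun h => ?_⟩
  exact col_sum_le (P := P.transpose) (Q := Q.transpose)
    (by rw [← Matrix.transpose_mul, hQP, Matrix.transpose_one])
    (by rw [← Matrix.transpose_mul, hPQ, Matrix.transpose_one]) h.1 h.2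

end Matrix

variable {r : ℕ}

lemma mulVec_mem_octahedron {A : Matrix (Fin r) (Fin r) ℝ} (hA : ∀ j, ∑ i, |A i j| ≤ 1)
    {x : Fin r → ℝ} (hx : x ∈ octahedron r) : A.mulVec x ∈ octahedron r :=
  calc ∑ i, |∑ j, A i j * x j| ≤ ∑ i, ∑ j, |A i j| * |x j| :=
        Finset.sum_le_sum fun i _ => (Finset.abs_sum_le_sum_abs _ _).trans_eq
          (Finset.sum_congr rfl fun j _ => abs_mul _ _)
    _ = ∑ j, (∑ i, |A i j|) * |x j| := by
        rw [Finset.sum_comm]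
        simp only [Finset.sum_mul]
    _ ≤ ∑ j, |x j| :=
        Finset.sum_le_sum fun j _ => mul_le_of_le_one_left (abs_nonneg _) (hA j)
    _ ≤ 1 := hx

lemma col_sum_le_of_mem_octReal {g : GL (Fin r) ℝ} (hg : g ∈ octReal r) (j : Fin r) :
    ∑ i, |g.1 i j| ≤ 1 := by
  have image_eq : (fun x => g.1.mulVec x) '' octahedron r = octahedron r := hg
  have single_mem : Pi.single j 1 ∈ octahedron r := by
    change ∑ i, |(Pi.single j 1 : Fin r → ℝ) i| ≤ 1
    simp [Pi.single_apply, apply_ite]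
  have col_mem : g.1.mulVec (Pi.single j 1) ∈ octahedron r :=
    image_eq ▸ Set.mem_image_of_mem _ single_mem
  rwa [Matrix.mulVec_single_one] at col_mem

lemma mem_octReal_iff {g : GL (Fin r) ℝ} : g ∈ octReal r ↔
    (∀ i, ∑ j, |g.1 i j| ≤ 1) ∧ ∀ i, ∑ j, |(g⁻¹).1 i j| ≤ 1 := by
  rw [row_sum_le_iff_col_sum_le g.mul_inv g.inv_mul]
  refine ⟨fun hg => ⟨col_sum_le_of_mem_octReal hg, col_sum_le_of_mem_octReal (inv_mem hg)⟩,
    fun ⟨hg, hg'⟩ => ?_⟩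
  change (fun x => g.1.mulVec x) '' octahedron r = octahedron r
  refine (Set.image_subset_iff.2 fun x => mulVec_mem_octahedron hg).antisymm fun x hx =>
    ⟨(g⁻¹).1.mulVec x, mulVec_mem_octahedron hg' hx, ?_⟩
  simp only [Matrix.mulVec_mulVec, g.mul_inv, Matrix.one_mulVec]

lemma mem_Oct_iff {N : ℕ} {g : GL (Fin r) (ZInv N)} : g ∈ Oct N r ↔
    (∀ i, ∑ j, |g.1 i j| ≤ 1) ∧ ∀ i, ∑ j, |(g⁻¹).1 i j| ≤ 1 := by
  have row_sum_le_iff : ∀ (h : GL (Fin r) (ZInv N)) (i : Fin r),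
      ∑ j, |(Matrix.GeneralLinearGroup.map (ZInv.toReal N) h).1 i j| ≤ 1 ↔
        ∑ j, |h.1 i j| ≤ 1 := fun h i => by
    have cast_sum : ∑ j, |(Matrix.GeneralLinearGroup.map (ZInv.toReal N) h).1 i j| =
        (((∑ j, |h.1 i j| : ZInv N) : ℚ) : ℝ) := by
      push_cast
      exact Finset.sum_congr rfl fun j _ => (Rat.cast_abs _).symm
    rw [cast_sum]
    exact_mod_cast Iff.rfl
  change Matrix.GeneralLinearGroup.map (ZInv.toReal N) g ∈ octReal r ↔ _
  rw [mem_octReal_iff, ← map_inv]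
  exact and_congr (forall_congr' (row_sum_le_iff g)) (forall_congr' (row_sum_le_iff g⁻¹))

end Octahedron

/-! ### Vector bundles and their matrices -/

namespace OModule

variable {X : GenRingedSpace} {E : OModule X} {r r' s s' : ℕ} {U V : Opens X.carrier}
  {e : Fin r → E.obj U} {f : Fin s → E.obj V}

lemma exists_isTransition {f : Fin r → E.obj V} (he : IsBasis E U e) (hf : IsBasis E V f) :
    ∃ c d : Fin r → (X.O (U ⊓ V)).op r, (X.O (U ⊓ V)).IsInverse c d ∧ IsTransition c e f := by
  have hf' := hf.restrict (V := U ⊓ V) inf_le_right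
  refine ⟨_, _, hf'.isInverse_coord (he.restrict (V := U ⊓ V) inf_le_left), fun i => ?_⟩
  simpa only [E.res_self] using (hf'.act_coord le_rfl (E.res inf_le_left (e i))).symm

lemma IsTransition.unique (hf : IsBasis E V f) {c c' : Fin r → (X.O (U ⊓ V)).op s}
    (hc : IsTransition c e f) (hc' : IsTransition c' e f) : c = c' :=
  funext fun i => (hf (U ⊓ V) inf_le_right).1 ((hc i).symm.trans (hc' i))

lemma IsTransition.change {c : Fin r → (X.O (U ⊓ V)).op s} (hc : IsTransition c e f)
    {e' : Fin r' → E.obj U} {f' : Fin s' → E.obj V} {p : Fin r' → (X.O U).op r}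
    {q : Fin s → (X.O V).op s'} (hp : ∀ i, (E.str U).act (p i) e = e' i)
    (hq : ∀ j, (E.str V).act (q j) f' = f j) :
    IsTransition (fun i => (X.O (U ⊓ V)).subst
      ((X.O (U ⊓ V)).subst ((X.res inf_le_left).app (p i)) c)
      (fun j => (X.res inf_le_right).app (q j))) e' f' := fun i => by
  rw [← hp, E.res_act, funext hc]
  simp only [← hq, E.res_act, (E.str _).act_assoc]

lemma IsTransition.map {F : OModule X} {c : Fin r → (X.O (U ⊓ V)).op s}
    (hc : IsTransition c e f) (φ : Hom E F) :
    IsTransition c (fun i => φ.app U (e i)) (fun j => φ.app V (f j)) := fun i => by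
  rw [← φ.naturality, hc, φ.map_act]
  simp only [φ.naturality]

lemma IsVectorBundle.of_isIsoTo {F : OModule X} (hE : E.IsVectorBundle r) (h : IsIsoTo E F) :
    F.IsVectorBundle r := fun x => by
  obtain ⟨φ, ψ, h₁, h₂⟩ := h
  obtain ⟨U, hx, ⟨τ⟩⟩ := hE x
  exact ⟨U, hx, ⟨(τ.isBasis.map h₁ h₂).trivialization⟩⟩

lemma isVectorBundle_of_sup_eq_top (hUV : U ⊔ V = ⊤) {f : Fin r → E.obj V} (he : IsBasis E U e)
    (hf : IsBasis E V f) : E.IsVectorBundle r := fun x => by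
  obtain hx | hx : x ∈ U ⊔ V := hUV ▸ trivial
  · exact ⟨U, hx, ⟨he.trivialization⟩⟩
  · exact ⟨V, hx, ⟨hf.trivialization⟩⟩

end OModule

namespace SpecZHat

open GenRing PrimeSpec OModule

variable {N r s t : ℕ} {E F : OModule (SpecZHat N)}

section Matrix

variable {U : Opens (SpecZHat N).carrier} (hU : gen N ∈ U)

/-- The rational matrix whose rows are the values of the `c i` at the generic point. -/
def valMatrix (c : Fin r → ((SpecZHat N).O U).op s) : Matrix (Fin r) (Fin s) ℚ :=
  Matrix.of fun i => val hU (c i)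

variable {hU} in
lemma valMatrix_injective {c c' : Fin r → ((SpecZHat N).O U).op s}
    (h : valMatrix hU c = valMatrix hU c') : c = c' :=
  funext fun i => val_injective hU (congrFun h i)

lemma valMatrix_subst (c : Fin r → ((SpecZHat N).O U).op s)
    (d : Fin s → ((SpecZHat N).O U).op t) :
    valMatrix hU (fun i => ((SpecZHat N).O U).subst (c i) d) =
      valMatrix hU c * valMatrix hU d := by
  ext i k
  rw [valMatrix, Matrix.of_apply, val_subst, Finset.sum_apply, Matrix.mul_apply]
  rfl

lemma valMatrix_var : valMatrix hU ((SpecZHat N).O U).var = (1 : Matrix (Fin r) (Fin r) ℚ) := by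
  ext i k
  rw [valMatrix, Matrix.of_apply, val_var, Matrix.one_eq_pi_single]

lemma isInverse_iff {c d : Fin r → ((SpecZHat N).O U).op r} :
    ((SpecZHat N).O U).IsInverse c d ↔
      valMatrix hU c * valMatrix hU d = 1 ∧ valMatrix hU d * valMatrix hU c = 1 := by
  simp only [← valMatrix_subst, ← valMatrix_var hU]
  refine and_congr ?_ ?_ <;>
    exact ⟨fun h => congrArg _ (funext h), fun h => congrFun (valMatrix_injective h)⟩

/-- A matrix over `ℤ[N⁻¹]` as a matrix over `ℚ`. -/
def ratMatrix (N r : ℕ) : Matrix (Fin r) (Fin r) (ZInv N) →+* Matrix (Fin r) (Fin r) ℚ :=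
  (algebraMap (ZInv N) ℚ).mapMatrix

lemma ratMatrix_injective : Function.Injective (ratMatrix N r) :=
  Matrix.map_injective Subtype.val_injective

/-- `A` is the matrix of an automorphism of the free module of rank `r` over `U`. -/
def IsMatrixOver (A : GL (Fin r) (ZInv N)) : Prop :=
  ∃ c d : Fin r → ((SpecZHat N).O U).op r, ((SpecZHat N).O U).IsInverse c d ∧
    valMatrix hU c = ratMatrix N r A.1

lemma isMatrixOver_iff {A : GL (Fin r) (ZInv N)} : IsMatrixOver hU A ↔
    (∃ c : Fin r → ((SpecZHat N).O U).op r, valMatrix hU c = ratMatrix N r A.1) ∧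
      ∃ d : Fin r → ((SpecZHat N).O U).op r, valMatrix hU d = ratMatrix N r (A⁻¹).1 := by
  have mul_inv : ratMatrix N r A.1 * ratMatrix N r (A⁻¹).1 = 1 := by
    rw [← map_mul, A.mul_inv, map_one]
  have inv_mul : ratMatrix N r (A⁻¹).1 * ratMatrix N r A.1 = 1 := by
    rw [← map_mul, A.inv_mul, map_one]
  constructor
  · rintro ⟨c, d, hcd, hc⟩
    have hd := ((isInverse_iff hU).1 hcd).2
    exact ⟨⟨c, hc⟩, d, left_inv_eq_right_inv (hc ▸ hd) mul_inv⟩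
  · rintro ⟨⟨c, hc⟩, d, hd⟩
    exact ⟨c, d, (isInverse_iff hU).2 (by rw [hc, hd]; exact ⟨mul_inv, inv_mul⟩), hc⟩

variable {hU} in
lemma exists_valMatrix_eq_of_isInverse (hN : 1 < N) (h : chartA hN ⊓ chartZ hN ≤ U)
    {c d : Fin r → ((SpecZHat N).O U).op r} (hcd : ((SpecZHat N).O U).IsInverse c d) :
    ∃ A : GL (Fin r) (ZInv N), IsMatrixOver hU A ∧ valMatrix hU c = ratMatrix N r A.1 := by
  have exists_ratMatrix_eq : ∀ c : Fin r → ((SpecZHat N).O U).op r,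
      ∃ A, valMatrix hU c = ratMatrix N r A := fun c => by
    choose A hA using fun i => exists_ZInv_val_eq hU hN h (c i)
    exact ⟨Matrix.of A, Matrix.ext hA⟩
  obtain ⟨A, hA⟩ := exists_ratMatrix_eq c
  obtain ⟨B, hB⟩ := exists_ratMatrix_eq d
  obtain ⟨hAB, hBA⟩ := (isInverse_iff hU).1 hcd
  rw [hA, hB, ← map_mul, ← map_one (ratMatrix N r)] at hAB hBA
  exact ⟨⟨A, B, ratMatrix_injective hAB, ratMatrix_injective hBA⟩, ⟨c, d, hcd, hA⟩, hA⟩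

end Matrix

lemma isMatrixOver_chartA_inf_chartZ (hN : 1 < N) (A : GL (Fin r) (ZInv N)) :
    IsMatrixOver (gen_mem_inf (gen_mem_chartA hN) (gen_mem_chartZ hN)) A := by
  have exists_valMatrix_eq : ∀ A : Matrix (Fin r) (Fin r) (ZInv N),
      ∃ c, valMatrix (gen_mem_inf (gen_mem_chartA hN) (gen_mem_chartZ hN)) c =
        ratMatrix N r A := fun A => by
    choose c hc using fun i => exists_val_eq_ZInv (gen_mem_inf (gen_mem_chartA hN)
      (gen_mem_chartZ hN)) hN le_rfl (A i)
    exact ⟨c, funext hc⟩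
  exact (isMatrixOver_iff _).2 ⟨exists_valMatrix_eq _, exists_valMatrix_eq _⟩

lemma isMatrixOver_chartA_iff (hN : 1 < N) {A : GL (Fin r) (ZInv N)} :
    IsMatrixOver (gen_mem_chartA hN) A ↔ A ∈ Oct N r := by
  have exists_valMatrix_eq_iff : ∀ A : Matrix (Fin r) (Fin r) (ZInv N),
      (∃ c, valMatrix (gen_mem_chartA hN) c = ratMatrix N r A) ↔ ∀ i, ∑ j, |A i j| ≤ 1 := by
    refine fun A => ⟨fun ⟨c, hc⟩ i => ?_, fun hA => ?_⟩
    · obtain ⟨a, ha⟩ := exists_AN_val_eq (gen_mem_chartA hN) hN le_rfl (c i)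
      have : a.1 = A i := funext fun j =>
        Subtype.val_injective ((ha j).symm.trans (congrFun (congrFun hc i) j))
      exact this ▸ a.2
    · choose c hc using fun i => exists_val_eq_AN (gen_mem_chartA hN) hN le_rfl ⟨A i, hA i⟩
      exact ⟨c, funext hc⟩
  rw [isMatrixOver_iff, mem_Oct_iff, exists_valMatrix_eq_iff, exists_valMatrix_eq_iff]

lemma mem_GLZ_iff {A : GL (Fin r) (ZInv N)} : A ∈ GLZ N r ↔
    (∃ B : Matrix (Fin r) (Fin r) ℤ, B.map (algebraMap ℤ (ZInv N)) = A.1) ∧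
      ∃ B : Matrix (Fin r) (Fin r) ℤ, B.map (algebraMap ℤ (ZInv N)) = (A⁻¹).1 := by
  refine ⟨?_, fun ⟨⟨B, hB⟩, B', hB'⟩ => ?_⟩
  · rintro ⟨Z, rfl⟩
    exact ⟨⟨Z.1, rfl⟩, (Z⁻¹).1, rfl⟩
  · have map_injective : Function.Injective
        ((algebraMap ℤ (ZInv N)).mapMatrix (m := Fin r)) :=
      Matrix.map_injective (algebraMap ℤ (ZInv N)).injective_int
    have hBB' : B * B' = 1 := map_injective (by
      rw [map_mul, map_one]
      exact (congrArg₂ (· * ·) hB hB').trans A.mul_inv)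
    have hB'B : B' * B = 1 := map_injective (by
      rw [map_mul, map_one]
      exact (congrArg₂ (· * ·) hB' hB).trans A.inv_mul)
    exact ⟨⟨B, B', hBB', hB'B⟩, Units.ext hB⟩

lemma isMatrixOver_chartZ_iff (hN : 1 < N) {A : GL (Fin r) (ZInv N)} :
    IsMatrixOver (gen_mem_chartZ hN) A ↔ A ∈ GLZ N r := by
  have exists_valMatrix_eq_iff : ∀ A : Matrix (Fin r) (Fin r) (ZInv N),
      (∃ c, valMatrix (gen_mem_chartZ hN) c = ratMatrix N r A) ↔
        ∃ B : Matrix (Fin r) (Fin r) ℤ, B.map (algebraMap ℤ (ZInv N)) = A := by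
    refine fun A => ⟨fun ⟨c, hc⟩ => ?_, fun ⟨B, hB⟩ => ?_⟩
    · choose B hB using fun i => exists_int_val_eq (gen_mem_chartZ hN) hN le_rfl (c i)
      exact ⟨Matrix.of B, ratMatrix_injective (hc ▸ Matrix.ext fun i j => (hB i j).symm)⟩
    · choose c hc using fun i => exists_val_eq_int (gen_mem_chartZ hN) hN le_rfl (B i)
      exact ⟨c, hB ▸ funext hc⟩
  rw [isMatrixOver_iff, mem_GLZ_iff, exists_valMatrix_eq_iff, exists_valMatrix_eq_iff]

lemma describes_iff (hN : 1 < N) {A : Matrix (Fin r) (Fin r) (ZInv N)} :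
    Describes A E ↔ ∃ (e : Fin r → E.obj (chartA hN)) (f : Fin r → E.obj (chartZ hN))
      (c : Fin r → ((SpecZHat N).O (chartA hN ⊓ chartZ hN)).op r),
      IsBasis E (chartA hN) e ∧ IsBasis E (chartZ hN) f ∧ IsTransition c e f ∧
        valMatrix (gen_mem_inf (gen_mem_chartA hN) (gen_mem_chartZ hN)) c = ratMatrix N r A := by
  constructor
  · rintro ⟨U, V, hU, hV, e, f, h⟩
    obtain rfl : U = chartA hN := Opens.ext hU
    obtain rfl : V = chartZ hN := Opens.ext hV
    choose c hc hef using h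
    exact ⟨e.basis, f.basis, c, e.isBasis, f.isBasis, hef,
      funext fun i => (pullsBackTo_iff _ (c i) (A i)).1 (hc i)⟩
  · rintro ⟨e, f, c, he, hf, hef, hc⟩
    refine ⟨chartA hN, chartZ hN, rfl, rfl, he.trivialization, hf.trivialization, fun i =>
      ⟨c i, (pullsBackTo_iff _ _ _).2 (congrFun hc i), ?_⟩⟩
    rw [he.basis_trivialization, hf.basis_trivialization]
    exact hef i

lemma exists_matrix_describes (hN : 1 < N) (hE : E.IsVectorBundle r) :
    ∃ A : GL (Fin r) (ZInv N), Describes A.1 E := by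
  obtain ⟨e, he⟩ := exists_isBasis_chartA hN hE
  obtain ⟨f, hf⟩ := exists_isBasis_chartZ hN hE
  obtain ⟨c, d, hcd, hef⟩ := exists_isTransition he hf
  obtain ⟨A, -, hA⟩ := exists_valMatrix_eq_of_isInverse
    (hU := gen_mem_inf (gen_mem_chartA hN) (gen_mem_chartZ hN)) hN le_rfl hcd
  exact ⟨A, (describes_iff hN).2 ⟨e, f, c, he, hf, hef, hA⟩⟩

lemma exists_bundle_describes (hN : 1 < N) (A : GL (Fin r) (ZInv N)) :
    ∃ E : GenVectorBundle (SpecZHat N) r, Describes A.1 E.1 := by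
  obtain ⟨c, d, hcd, hA⟩ := isMatrixOver_chartA_inf_chartZ hN A
  exact ⟨⟨glued c, isVectorBundle_of_sup_eq_top (chartA_sup_chartZ hN) isBasis_gluedLeft
    (isBasis_gluedRight hcd)⟩, (describes_iff hN).2 ⟨gluedLeft c, gluedRight hcd, c,
      isBasis_gluedLeft, isBasis_gluedRight hcd, isTransition_glued hcd, hA⟩⟩

lemma isIsoTo_of_describes (hN : 1 < N) {A : Matrix (Fin r) (Fin r) (ZInv N)}
    (hE : Describes A E) (hF : Describes A F) : IsIsoTo E F := by
  obtain ⟨e, f, c, he, hf, hef, hc⟩ := (describes_iff hN).1 hE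
  obtain ⟨e', f', c', he', hf', hef', hc'⟩ := (describes_iff hN).1 hF
  obtain rfl : c = c' := valMatrix_injective (hc.trans hc'.symm)
  exact isIsoTo_of_isTransition (chartA_sup_chartZ hN) he hf he' hf' hef hef'

lemma describes_of_isIsoTo (hN : 1 < N) {A : Matrix (Fin r) (Fin r) (ZInv N)}
    (hE : Describes A E) (h : IsIsoTo E F) : Describes A F := by
  obtain ⟨e, f, c, he, hf, hef, hc⟩ := (describes_iff hN).1 hE
  obtain ⟨φ, ψ, h₁, h₂⟩ := h
  exact (describes_iff hN).2 ⟨_, _, c, he.map h₁ h₂, hf.map h₁ h₂, hef.map φ, hc⟩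

lemma valMatrix_change {U V : Opens (SpecZHat N).carrier} (hU : gen N ∈ U) (hV : gen N ∈ V)
    {p : Fin r → ((SpecZHat N).O U).op r} {c : Fin r → ((SpecZHat N).O (U ⊓ V)).op r}
    {q : Fin r → ((SpecZHat N).O V).op r} {P A Q : Matrix (Fin r) (Fin r) (ZInv N)}
    (hp : valMatrix hU p = ratMatrix N r P)
    (hc : valMatrix (gen_mem_inf hU hV) c = ratMatrix N r A)
    (hq : valMatrix hV q = ratMatrix N r Q) :
    valMatrix (gen_mem_inf hU hV) (fun i => ((SpecZHat N).O (U ⊓ V)).subst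
      (((SpecZHat N).O (U ⊓ V)).subst (((SpecZHat N).res inf_le_left).app (p i)) c)
      (fun j => ((SpecZHat N).res inf_le_right).app (q j))) = ratMatrix N r (P * A * Q) := by
  rw [valMatrix_subst, valMatrix_subst, map_mul, map_mul, ← hp, ← hc, ← hq]
  rfl

lemma describes_mul (hN : 1 < N) {A P Q : GL (Fin r) (ZInv N)} (hP : P ∈ Oct N r)
    (hQ : Q ∈ GLZ N r) (h : Describes A.1 E) : Describes (P * A * Q).1 E := by
  obtain ⟨e, f, c, he, hf, hef, hc⟩ := (describes_iff hN).1 h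
  obtain ⟨p, p', hpp', hp⟩ := (isMatrixOver_chartA_iff hN).2 hP
  obtain ⟨q, q', hqq', hq⟩ := (isMatrixOver_chartZ_iff hN).2 hQ
  refine (describes_iff hN).2 ⟨_, _, _, he.change hpp', hf.change hqq'.symm,
    hef.change (fun i => rfl) (q := q) fun j => ?_, valMatrix_change _ _ hp hc hq⟩
  rw [← (E.str _).act_assoc, hqq'.1, (E.str _).var_act]

lemma exists_eq_mul_of_describes (hN : 1 < N) {A A' : GL (Fin r) (ZInv N)}
    (h : Describes A.1 E) (h' : Describes A'.1 E) :
    ∃ P ∈ Oct N r, ∃ Q ∈ GLZ N r, A' = P * A * Q := by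
  obtain ⟨e, f, c, he, hf, hef, hc⟩ := (describes_iff hN).1 h
  obtain ⟨e', f', c', he', hf', hef', hc'⟩ := (describes_iff hN).1 h'
  obtain ⟨P, hP, hp⟩ := exists_valMatrix_eq_of_isInverse (hU := gen_mem_chartA hN) hN inf_le_left
    (he.isInverse_coord he')
  obtain ⟨Q, hQ, hq⟩ := exists_valMatrix_eq_of_isInverse (hU := gen_mem_chartZ hN) hN inf_le_right
    (hf'.isInverse_coord hf)
  have hef'' := hef.change (fun i => by simpa only [E.res_self] using he.act_coord le_rfl (e' i))
    (fun j => by simpa only [E.res_self] using hf'.act_coord le_rfl (f j))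
  refine ⟨P, (isMatrixOver_chartA_iff hN).1 hP, Q, (isMatrixOver_chartZ_iff hN).1 hQ,
    Units.ext (ratMatrix_injective ?_)⟩
  rw [← hc', hef'.unique hf' hef'']
  exact valMatrix_change _ _ hp hc hq

end SpecZHat

/-! ### Isomorphism classes and double cosets -/

lemma exists_equiv_of_surjective {α κ κ' : Type*} {p : α → κ} {q : α → κ'}
    (hp : Function.Surjective p) (hq : Function.Surjective q)
    (h : ∀ a b, p a = p b ↔ q a = q b) : ∃ Λ : κ ≃ κ', ∀ a, Λ (p a) = q a := by
  refine ⟨(Setoid.quotientKerEquivOfSurjective p hp).symm.trans ((Quotient.congrRight h).trans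
    (Setoid.quotientKerEquivOfSurjective q hq)), fun a => ?_⟩
  have : (Setoid.quotientKerEquivOfSurjective p hp).symm (p a) = Quotient.mk _ a :=
    (Equiv.symm_apply_eq _).2 rfl
  rw [Equiv.trans_apply, this]
  rfl

lemma exists_equiv_of_relation {α β κ κ' : Type*} {p : α → κ} {q : β → κ'}
    (hp : Function.Surjective p) (hq : Function.Surjective q) {D : α → β → Prop}
    (left_total : ∀ a, ∃ b, D a b) (right_total : ∀ b, ∃ a, D a b)
    (eq_iff : ∀ {a b a' b'}, D a b → D a' b' → (p a = p a' ↔ q b = q b'))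
    (of_eq : ∀ {a b b'}, D a b → q b = q b' → D a b') :
    ∃ Φ : κ ≃ κ', ∀ a b, Φ (p a) = q b ↔ D a b := by
  have hp' : Function.Surjective fun x : {x : α × β // D x.1 x.2} => p x.1.1 :=
    hp.comp fun a => let ⟨b, h⟩ := left_total a; ⟨⟨(a, b), h⟩, rfl⟩
  have hq' : Function.Surjective fun x : {x : α × β // D x.1 x.2} => q x.1.2 :=
    hq.comp fun b => let ⟨a, h⟩ := right_total b; ⟨⟨(a, b), h⟩, rfl⟩
  obtain ⟨Φ, hΦ⟩ := exists_equiv_of_surjective hp' hq' fun x y => eq_iff x.2 y.2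
  refine ⟨Φ, fun a b => ⟨fun h => ?_, fun h => hΦ ⟨(a, b), h⟩⟩⟩
  obtain ⟨b', hb'⟩ := left_total a
  exact of_eq hb' ((hΦ ⟨(a, b'), hb'⟩).symm.trans h)

section DoubleCoset

variable {G G' : Type*} [Group G] [Group G']

lemma doubleCosetMk_surjective (H K : Subgroup G) : Function.Surjective (DoubleCoset.mk H K) :=
  Quotient.mk''_surjective

lemma doubleCosetMk_map_eq_iff (e : G ≃* G') {H K : Subgroup G} {H' K' : Subgroup G'}
    (hH : ∀ {g}, e g ∈ H' ↔ g ∈ H) (hK : ∀ {g}, e g ∈ K' ↔ g ∈ K) {a b : G} :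
    DoubleCoset.mk H' K' (e a) = DoubleCoset.mk H' K' (e b) ↔
      DoubleCoset.mk H K a = DoubleCoset.mk H K b := by
  simp only [DoubleCoset.eq, e.surjective.exists, hH, hK, ← map_mul, e.injective.eq_iff]

lemma doubleCosetMk_ker_eq_iff (f : G →* G') {a b : G} :
    DoubleCoset.mk f.ker f.ker a = DoubleCoset.mk f.ker f.ker b ↔ f a = f b := by
  refine ⟨fun h => ?_, fun h => ?_⟩
  · obtain ⟨x, hx, y, hy, rfl⟩ := (DoubleCoset.eq _ _ _ _).1 h
    rw [map_mul, map_mul, f.mem_ker.1 hx, f.mem_ker.1 hy, one_mul, mul_one]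
  · exact (DoubleCoset.eq _ _ _ _).2 ⟨1, one_mem _, a⁻¹ * b, f.eq_iff.1 h.symm, by group⟩

end DoubleCoset

/-- A unit as an invertible `1 × 1` matrix. -/
def unitMatrix {R : Type*} [CommRing R] : Rˣ ≃* GL (Fin 1) R :=
  Units.mapEquiv (Matrix.uniqueRingEquiv (m := Fin 1) (A := R)).symm.toMulEquiv

section Abs

variable {R : Type*} [CommRing R] [LinearOrder R] [IsStrictOrderedRing R]

/-- The absolute value as a map from the units to the positive units. -/
def absUnit : Rˣ →* Units.posSubgroup R :=
  (Units.map ((absHom : R →*₀ R) : R →* R)).codRestrict (Units.posSubgroup R)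
    fun l => abs_pos.2 l.ne_zero

lemma absUnit_surjective : Function.Surjective (absUnit (R := R)) := fun u =>
  ⟨u.1, Subtype.ext (Units.ext (abs_of_pos u.2))⟩

lemma absUnit_eq_one_iff {l : Rˣ} : absUnit l = 1 ↔ |(l : R)| = 1 := by
  rw [Subtype.ext_iff, Units.ext_iff]
  rfl

end Abs

namespace SpecZHat

open OModule

variable {N r : ℕ}

lemma exists_equiv_doubleCoset (hN : 1 < N) (r : ℕ) :
    ∃ Φ : GenVectorBundleClass (SpecZHat N) r ≃
        DoubleCoset.Quotient (Oct N r : Set (GL (Fin r) (ZInv N))) (GLZ N r),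
      ∀ (E : GenVectorBundle (SpecZHat N) r) (A : GL (Fin r) (ZInv N)),
        Φ E.cls = DoubleCoset.mk (Oct N r) (GLZ N r) A ↔ Describes A.1 E.1 := by
  have of_mk_eq : ∀ {E : GenVectorBundle (SpecZHat N) r} {A B : GL (Fin r) (ZInv N)},
      Describes A.1 E.1 →
        DoubleCoset.mk (Oct N r) (GLZ N r) A = DoubleCoset.mk (Oct N r) (GLZ N r) B →
          Describes B.1 E.1 := fun hE h => by
    obtain ⟨P, hP, Q, hQ, rfl⟩ := (DoubleCoset.eq _ _ _ _).1 h
    exact describes_mul hN hP hQ hE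
  refine exists_equiv_of_relation (p := GenVectorBundle.cls) Quotient.mk_surjective
    (doubleCosetMk_surjective _ _) (fun E => exists_matrix_describes hN E.2)
    (exists_bundle_describes hN) (fun {E A F B} hE hF => ⟨fun h => ?_, fun h => ?_⟩) of_mk_eq
  · exact (DoubleCoset.eq _ _ _ _).2 (exists_eq_mul_of_describes hN
      (describes_of_isIsoTo hN hE (Quotient.exact h)) hF)
  · exact Quotient.sound (isIsoTo_of_describes hN (of_mk_eq hE h) hF)

/-! ### Line bundles -/

lemma mem_pmOne_iff {l : (ZInv N)ˣ} : l ∈ pmOne N ↔ |(l : ZInv N)| = 1 := by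
  constructor
  · rintro ⟨k, rfl⟩
    obtain h | h := Int.even_or_odd k <;> simp [h.neg_one_zpow]
  · intro h
    obtain h | h := eq_or_eq_neg_of_abs_eq h
    · exact (show l = 1 from Units.ext h) ▸ one_mem _
    · exact (show l = -1 from Units.ext h) ▸ Subgroup.mem_zpowers _

lemma unitMatrix_mem_Oct_iff {l : (ZInv N)ˣ} : unitMatrix l ∈ Oct N 1 ↔ l ∈ pmOne N := by
  have abs_mul_abs_inv : |(l : ZInv N)| * |((l⁻¹ : (ZInv N)ˣ) : ZInv N)| = 1 := by
    rw [← abs_mul, Units.mul_inv, abs_one]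
  have mem_Oct_iff_abs_le : unitMatrix l ∈ Oct N 1 ↔
      |(l : ZInv N)| ≤ 1 ∧ |((l⁻¹ : (ZInv N)ˣ) : ZInv N)| ≤ 1 := by
    rw [mem_Oct_iff, ← map_inv]
    simp only [Fin.forall_fin_one, Fin.sum_univ_one]
    rfl
  rw [mem_Oct_iff_abs_le, mem_pmOne_iff]
  refine ⟨fun ⟨h, h'⟩ => h.antisymm ?_, fun h => ⟨h.le, ?_⟩⟩
  · exact abs_mul_abs_inv ▸ mul_le_of_le_one_right (abs_nonneg _) h'
  · rw [h, one_mul] at abs_mul_abs_inv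
    exact abs_mul_abs_inv.le

lemma unitMatrix_mem_GLZ_iff {l : (ZInv N)ˣ} : unitMatrix l ∈ GLZ N 1 ↔ l ∈ pmOne N := by
  constructor
  · rintro ⟨Z, hZ⟩
    have hl : (l : ZInv N) = algebraMap ℤ (ZInv N) (unitMatrix.symm Z : ℤˣ) :=
      (congrArg (fun A : GL (Fin 1) (ZInv N) => A.1 0 0) hZ).symm
    rw [mem_pmOne_iff, hl]
    obtain h | h := Int.units_eq_one_or (unitMatrix.symm Z) <;> simp [h]
  · rintro ⟨k, rfl⟩
    have unitMatrix_neg_one : unitMatrix (-1 : (ZInv N)ˣ) ∈ GLZ N 1 :=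
      ⟨unitMatrix (-1 : ℤˣ), Units.ext (Matrix.ext fun i j =>
        (map_neg (algebraMap ℤ (ZInv N)) 1).trans (congrArg _ (map_one _)))⟩
    exact (map_zpow (unitMatrix (R := ZInv N)) _ k).symm ▸ zpow_mem unitMatrix_neg_one k

lemma ker_absUnit : (absUnit (R := ZInv N)).ker = pmOne N :=
  Subgroup.ext fun _ => absUnit_eq_one_iff.trans mem_pmOne_iff.symm

lemma exists_equiv_pic (hN : 1 < N) :
    ∃ Ψ : Pic (SpecZHat N) ≃ DoubleCoset.Quotient (pmOne N : Set (ZInv N)ˣ) (pmOne N),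
      ∀ (L : GenVectorBundle (SpecZHat N) 1) (l : (ZInv N)ˣ),
        Ψ L.cls = DoubleCoset.mk (pmOne N) (pmOne N) l ↔
          Describes (Matrix.of fun _ _ : Fin 1 => (l : ZInv N)) L.1 := by
  obtain ⟨Φ, hΦ⟩ := exists_equiv_doubleCoset hN 1
  obtain ⟨Λ, hΛ⟩ := exists_equiv_of_surjective
    ((doubleCosetMk_surjective (Oct N 1) (GLZ N 1)).comp unitMatrix.surjective)
    (doubleCosetMk_surjective (pmOne N) (pmOne N))
    fun l l' => doubleCosetMk_map_eq_iff unitMatrix unitMatrix_mem_Oct_iff unitMatrix_mem_GLZ_iff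
  refine ⟨Φ.trans Λ, fun L l => ?_⟩
  rw [← hΛ l, Equiv.trans_apply, Λ.injective.eq_iff]
  exact hΦ L (unitMatrix l)

variable (N) in
lemma exists_equiv_posSubgroup :
    ∃ Λ : DoubleCoset.Quotient (pmOne N : Set (ZInv N)ˣ) (pmOne N) ≃
        Additive (Units.posSubgroup (ZInv N)),
      ∀ l, Λ (DoubleCoset.mk (pmOne N) (pmOne N) l) = Additive.ofMul (absUnit l) := by
  refine exists_equiv_of_surjective (doubleCosetMk_surjective _ _)
    (Additive.ofMul.surjective.comp absUnit_surjective) fun l l' => ?_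
  rw [← ker_absUnit]
  exact (doubleCosetMk_ker_eq_iff _).trans Additive.ofMul.injective.eq_iff.symm

variable {L L' T : OModule (SpecZHat N)} {l l' : (ZInv N)ˣ}

lemma exists_unit_describes (hN : 1 < N) (hL : L.IsVectorBundle 1) :
    ∃ l : (ZInv N)ˣ, Describes (Matrix.of fun _ _ : Fin 1 => (l : ZInv N)) L :=
  unitMatrix.surjective.exists.1 (exists_matrix_describes hN hL)

lemma isTensorProduct_of_describes (hN : 1 < N)
    (hL : Describes (Matrix.of fun _ _ : Fin 1 => (l : ZInv N)) L)
    (hL' : Describes (Matrix.of fun _ _ : Fin 1 => (l' : ZInv N)) L')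
    (hT : Describes (Matrix.of fun _ _ : Fin 1 => ((l * l' : (ZInv N)ˣ) : ZInv N)) T) :
    IsTensorProduct L L' T := by
  obtain ⟨e, f, c, he, hf, hef, hc⟩ := (describes_iff hN).1 hL
  obtain ⟨e', f', c', he', hf', hef', hc'⟩ := (describes_iff hN).1 hL'
  obtain ⟨e'', f'', c'', he'', hf'', hef'', hc''⟩ := (describes_iff hN).1 hT
  have valMatrix_mul : valMatrix (gen_mem_inf (gen_mem_chartA hN) (gen_mem_chartZ hN))
      (fun i => c i * c' i) = ratMatrix N 1 (unitMatrix (l * l')).1 := by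
    rw [map_mul unitMatrix, Units.val_mul, map_mul]
    refine Eq.trans ?_ ((valMatrix_subst _ c c').trans (congrArg₂ _ hc hc'))
    exact congrArg _ (funext fun i => congrArg (GenRing.subst _ (c i))
      (funext fun j => congrArg c' (Subsingleton.elim i j)))
  have hcc' : c'' = fun i => c i * c' i := valMatrix_injective (hc''.trans valMatrix_mul.symm)
  exact isTensorProduct_of_isTransition (chartA_sup_chartZ hN) he hf he' hf' he'' hf'' hef hef'
    (hcc' ▸ hef'')

lemma exists_isTensorProduct (hN : 1 < N)
    (hL : Describes (Matrix.of fun _ _ : Fin 1 => (l : ZInv N)) L)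
    (hL' : Describes (Matrix.of fun _ _ : Fin 1 => (l' : ZInv N)) L') :
    ∃ T : GenVectorBundle (SpecZHat N) 1, IsTensorProduct L L' T.1 ∧
      Describes (Matrix.of fun _ _ : Fin 1 => ((l * l' : (ZInv N)ˣ) : ZInv N)) T.1 := by
  obtain ⟨T, hT⟩ := exists_bundle_describes hN (unitMatrix (l * l'))
  exact ⟨T, isTensorProduct_of_describes hN hL hL' hT, hT⟩

lemma describes_mul_of_isTensorProduct (hN : 1 < N)
    (hL : Describes (Matrix.of fun _ _ : Fin 1 => (l : ZInv N)) L)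
    (hL' : Describes (Matrix.of fun _ _ : Fin 1 => (l' : ZInv N)) L')
    (hT : IsTensorProduct L L' T) : T.IsVectorBundle 1 ∧
      Describes (Matrix.of fun _ _ : Fin 1 => ((l * l' : (ZInv N)ˣ) : ZInv N)) T := by
  obtain ⟨T', hT', hdesc⟩ := exists_isTensorProduct hN hL hL'
  have hiso : IsIsoTo T'.1 T := hT'.isIsoTo hT
  exact ⟨T'.2.of_isIsoTo hiso, describes_of_isIsoTo hN hdesc hiso⟩

end SpecZHat

end

theorem proposition3p5 (N : ℕ) (hN : 1 < N) :
    (∀ r : ℕ, ∃ Φ : GenVectorBundleClass (SpecZHat N) r ≃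
        DoubleCoset.Quotient (Oct N r : Set (GL (Fin r) (ZInv N))) (GLZ N r),
      ∀ (E : GenVectorBundle (SpecZHat N) r) (A : GL (Fin r) (ZInv N)),
        Φ E.cls = DoubleCoset.mk (Oct N r) (GLZ N r) A ↔ Describes A.1 E.1) ∧
    ∃ _ : AddCommGroup (Pic (SpecZHat N)),
      (∀ L L' : GenVectorBundle (SpecZHat N) 1, ∃ T, OModule.IsTensorProduct L.1 L'.1 T) ∧
      (∀ (L L' : GenVectorBundle (SpecZHat N) 1) (T : OModule (SpecZHat N)),
        OModule.IsTensorProduct L.1 L'.1 T →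
          ∃ hT : T.IsVectorBundle 1, GenVectorBundle.cls ⟨T, hT⟩ = L.cls + L'.cls) ∧
      ∃ (Ψ : Pic (SpecZHat N) ≃
            DoubleCoset.Quotient (pmOne N : Set (ZInv N)ˣ) (pmOne N))
        (Λ : DoubleCoset.Quotient (pmOne N : Set (ZInv N)ˣ) (pmOne N) ≃
            Additive (Units.posSubgroup (ZInv N))),
        (∀ (L : GenVectorBundle (SpecZHat N) 1) (l : (ZInv N)ˣ),
          Ψ L.cls = DoubleCoset.mk (pmOne N) (pmOne N) l ↔
            Describes (Matrix.of fun _ _ : Fin 1 => (l : ZInv N)) L.1) ∧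
        (∀ l : (ZInv N)ˣ, (((Λ (DoubleCoset.mk (pmOne N) (pmOne N) l)).toMul :
          (ZInv N)ˣ) : ZInv N) = |(l : ZInv N)|) ∧
        ∀ a b : Pic (SpecZHat N), Λ (Ψ (a + b)) = Λ (Ψ a) + Λ (Ψ b) := by
  refine ⟨SpecZHat.exists_equiv_doubleCoset hN, ?_⟩
  obtain ⟨Ψ, hΨ⟩ := SpecZHat.exists_equiv_pic hN
  obtain ⟨Λ, hΛ⟩ := SpecZHat.exists_equiv_posSubgroup N
  let G : AddCommGroup (Pic (SpecZHat N)) := (Ψ.trans Λ).addCommGroup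
  have map_add : ∀ a b : Pic (SpecZHat N), Λ (Ψ (a + b)) = Λ (Ψ a) + Λ (Ψ b) :=
    fun a b => (Ψ.trans Λ).apply_symm_apply _
  refine ⟨G, fun L L' => ?_, fun L L' T hT => ?_, Ψ, Λ, hΨ, fun l => by rw [hΛ]; rfl, map_add⟩
  · obtain ⟨l, hl⟩ := SpecZHat.exists_unit_describes hN L.2
    obtain ⟨l', hl'⟩ := SpecZHat.exists_unit_describes hN L'.2
    obtain ⟨T, hT, -⟩ := SpecZHat.exists_isTensorProduct hN hl hl'
    exact ⟨T.1, hT⟩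
  · obtain ⟨l, hl⟩ := SpecZHat.exists_unit_describes hN L.2
    obtain ⟨l', hl'⟩ := SpecZHat.exists_unit_describes hN L'.2
    obtain ⟨hT₁, hll'⟩ := SpecZHat.describes_mul_of_isTensorProduct hN hl hl' hT
    refine ⟨hT₁, (Ψ.trans Λ).injective ?_⟩
    change Λ (Ψ _) = Λ (Ψ _)
    rw [map_add, (hΨ L l).2 hl, (hΨ L' l').2 hl', (hΨ ⟨T, hT₁⟩ (l * l')).2 hll', hΛ, hΛ, hΛ,
      map_mul, ofMul_mul]
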